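/- Let $S$ be a closed oriented smooth surface with universal covering $\widetilde S\to S$ and deck group $\pi_1(S)$. A \emph{complex metric} on $S$ is a smooth non-degenerate symmetric $\mathbb C$-bilinear form $g$ on $\mathbb C TS=TS\otimes\mathbb C$; it is \emph{positive} if at each point $p$ no isotropic direction of $g_p$ is real and its two isotropic directions lie in different components of $\mathbb P(\mathbb C T_pS)\setminus\mathbb P(T_pS)$. Its Levi-Civita connection $\nabla^g$, Gauss curvature $\mathrm K_g$, Laplacian $\Delta_g=\mathrm{tr}_g\mathrm{Hess}_g$ and induced pairing of tensors are defined by the formulas of Riemannian geometry. Let $c_1$ and $\overline{c_2}$ be complex structures on $S$ inducing the given and the opposite orientation respectively; $g$ has conformal class $(c_1,\overline{c_2})$ if $g=\lambda\,dz\,d\overline w$, $\lambda\neq0$, for holomorphic coordinates $z$ of $c_1$ and $\overline w$ of $\overline{c_2}$, where $dz\,d\overline w=\frac12(dz\otimes d\overline w+d\overline w\otimes dz)$. The metric volume form of such a $g$ compatible with the orientation is $dV_g=\frac i2\lambda\,dz\wedge d\overline w$. A map $\sigma\colon\widetilde S\to\mathbb C^3$ with transversal field $\xi\colon\widetilde S\to\mathbb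 C^3$ (both smooth, and $\sigma_*(\mathbb CT\widetilde S)\oplus\mathbb C\xi=\mathbb C^3$ at each point, with $\sigma_*$ injective on $\mathbb CT\widetilde S$), equivariant for some $\rho\colon\pi_1(S)\to\mathrm{SL}(3,\mathbb C)$, is decomposed as $$D_XY=\nabla_XY+g(X,Y)\,\xi,\qquad D_X\xi=-\mathsf S(X)+\tau(X)\,\xi .$$ It is a \emph{positive hyperbolic complex affine sphere} with Blaschke metric $g$ if $g$ is a positive complex metric, the form $\theta=\omega(\cdot,\cdot,\xi)$, $\omega=dz_1\wedge dz_2\wedge dz_3$, satisfies $\nabla\theta=0$ and $\theta=dV_g$, and $\mathsf S=-\mathrm{id}$. The affine normals then meet in one point, which is normalized to be the origin, so that $\xi=\sigma$. The Pick tensor is $C(X,Y,Z)=-2g(\nabla_XY-\nabla^g_XY,Z)$. Let $\mathcal Q_1$ and $\overline{\mathcal Q_2}$ be holomorphic cubic differentials for $c_1$ and $\overline{c_2}$ respectively. (1) Let $g$ be a positive complex metric on $S$ with conformal class $(c_1,\overline{c_2})$. There exists an equivariant positive hyperbolic complex affine sphere $\sigma\colon\widetilde S\to\mathbb C^3$ with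 holonomy in $\mathrm{SL}(3,\mathbb C)$, Blaschke metric $g$ and Pick tensor $\mathcal Q_1+\overline{\mathcal Q_2}$ if and only if $$\mathrm K_g=-1+\tfrac14\,g(\mathcal Q_1,\overline{\mathcal Q_2}).$$ Moreover, any two such complex affine spheres differ by composition with an element of $\mathrm{SL}(3,\mathbb C)$. (2) Let $h$ be the Bers metric of $(c_1,\overline{c_2})$, that is, $h=-\frac{4}{(f_1-\overline{f_2})^2}\,df_1\,d\overline{f_2}$, where $f_1\colon(\widetilde S,c_1)\to\Omega^+$ and $\overline{f_2}\colon(\widetilde S,\overline{c_2})\to\Omega^-$ are biholomorphisms, equivariant for a homomorphism $\pi_1(S)\to\mathrm{PSL}(2,\mathbb C)$ that preserves a Jordan curve in $\mathbb{CP}^1$, onto the two domains complementary to the curve. Let $u\colon S\to\mathbb C$ be smooth. Then $g=e^{2u}h$ and $C=\mathcal Q_1+\overline{\mathcal Q_2}$ are the Blaschke metric and the Pick tensor of an equivariant positive hyperbolic complex affine sphere in $\mathbb C^3$ if and only if $$\Delta_hu-e^{2u}+\tfrac14\,h(\mathcal Q_1,\overline{\mathcal Q_2})\,e^{-4u}+1=0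 .$$ -/

import Mathlib

/-!
In null coordinates `z` of `c₁` and `w` of `c₂` (holomorphic for the opposite orientation) a metric
of conformal class `(c₁, c₂)` is `λ dz dw`, and the equations of a sphere with Pick tensor
`φ dz³ + ψ dw³` say that the frame `(∂_z σ, ∂_w σ, σ)` solves a linear total differential system
whose coefficients are built from `λ`, `φ` and `ψ`. Once `φ` and `ψ` are holomorphic, flatness of
this system is exactly the Gauss equation. By Frobenius, a flat system has a solution near every
point with prescribed initial frame, so that local spheres exist and any two differ by a unique
element of `SL(3, ℂ)`, the determinant being pinned down by the volume normalization. The changes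
between local spheres thus form a locally constant cocycle on the universal cover; its associated
covering space has a section because the base is simply connected, and the section glues the local
spheres. Equivariance is uniqueness applied to the sphere and its composition with a deck
transformation.

The Bers metric has curvature `-1`, because it is the pullback of the constant curvature metric
`-4 dx dy / (x - y)²` under `(f₁, f₂)`. The conformal change formula for the curvature of `e²ᵘ h`
then turns the Gauss equation into the partial differential equation for `u`.
-/

open scoped Manifold ContDiff Topology
open Set

noncomputable section

namespace CAS

/-! ### Calculus in coordinates -/

/-- The model plane `ℝ²`. -/
abbrev Plane : Type := EuclideanSpace ℝ (Fin 2)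

/-- The partial derivative `∂ᵢ f` of a vector-valued function on the plane. -/
def pd {V : Type*} [NormedAddCommGroup V] [NormedSpace ℝ V]
    (i : Fin 2) (f : Plane → V) (y : Plane) : V :=
  fderiv ℝ f y (EuclideanSpace.single i 1)

/-- Christoffel symbols `Γᵏᵢⱼ` of the Levi-Civita connection of a complex metric `∑ Gᵢⱼ dxᵢ dxⱼ`. -/
def christoffel (G : Plane → Matrix (Fin 2) (Fin 2) ℂ) (k i j : Fin 2) (y : Plane) : ℂ :=
  (1 / 2) * ∑ l, (G y)⁻¹ k l *
    (pd i (fun y' => G y' j l) y + pd j (fun y' => G y' i l) y - pd l (fun y' => G y' i j) y)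

/-- The `∂ₗ`-component of `R(∂ᵢ, ∂ⱼ)∂ₖ`, where `R(X, Y)Z = ∇_X ∇_Y Z - ∇_Y ∇_X Z - ∇_[X,Y] Z`
for the Levi-Civita connection of `G`. -/
def riemann (G : Plane → Matrix (Fin 2) (Fin 2) ℂ) (l i j k : Fin 2) (y : Plane) : ℂ :=
  pd i (christoffel G l j k) y - pd j (christoffel G l i k) y
    + ∑ m, (christoffel G l i m y * christoffel G m j k y
      - christoffel G l j m y * christoffel G m i k y)

/-- Gauss curvature `g(R(∂₀, ∂₁)∂₁, ∂₀) / (g₀₀ g₁₁ - g₀₁²)`. -/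
def curvature (G : Plane → Matrix (Fin 2) (Fin 2) ℂ) (y : Plane) : ℂ :=
  (∑ l, riemann G l 0 1 1 y * G y l 0) / (G y).det

/-- The Laplacian: the `G`-trace of the Hessian `∂ᵢ∂ⱼf - Γᵏᵢⱼ ∂ₖf`. -/
def laplacian (G : Plane → Matrix (Fin 2) (Fin 2) ℂ) (f : Plane → ℂ) (y : Plane) : ℂ :=
  ∑ i, ∑ j, (G y)⁻¹ i j * (pd i (pd j f) y - ∑ k, christoffel G k i j y * pd k f y)

/-- A complex vector `v₀∂₀ + v₁∂₁` is isotropic for the symmetric bilinear form `G`. -/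
def IsIsotropic (G : Matrix (Fin 2) (Fin 2) ℂ) (v : Fin 2 → ℂ) : Prop :=
  v ⬝ᵥ G.mulVec v = 0

/-- `Im(v̄₀ v₁)`. It vanishes exactly when the complex line spanned by `v ≠ 0` is the
complexification of a real line, and its sign tells the two components of `ℙ(ℂ²) ∖ ℙ(ℝ²)`
apart (it is positive at `∂₀ + i∂₁`, which is proportional to the vector field `∂/∂z̄` of the
standard complex structure). -/
def side (v : Fin 2 → ℂ) : ℝ := ((starRingEnd ℂ) (v 0) * v 1).im

/-- Positivity of a complex bilinear form on `ℂ ⊗ ℝ²`: no isotropic direction is real, and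
the two components of the complement of the real directions each contain one. -/
def IsPositiveForm (G : Matrix (Fin 2) (Fin 2) ℂ) : Prop :=
  (∀ v, v ≠ 0 → IsIsotropic G v → side v ≠ 0) ∧
  (∃ v, IsIsotropic G v ∧ 0 < side v) ∧ (∃ v, IsIsotropic G v ∧ side v < 0)

/-- `s dx₀ ∧ dx₁` is the metric volume form of the positive form `G` compatible with the
orientation: `s² = det G`, and the square root is the one for which
`dV(v, v') = i G(v, v')` when `v`, `v'` are isotropic on the negative and on the positive side.
It is the branch that depends continuously on the positive form `G` and that has `s > 0` when
`G` is a Riemannian metric; for `G = λ dz dw̄` it is the form `(i/2) λ dz ∧ dw̄`. -/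
def IsVolumeCoeff (G : Matrix (Fin 2) (Fin 2) ℂ) (s : ℂ) : Prop :=
  s ^ 2 = G.det ∧
  ∀ v v' : Fin 2 → ℂ, IsIsotropic G v → IsIsotropic G v' → side v < 0 → 0 < side v' →
    s * (v 0 * v' 1 - v 1 * v' 0) = Complex.I * (v ⬝ᵥ G.mulVec v')

/-! ### Tensors on a surface -/

section Tensors

variable {S : Type*} [TopologicalSpace S] [ChartedSpace Plane S]

variable (S) in
/-- The atlas of the surface is oriented: all its transition maps preserve orientation. -/
def IsOrientedAtlas : Prop :=
  ∀ e ∈ atlas Plane S, ∀ e' ∈ atlas Plane S, ∀ y ∈ (e.symm ≫ₕ e').source,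
    0 < (fderiv ℝ (e' ∘ e.symm) y).det

variable (S) in
/-- Covariant `k`-tensor fields on the complexified tangent bundle. A `ℂ`-multilinear form on
`ℂ ⊗ TₓS` is the same as an `ℝ`-multilinear `ℂ`-valued form on `TₓS`. -/
abbrev CTensor (k : ℕ) : Type _ :=
  ∀ x : S, MultilinearMap ℝ (fun _ : Fin k => TangentSpace (𝓡 2) x) ℂ

/-- The components `T(∂_{i₁}, …, ∂_{iₖ})` of a tensor field in the chart `e`, at the point of
the surface with coordinates `y`. -/
def CTensor.coeff {k : ℕ} (T : CTensor S k) (e : OpenPartialHomeomorph S Plane) (y : Plane)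
    (i : Fin k → Fin 2) : ℂ :=
  T (e.symm y) fun a => mfderiv (𝓡 2) (𝓡 2) e.symm y (EuclideanSpace.single (i a) (1 : ℝ))

/-- A tensor field is smooth if its components in all charts are. -/
def CTensor.IsSmooth {k : ℕ} (T : CTensor S k) : Prop :=
  ∀ e ∈ atlas Plane S, ∀ i, ContDiffOn ℝ ∞ (fun y => T.coeff e y i) e.target

/-- The matrix `g(∂ᵢ, ∂ⱼ)` of a bilinear form in the chart `e`. -/
def gram (g : CTensor S 2) (e : OpenPartialHomeomorph S Plane) (y : Plane) :
    Matrix (Fin 2) (Fin 2) ℂ :=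
  Matrix.of fun i j => g.coeff e y ![i, j]

/-- Positive complex metrics: smooth sections of `Sym²(ℂT*S)` that are non-degenerate and
positive at each point. -/
structure IsPositiveComplexMetric (g : CTensor S 2) : Prop where
  symm : ∀ x v w, g x ![v, w] = g x ![w, v]
  smooth : g.IsSmooth
  nondegenerate : ∀ e ∈ atlas Plane S, ∀ y ∈ e.target, (gram g e y).det ≠ 0
  positive : ∀ e ∈ atlas Plane S, ∀ y ∈ e.target, IsPositiveForm (gram g e y)

/-- The pairing `g(Q, Q')` of two cubic tensors, in the chart `e`, induced by `g`. -/
def cubicPairing (g : CTensor S 2) (Q Q' : CTensor S 3)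
    (e : OpenPartialHomeomorph S Plane) (y : Plane) : ℂ :=
  ∑ i : Fin 3 → Fin 2, ∑ j : Fin 3 → Fin 2,
    (∏ a, (gram g e y)⁻¹ (i a) (j a)) * Q.coeff e y i * Q'.coeff e y j

/-- The equation `K_g = -1 + ¼ g(Q₁, Q₂)` on the surface. -/
def GaussEquation (g : CTensor S 2) (Q₁ Q₂ : CTensor S 3) : Prop :=
  ∀ e ∈ atlas Plane S, ∀ y ∈ e.target,
    curvature (gram g e) y = -1 + (1 / 4) * cubicPairing g Q₁ Q₂ e y

/-- The equation `Δ_h u - e^{2u} + ¼ h(Q₁, Q₂) e^{-4u} + 1 = 0` on the surface. -/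
def GaussPDE (h : CTensor S 2) (Q₁ Q₂ : CTensor S 3) (u : S → ℂ) : Prop :=
  ∀ e ∈ atlas Plane S, ∀ y ∈ e.target,
    laplacian (gram h e) (u ∘ e.symm) y - Complex.exp (2 * u (e.symm y))
      + (1 / 4) * cubicPairing h Q₁ Q₂ e y * Complex.exp (-4 * u (e.symm y)) + 1 = 0

/-- The metric `e^{2u} h`. -/
def conformalMetric (u : S → ℂ) (h : CTensor S 2) : CTensor S 2 :=
  fun x => Complex.exp (2 * u x) • h x

/-! ### Complex structures and holomorphic cubic differentials -/

variable (S) in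
/-- A complex structure on the surface, compatible with its smooth structure: an atlas of
complex coordinates that are diffeomorphisms onto open sets of `ℂ`, with holomorphic
transition maps. -/
structure ComplexStructure where
  charts : Set (OpenPartialHomeomorph S ℂ)
  cover : ∀ x, ∃ z ∈ charts, x ∈ z.source
  smooth : ∀ z ∈ charts, ContMDiffOn (𝓡 2) 𝓘(ℝ, ℂ) ∞ z z.source
  smooth_symm : ∀ z ∈ charts, ContMDiffOn 𝓘(ℝ, ℂ) (𝓡 2) ∞ z.symm z.target
  holomorphic : ∀ z ∈ charts, ∀ z' ∈ charts,
    DifferentiableOn ℂ (z' ∘ z.symm) (z.symm ≫ₕ z').source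

/-- The Jacobian determinant, in the chart `e`, of a complex coordinate `z`. -/
def jacobian (z : OpenPartialHomeomorph S ℂ) (e : OpenPartialHomeomorph S Plane)
    (y : Plane) : ℝ :=
  ((starRingEnd ℂ) (pd 0 (z ∘ e.symm) y) * pd 1 (z ∘ e.symm) y).im

/-- The complex structure induces the orientation of `S`. -/
def ComplexStructure.IsCompatible (c : ComplexStructure S) : Prop :=
  ∀ z ∈ c.charts, ∀ e ∈ atlas Plane S, ∀ y ∈ e.target, e.symm y ∈ z.source →
    0 < jacobian z e y

/-- The complex structure induces the opposite orientation, that of `S̄`. -/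
def ComplexStructure.IsAntiCompatible (c : ComplexStructure S) : Prop :=
  ∀ z ∈ c.charts, ∀ e ∈ atlas Plane S, ∀ y ∈ e.target, e.symm y ∈ z.source →
    jacobian z e y < 0

/-- The value `dz(v)` of the differential of a complex coordinate at a tangent vector. -/
def dcoord (z : OpenPartialHomeomorph S ℂ) (x : S) (v : TangentSpace (𝓡 2) x) : ℂ :=
  mfderiv (𝓡 2) 𝓘(ℝ, ℂ) z x v

/-- `g` has conformal class `(c₁, c₂)`: for holomorphic coordinates `z` of `c₁` and `w` of `c₂`
one has `g = λ dz dw` with `λ ≠ 0` (here `dz dw` is the symmetric product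
`½ (dz ⊗ dw + dw ⊗ dz)`). For `c₂` of the opposite orientation, `w` is what is usually
written `w̄`. -/
def HasConformalClass (g : CTensor S 2) (c₁ c₂ : ComplexStructure S) : Prop :=
  ∀ z ∈ c₁.charts, ∀ w ∈ c₂.charts, ∀ x ∈ z.source ∩ w.source, ∃ l : ℂ, l ≠ 0 ∧
    ∀ v v' : TangentSpace (𝓡 2) x, g x ![v, v'] =
      l * ((1 / 2) * (dcoord z x v * dcoord w x v' + dcoord w x v * dcoord z x v'))

/-- Holomorphic cubic differentials: in each coordinate `z` of the complex structure,
`Q = φ dz³` with `φ` holomorphic. -/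
def IsHolomorphicCubic (c : ComplexStructure S) (Q : CTensor S 3) : Prop :=
  ∀ z ∈ c.charts, ∃ φ : ℂ → ℂ, DifferentiableOn ℂ φ z.target ∧
    ∀ x ∈ z.source, ∀ v : Fin 3 → TangentSpace (𝓡 2) x,
      Q x v = φ (z x) * ∏ a, dcoord z x (v a)

end Tensors

/-! ### Universal cover, equivariance -/

section Cover

variable {S M : Type*} [TopologicalSpace S] [ChartedSpace Plane S] [TopologicalSpace M]

/-- The group of deck transformations of `p`, i.e. the fundamental group of `S` when `p` is the
universal covering. -/
def deckGroup (p : M → S) : Subgroup (M ≃ₜ M) where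
  carrier := {d | ∀ x, p (d x) = p x}
  mul_mem' := by
    intro a b ha hb x
    exact (ha (b x)).trans (hb x)
  one_mem' := fun _ => rfl
  inv_mem' := by
    intro a ha x
    have h := ha (a⁻¹ x)
    have h' : a (a⁻¹ x) = x := a.apply_symm_apply x
    rw [h'] at h
    exact h.symm

/-- `κ` is the lift `e ∘ p`, restricted to an open set on which it is injective, of a chart `e`
of the base. The lifts of the charts of an atlas of `S` form the atlas of the covering space
for which `p` is a local diffeomorphism; in such a chart of `M` the components of the pull-back
of a tensor field of `S` are its components in the chart `e`. -/
def IsLift {H : Type*} [TopologicalSpace H] (p : M → S) (e : OpenPartialHomeomorph S H)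
    (κ : OpenPartialHomeomorph M H) : Prop :=
  ∀ x ∈ κ.source, p x ∈ e.source ∧ κ x = e (p x)

/-- Smoothness of a map on the covering space. -/
def SmoothOnCover {V : Type*} [NormedAddCommGroup V] [NormedSpace ℝ V]
    (p : M → S) (f : M → V) : Prop :=
  ∀ e ∈ atlas Plane S, ∀ κ : OpenPartialHomeomorph M Plane, IsLift p e κ →
    ContDiffOn ℝ ∞ (f ∘ κ.symm) κ.target

/-- Holomorphy of a function on the covering space, for the lift of `c`. -/
def HolomorphicOnCover (p : M → S) (c : ComplexStructure S) (f : M → ℂ) : Prop :=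
  ∀ z ∈ c.charts, ∀ ζ : OpenPartialHomeomorph M ℂ, IsLift p z ζ →
    DifferentiableOn ℂ (f ∘ ζ.symm) ζ.target

/-! ### Bers metrics -/

/-- `h` is the Bers metric of the pair `(c₁, c₂)`: there are a quasi-Fuchsian representation `ρ`
(by Möbius transformations preserving a Jordan curve `γ` of the Riemann sphere) and
`ρ`-equivariant biholomorphisms `f₁`, `f₂` from the universal cover, with the lifts of `c₁` and
`c₂`, onto the two domains complementary to `γ`, such that `h` lifts to
`-4 / (f₁ - f₂)² df₁ df₂`. This expression is the same in all affine coordinates of the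
sphere, so a coordinate whose point at infinity lies on `γ` is used. -/
def IsBersMetric (p : M → S) (c₁ c₂ : ComplexStructure S) (h : CTensor S 2) : Prop :=
  ∃ (γ : Circle → OnePoint ℂ) (ρ : deckGroup p →* Equiv.Perm (OnePoint ℂ)) (f₁ f₂ : M → ℂ),
    (Continuous γ ∧ Function.Injective γ ∧ OnePoint.infty ∈ range γ) ∧
    (∀ d, ∃ A : GL (Fin 2) ℂ, ∀ ζ : OnePoint ℂ, ρ d ζ = A • ζ) ∧
    (∀ d, ρ d '' range γ = range γ) ∧
    (HolomorphicOnCover p c₁ f₁ ∧ HolomorphicOnCover p c₂ f₂) ∧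
    (Function.Injective f₁ ∧ Function.Injective f₂) ∧
    Disjoint (range f₁) (range f₂) ∧
    (OnePoint.some '' range f₁ ∪ OnePoint.some '' range f₂ = (range γ)ᶜ) ∧
    (∀ (d : deckGroup p) (x : M), (f₁ (d.1 x) : OnePoint ℂ) = ρ d (f₁ x : OnePoint ℂ) ∧
      (f₂ (d.1 x) : OnePoint ℂ) = ρ d (f₂ x : OnePoint ℂ)) ∧
    ∀ e ∈ atlas Plane S, ∀ κ : OpenPartialHomeomorph M Plane, IsLift p e κ →
      ∀ y ∈ κ.target, ∀ i j : Fin 2, gram h e y i j =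
        -4 / (f₁ (κ.symm y) - f₂ (κ.symm y)) ^ 2 *
          ((1 / 2) * (pd i (f₁ ∘ κ.symm) y * pd j (f₂ ∘ κ.symm) y
            + pd i (f₂ ∘ κ.symm) y * pd j (f₁ ∘ κ.symm) y))

/-! ### Complex affine immersions and complex affine spheres in `ℂ³` -/

/-- `ℂ³`. -/
abbrev C3 : Type := Fin 3 → ℂ

/-- The matrix with columns `∂₀σ`, `∂₁σ`, `ξ`. -/
def frame (σ ξ : Plane → C3) (y : Plane) : Matrix (Fin 3) (Fin 3) ℂ :=
  Matrix.of fun a b => ![pd 0 σ y, pd 1 σ y, ξ y] b a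

/-- The components of a vector of `ℂ³` in the basis `∂₀σ`, `∂₁σ`, `ξ`. -/
def component (σ ξ : Plane → C3) (y : Plane) (v : C3) : Fin 3 → ℂ :=
  (frame σ ξ y)⁻¹.mulVec v

/-- Coefficients `Γᵏᵢⱼ` of the induced connection:
`∂ᵢ∂ⱼσ = ∑ₖ Γᵏᵢⱼ ∂ₖσ + gᵢⱼ ξ`. -/
def inducedConnection (σ ξ : Plane → C3) (k i j : Fin 2) (y : Plane) : ℂ :=
  component σ ξ y (pd i (pd j σ) y) k.castSucc

/-- Coefficients `gᵢⱼ` of the affine fundamental form. -/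
def fundamentalForm (σ ξ : Plane → C3) (i j : Fin 2) (y : Plane) : ℂ :=
  component σ ξ y (pd i (pd j σ) y) 2

/-- Coefficients `Sᵏᵢ` of the shape operator: `∂ᵢξ = -∑ₖ Sᵏᵢ ∂ₖσ + τᵢ ξ`. -/
def shapeOperator (σ ξ : Plane → C3) (k i : Fin 2) (y : Plane) : ℂ :=
  -component σ ξ y (pd i ξ y) k.castSucc

/-- The coefficient `θ(∂₀, ∂₁) = ω(∂₀σ, ∂₁σ, ξ)` of the induced complex volume form, where
`ω = dz₁ ∧ dz₂ ∧ dz₃`. -/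
def inducedVolume (σ ξ : Plane → C3) (y : Plane) : ℂ := (frame σ ξ y).det

/-- `(σ, ξ)` is a complex affine immersion: `σ` is a smooth admissible immersion and `ξ` a smooth
transversal vector field, i.e. `∂₀σ`, `∂₁σ`, `ξ` form a basis of `ℂ³` over `ℂ`. -/
structure IsComplexAffineImmersion (p : M → S) (σ ξ : M → C3) : Prop where
  smooth : SmoothOnCover p σ
  smooth_normal : SmoothOnCover p ξ
  transversal : ∀ e ∈ atlas Plane S, ∀ κ : OpenPartialHomeomorph M Plane, IsLift p e κ →
    ∀ y ∈ κ.target, LinearIndependent ℂ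
      ![pd 0 (σ ∘ κ.symm) y, pd 1 (σ ∘ κ.symm) y, ξ (κ.symm y)]

/-- `(σ, ξ)` is a Blaschke affine immersion with (positive) Blaschke metric `g`: the affine
fundamental form is `g`, the induced volume form `θ` is parallel for the induced connection, and
`θ` is the metric volume form of `g` compatible with the orientation. -/
structure IsBlaschkeImmersion (p : M → S) (g : CTensor S 2) (σ ξ : M → C3) : Prop
    extends IsComplexAffineImmersion p σ ξ where
  positive : IsPositiveComplexMetric g
  metric : ∀ e ∈ atlas Plane S, ∀ κ : OpenPartialHomeomorph M Plane, IsLift p e κ →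
    ∀ y ∈ κ.target, ∀ i j,
      fundamentalForm (σ ∘ κ.symm) (ξ ∘ κ.symm) i j y = gram g e y i j
  parallel : ∀ e ∈ atlas Plane S, ∀ κ : OpenPartialHomeomorph M Plane, IsLift p e κ →
    ∀ y ∈ κ.target, ∀ i,
      pd i (inducedVolume (σ ∘ κ.symm) (ξ ∘ κ.symm)) y
        - (∑ k, inducedConnection (σ ∘ κ.symm) (ξ ∘ κ.symm) k i k y)
          * inducedVolume (σ ∘ κ.symm) (ξ ∘ κ.symm) y = 0
  volume : ∀ e ∈ atlas Plane S, ∀ κ : OpenPartialHomeomorph M Plane, IsLift p e κ →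
    ∀ y ∈ κ.target,
      IsVolumeCoeff (gram g e y) (inducedVolume (σ ∘ κ.symm) (ξ ∘ κ.symm) y)

/-- `(σ, ξ)` is a positive hyperbolic complex affine sphere with Blaschke metric `g`: the shape
operator is `-id`. -/
structure IsPositiveHyperbolicSphere (p : M → S) (g : CTensor S 2) (σ ξ : M → C3) : Prop
    extends IsBlaschkeImmersion p g σ ξ where
  shape : ∀ e ∈ atlas Plane S, ∀ κ : OpenPartialHomeomorph M Plane, IsLift p e κ →
    ∀ y ∈ κ.target, ∀ k i,
      shapeOperator (σ ∘ κ.symm) (ξ ∘ κ.symm) k i y = if k = i then -1 else 0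

/-- The Pick tensor `C(X, Y, Z) = -2 g(∇_X Y - ∇ᵍ_X Y, Z)` of `(σ, ξ)`, where `∇` is the induced
connection and `∇ᵍ` the Levi-Civita connection of `g`, is the cubic tensor `C`. -/
def HasPickTensor (p : M → S) (g : CTensor S 2) (C : CTensor S 3) (σ ξ : M → C3) : Prop :=
  ∀ e ∈ atlas Plane S, ∀ κ : OpenPartialHomeomorph M Plane, IsLift p e κ →
    ∀ y ∈ κ.target, ∀ i j k, C.coeff e y ![i, j, k] =
      -2 * ∑ l, (inducedConnection (σ ∘ κ.symm) (ξ ∘ κ.symm) l i j y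
        - christoffel (gram g e) l i j y) * gram g e y l k

/-- `(σ, ξ)` is equivariant for a representation of the deck group in `SL(3, ℂ)`. -/
def IsEquivariant (p : M → S) (σ ξ : M → C3) : Prop :=
  ∃ ρ : deckGroup p →* Matrix.SpecialLinearGroup (Fin 3) ℂ, ∀ (d : deckGroup p) (x : M),
    σ (d.1 x) = (ρ d).1.mulVec (σ x) ∧ ξ (d.1 x) = (ρ d).1.mulVec (ξ x)

/-- `σ` is an equivariant positive hyperbolic complex affine sphere, with holonomy in
`SL(3, ℂ)`, Blaschke metric `g` and Pick tensor `C`, whose affine normals meet at the origin: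
`σ - ξ`, which is constant for a sphere with shape operator `-id`, vanishes. -/
def IsEquivariantCAS (p : M → S) (g : CTensor S 2) (C : CTensor S 3) (σ : M → C3) : Prop :=
  ∃ ξ : M → C3, IsPositiveHyperbolicSphere p g σ ξ ∧ HasPickTensor p g C σ ξ ∧
    IsEquivariant p σ ξ ∧ ∀ x, σ x - ξ x = 0

end Cover

end CAS

end

open CAS

noncomputable section

namespace CAS

/-! ### The Frobenius theorem for flat connections -/

section Frobenius

set_option maxSynthPendingDepth 3

variable {E V : Type*} [NormedAddCommGroup E] [NormedSpace ℝ E]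
  [NormedAddCommGroup V] [NormedSpace ℝ V] {A : E → E →L[ℝ] V →L[ℝ] V} {y₀ h v : E}

/-- `F` is a solution on `s` of the total differential equation `dF = A F`, that is, a parallel
section of the connection `d - A`. -/
def IsParallelOn (A : E → E →L[ℝ] V →L[ℝ] V) (s : Set E) (F : E → V) : Prop :=
  ∀ y ∈ s, HasFDerivAt F ((A y).flip (F y)) y

/-- The connection `d - A` is flat on `s`: the curvature form `dA - A ∧ A` vanishes there. -/
def IsFlatOn (A : E → E →L[ℝ] V →L[ℝ] V) (s : Set E) : Prop :=
  ∀ y ∈ s, ∀ u v : E, fderiv ℝ A y u v + (A y v).comp (A y u) =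
    fderiv ℝ A y v u + (A y u).comp (A y v)

/-- `f` is parallel for `d - A` along the segment `t ↦ y₀ + t h`, `0 ≤ t ≤ 1`. -/
def IsRadialTransport (A : E → E →L[ℝ] V →L[ℝ] V) (y₀ h : E) (f : ℝ → V) : Prop :=
  ∀ t ∈ Icc (0 : ℝ) 1, HasDerivWithinAt f (A (y₀ + t • h) h (f t)) (Icc 0 1) t

/-- Quantitative control of a connection form on a ball: a bound and Lipschitz constants for `A`
and `dA`, the radius being so small that the linear equations along radii have coefficients
bounded by `1 / 2`. -/
structure IsControlledOnBall (A : E → E →L[ℝ] V →L[ℝ] V) (y₀ : E) (r M : ℝ) (K₁ K₂ : NNReal) :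
    Prop where
  differentiableAt : ∀ y ∈ Metric.ball y₀ r, DifferentiableAt ℝ A y
  norm_le : ∀ y ∈ Metric.ball y₀ r, ‖A y‖ ≤ M
  lipschitz : LipschitzOnWith K₁ A (Metric.ball y₀ r)
  lipschitz_fderiv : LipschitzOnWith K₂ (fderiv ℝ A) (Metric.ball y₀ r)
  mul_le : M * r ≤ 1 / 2

theorem hasDerivAt_add_smul (y₀ h : E) (t : ℝ) : HasDerivAt (fun t : ℝ => y₀ + t • h) h t := by
  simpa using ((hasDerivAt_id t).smul_const h).const_add y₀

theorem add_smul_mem_ball {r t : ℝ} (hh : ‖h‖ < r) (ht : t ∈ Icc (0 : ℝ) 1) :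
    y₀ + t • h ∈ Metric.ball y₀ r :=
  (convex_ball y₀ r).add_smul_mem (Metric.mem_ball_self ((norm_nonneg h).trans_lt hh))
    (by simpa using hh) ht

theorem hasDerivWithinAt_Ici_of_Icc {f : ℝ → V} {f' : V} {a b t : ℝ} (ht : t ∈ Ico a b)
    (hf : HasDerivWithinAt f f' (Icc a b) t) : HasDerivWithinAt f f' (Ici t) t :=
  hf.mono_of_mem_nhdsWithin (Icc_mem_nhdsGE_of_mem ht)

theorem IsParallelOn.sub {s : Set E} {F F' : E → V} (hF : IsParallelOn A s F)
    (hF' : IsParallelOn A s F') : IsParallelOn A s (F - F') := fun y hy => by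
  simpa only [map_sub, Pi.sub_apply] using (hF y hy).sub (hF' y hy)

theorem IsParallelOn.isRadialTransport {s : Set E} (hs : StarConvex ℝ y₀ s) (hh : y₀ + h ∈ s)
    {F : E → V} (hF : IsParallelOn A s F) :
    IsRadialTransport A y₀ h fun t => F (y₀ + t • h) := fun t ht =>
  HasDerivAt.hasDerivWithinAt <| by
    exact (hF _ (hs.add_smul_mem hh ht.1 ht.2)).comp_hasDerivAt t (hasDerivAt_add_smul y₀ h t)

theorem IsRadialTransport.continuousOn {f : ℝ → V} (hf : IsRadialTransport A y₀ h f) :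
    ContinuousOn f (Icc 0 1) := fun t ht => (hf t ht).continuousWithinAt

theorem IsRadialTransport.eq_zero {f : ℝ → V} (hf : IsRadialTransport A y₀ h f)
    (hA : ContinuousOn (fun t : ℝ => A (y₀ + t • h)) (Icc 0 1)) (h0 : f 0 = 0) : f 1 = 0 := by
  obtain ⟨N, hN⟩ := isCompact_Icc.exists_bound_of_continuousOn (E := E →L[ℝ] V →L[ℝ] V) hA
  refine eq_zero_of_abs_deriv_le_mul_abs_self_of_eq_zero_right (K := N * ‖h‖) hf.continuousOn
    (fun t ht => hasDerivWithinAt_Ici_of_Icc ht (hf t (Ico_subset_Icc_self ht))) h0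
    (fun t ht => ?_) 1 (right_mem_Icc.2 zero_le_one)
  refine ((A _).le_opNorm₂ _ _).trans ?_
  gcongr
  exact hN t (Ico_subset_Icc_self ht)

theorem IsRadialTransport.apply_one_of_zero {f : ℝ → V} (hf : IsRadialTransport A y₀ 0 f) :
    f 1 = f 0 :=
  constant_of_has_deriv_right_zero hf.continuousOn
    (fun t ht => by
      simpa using hasDerivWithinAt_Ici_of_Icc ht (hf t (Ico_subset_Icc_self ht))) 1
    (right_mem_Icc.2 zero_le_one)

theorem IsParallelOn.eqOn_of_starConvex {s : Set E} (hs : StarConvex ℝ y₀ s)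
    (hA : ContinuousOn A s) {F F' : E → V} (hF : IsParallelOn A s F) (hF' : IsParallelOn A s F')
    (h0 : F y₀ = F' y₀) : EqOn F F' s := by
  intro y hy
  have hy' : y₀ + (y - y₀) ∈ s := by simpa using hy
  have hzero := ((hF.sub hF').isRadialTransport hs hy').eq_zero
    (hA.comp (by fun_prop) fun t ht => hs.add_smul_mem hy' ht.1 ht.2) (by simp [h0])
  simpa [sub_eq_zero] using hzero

theorem exists_hasDerivWithinAt_of_norm_le_half [CompleteSpace V] {B : ℝ → V →L[ℝ] V}
    (hB : ContinuousOn B (Icc 0 1)) (hB' : ∀ t ∈ Icc (0 : ℝ) 1, ‖B t‖ ≤ 1 / 2) (v₀ : V) :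
    ∃ f : ℝ → V, f 0 = v₀ ∧ ∀ t ∈ Icc (0 : ℝ) 1, HasDerivWithinAt f (B t (f t)) (Icc 0 1) t := by
  have hPL : IsPicardLindelof (fun t v => B t v) (⟨0, by simp⟩ : Icc (0 : ℝ) 1) v₀ ‖v₀‖₊ 0
      ‖v₀‖₊ 1 := by
    refine ⟨fun t ht => ?_, fun v _ => hB.clm_apply continuousOn_const, fun t ht v hv => ?_, ?_⟩
    · refine (((B t).lipschitz).weaken ?_).lipschitzOnWith
      rw [← NNReal.coe_le_coe, coe_nnnorm, NNReal.coe_one]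
      linarith [hB' t ht]
    · have hv' : ‖v‖ ≤ 2 * ‖v₀‖ := by
        have hball := mem_closedBall_iff_norm.1 hv
        rw [coe_nnnorm] at hball
        linarith [norm_le_norm_add_norm_sub' v v₀]
      calc ‖B t v‖ ≤ ‖B t‖ * ‖v‖ := (B t).le_opNorm v
        _ ≤ 1 / 2 * (2 * ‖v₀‖) := by gcongr; exact hB' t ht
        _ = ‖v₀‖ := by ring
    · simp
  exact hPL.exists_eq_forall_mem_Icc_hasDerivWithinAt₀

theorem norm_image_sub_sub_fderiv_le_of_lipschitzOnWith {G : Type*} [NormedAddCommGroup G]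
    [NormedSpace ℝ G] {f : E → G} {s : Set E} {K : NNReal} (hs : Convex ℝ s)
    (hf : ∀ y ∈ s, DifferentiableAt ℝ f y) (hf' : LipschitzOnWith K (fderiv ℝ f) s) {a b : E}
    (ha : a ∈ s) (hb : b ∈ s) :
    ‖f b - f a - fderiv ℝ f a (b - a)‖ ≤ K * ‖b - a‖ * ‖b - a‖ := by
  have hseg : segment ℝ a b ⊆ s := hs.segment_subset ha hb
  refine (convex_segment a b).norm_image_sub_le_of_norm_hasFDerivWithin_le'
    (fun y hy => (hf y (hseg hy)).hasFDerivAt.hasFDerivWithinAt) (fun y hy => ?_)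
    (left_mem_segment ℝ a b) (right_mem_segment ℝ a b)
  rw [← dist_eq_norm]
  refine (hf'.dist_le_mul y (hseg hy) a ha).trans ?_
  rw [dist_eq_norm]
  gcongr
  exact norm_sub_le_of_mem_segment hy

theorem exists_isControlledOnBall (hA : ContDiffAt ℝ 2 A y₀) {U : Set E}
    (hU : U ∈ 𝓝 y₀) :
    ∃ r > 0, ∃ (M : ℝ) (K₁ K₂ : NNReal), Metric.ball y₀ r ⊆ U ∧
      IsControlledOnBall A y₀ r M K₁ K₂ := by
  obtain ⟨K₁, s₁, hs₁, hL₁⟩ := (hA.of_le one_le_two).exists_lipschitzOnWith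
  obtain ⟨K₂, s₂, hs₂, hL₂⟩ :=
    (hA.fderiv_right (m := 1) (by norm_num)).exists_lipschitzOnWith
  have hnorm : ∀ᶠ y in 𝓝 y₀, ‖A y‖ < ‖A y₀‖ + 1 :=
    (ContinuousAt.norm (E := E →L[ℝ] V →L[ℝ] V) hA.continuousAt).eventually_lt
      continuousAt_const (by simp)
  have hdiff : ∀ᶠ y in 𝓝 y₀, DifferentiableAt ℝ A y :=
    (hA.eventually (by simp)).mono fun y hy => hy.differentiableAt (by norm_num)
  obtain ⟨ρ, hρ, hball⟩ := Metric.eventually_nhds_iff_ball.1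
    ((Filter.eventually_mem_set.2 hU).and <| hdiff.and <| hnorm.and <|
      (Filter.eventually_mem_set.2 hs₁).and (Filter.eventually_mem_set.2 hs₂))
  have hsub : ∀ y ∈ Metric.ball y₀ (min ρ (1 / (2 * (‖A y₀‖ + 1)))), y ∈ Metric.ball y₀ ρ :=
    fun _ hy => Metric.ball_subset_ball (min_le_left _ _) hy
  refine ⟨_, by positivity, ‖A y₀‖ + 1, K₁, K₂, fun y hy => (hball y (hsub y hy)).1, ?_⟩
  constructor
  · exact fun y hy => (hball y (hsub y hy)).2.1
  · exact fun y hy => (hball y (hsub y hy)).2.2.1.le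
  · exact hL₁.mono fun y hy => (hball y (hsub y hy)).2.2.2.1
  · exact hL₂.mono fun y hy => (hball y (hsub y hy)).2.2.2.2
  · calc (‖A y₀‖ + 1) * min ρ (1 / (2 * (‖A y₀‖ + 1)))
        ≤ (‖A y₀‖ + 1) * (1 / (2 * (‖A y₀‖ + 1))) := by gcongr; exact min_le_right _ _
      _ = 1 / 2 := by field_simp

/-- The failure of `A v` to be the variation of a radial transport: `f'` is transported along
`h + v` and `f` along `h`. -/
def transportDefect (A : E → E →L[ℝ] V →L[ℝ] V) (y₀ h v : E) (f f' : ℝ → V) (t : ℝ) : V :=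
  f' t - f t - A (y₀ + t • h) (t • v) (f t)

theorem defect_deriv_eq_of_flat {L L' : E →L[ℝ] V →L[ℝ] V} {D : E →L[ℝ] E →L[ℝ] V →L[ℝ] V} {w : E}
    (hflat : D h w + (L w).comp (L h) = D w h + (L h).comp (L w)) (x x' : V) :
    L' (h + v) x' - L h x - ((D h w + L v) x + L w (L h x)) =
      L' (h + v) (x' - x - L w x) + ((L' - L - D w) h x + (L' - L) v x) +
        ((L' - L) (h + v) (L w x) + L v (L w x)) := by
  have hx := congrArg (fun T : V →L[ℝ] V => T x) hflat
  simp only [add_apply, ContinuousLinearMap.comp_apply] at hx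
  simp only [add_apply, sub_apply, map_add, map_sub]
  rw [← sub_eq_zero] at hx ⊢
  rw [← neg_eq_zero, ← hx]
  abel

namespace IsControlledOnBall

variable {r M : ℝ} {K₁ K₂ : NNReal} (hA : IsControlledOnBall A y₀ r M K₁ K₂)
include hA

theorem exists_isRadialTransport [CompleteSpace V] (hh : ‖h‖ < r) (F₀ : V) :
    ∃ f, f 0 = F₀ ∧ IsRadialTransport A y₀ h f := by
  have hmem : MapsTo (fun t : ℝ => y₀ + t • h) (Icc 0 1) (Metric.ball y₀ r) :=
    fun t ht => add_smul_mem_ball hh ht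
  refine exists_hasDerivWithinAt_of_norm_le_half (B := fun t => A (y₀ + t • h) h)
    ((hA.lipschitz.continuousOn.comp (by fun_prop) hmem).clm_apply continuousOn_const)
    (fun t ht => ?_) F₀
  calc ‖A (y₀ + t • h) h‖ ≤ ‖A (y₀ + t • h)‖ * ‖h‖ := ContinuousLinearMap.le_opNorm _ _
    _ ≤ M * r := by
      have := hA.norm_le _ (hmem ht)
      gcongr
      exact (norm_nonneg _).trans this
    _ ≤ 1 / 2 := hA.mul_le

theorem norm_defect_deriv_le {a a' w : E} (ha : a ∈ Metric.ball y₀ r) (ha' : a' ∈ Metric.ball y₀ r)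
    (hw : a' - a = w) (hwv : ‖w‖ ≤ ‖v‖) (hh : ‖h‖ < r) (hv : ‖h + v‖ < r) {x : V} {N : ℝ}
    (hx : ‖x‖ ≤ N) (z : V) :
    ‖A a' (h + v) z + ((A a' - A a - fderiv ℝ A a w) h x + (A a' - A a) v x) +
        ((A a' - A a) (h + v) (A a w x) + A a v (A a w x))‖ ≤
      1 / 2 * ‖z‖ + (K₂ * r + K₁ + (K₁ * r + M) * M) * N * ‖v‖ ^ 2 := by
  have : 0 ≤ M := (norm_nonneg _).trans (hA.norm_le a ha)
  have : 0 ≤ r := (norm_nonneg _).trans hh.le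
  have hlip : ‖A a' - A a‖ ≤ K₁ * ‖v‖ := by
    rw [← dist_eq_norm]
    refine (hA.lipschitz.dist_le_mul a' ha' a ha).trans ?_
    rw [dist_eq_norm, hw]
    gcongr
  have htaylor : ‖A a' - A a - fderiv ℝ A a w‖ ≤ K₂ * ‖v‖ * ‖v‖ := by
    refine (hw ▸ norm_image_sub_sub_fderiv_le_of_lipschitzOnWith (convex_ball y₀ r)
      hA.differentiableAt hA.lipschitz_fderiv ha ha').trans ?_
    gcongr
  have hAwx : ‖A a w x‖ ≤ M * ‖v‖ * N :=
    (A a).le_of_opNorm₂_le_of_le (hA.norm_le a ha) hwv hx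
  have hz : ‖A a' (h + v) z‖ ≤ M * r * ‖z‖ :=
    (A a').le_of_opNorm₂_le_of_le (hA.norm_le a' ha') hv.le le_rfl
  refine norm_add₃_le.trans ?_
  calc _ ≤ M * r * ‖z‖ + (K₂ * ‖v‖ * ‖v‖ * r * N + K₁ * ‖v‖ * ‖v‖ * N) +
        (K₁ * ‖v‖ * r * (M * ‖v‖ * N) + M * ‖v‖ * (M * ‖v‖ * N)) := by
        refine add_le_add_three hz (norm_add_le_of_le ?_ ?_) (norm_add_le_of_le ?_ ?_)
        exacts [(_ : E →L[ℝ] V →L[ℝ] V).le_of_opNorm₂_le_of_le htaylor hh.le hx,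
          (_ : E →L[ℝ] V →L[ℝ] V).le_of_opNorm₂_le_of_le hlip le_rfl hx,
          (_ : E →L[ℝ] V →L[ℝ] V).le_of_opNorm₂_le_of_le hlip hv.le hAwx,
          (A a).le_of_opNorm₂_le_of_le (hA.norm_le a ha) le_rfl hAwx]
    _ = M * r * ‖z‖ + (K₂ * r + K₁ + (K₁ * r + M) * M) * N * ‖v‖ ^ 2 := by ring
    _ ≤ _ := by gcongr; exact hA.mul_le

variable {f f' : ℝ → V}

theorem hasDerivWithinAt_transportDefect (hh : ‖h‖ < r) (hf : IsRadialTransport A y₀ h f)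
    (hf' : IsRadialTransport A y₀ (h + v) f') {t : ℝ} (ht : t ∈ Icc (0 : ℝ) 1) :
    HasDerivWithinAt (transportDefect A y₀ h v f f')
      (A (y₀ + t • (h + v)) (h + v) (f' t) - A (y₀ + t • h) h (f t) -
        ((fderiv ℝ A (y₀ + t • h) h (t • v) + A (y₀ + t • h) v) (f t) +
          A (y₀ + t • h) (t • v) (A (y₀ + t • h) h (f t)))) (Icc 0 1) t := by
  have hAt := ((hA.differentiableAt _ (add_smul_mem_ball hh ht)).hasFDerivAt.comp_hasDerivAt t
    (hasDerivAt_add_smul y₀ h t)).hasDerivWithinAt (s := Icc 0 1)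
  have hsmul : HasDerivWithinAt (fun t : ℝ => t • v) v (Icc 0 1) t := by
    simpa using ((hasDerivAt_id t).smul_const v).hasDerivWithinAt
  exact ((hf' t ht).sub (hf t ht)).sub ((hAt.clm_apply hsmul).clm_apply (hf t ht))

theorem norm_transportDefect_le (hflat : IsFlatOn A (Metric.ball y₀ r)) (hh : ‖h‖ < r)
    (hv : ‖h + v‖ < r) (hf : IsRadialTransport A y₀ h f)
    (hf' : IsRadialTransport A y₀ (h + v) f') (h0 : f' 0 = f 0) {N : ℝ}
    (hN : ∀ t ∈ Icc (0 : ℝ) 1, ‖f t‖ ≤ N) :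
    ‖transportDefect A y₀ h v f f' 1‖ ≤
      2 * (Real.exp (1 / 2) - 1) * ((K₂ * r + K₁ + (K₁ * r + M) * M) * N) * ‖v‖ ^ 2 := by
  have hder := fun t ht => hA.hasDerivWithinAt_transportDefect (t := t) hh hf hf' ht
  have hgronwall := norm_le_gronwallBound_of_norm_deriv_right_le (δ := 0) (K := 1 / 2)
    (ε := (K₂ * r + K₁ + (K₁ * r + M) * M) * N * ‖v‖ ^ 2)
    (HasDerivWithinAt.continuousOn hder)
    (fun t ht => hasDerivWithinAt_Ici_of_Icc ht (hder t (Ico_subset_Icc_self ht)))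
    (by simp [transportDefect, h0])
    (fun t ht => ?_) 1 (by simp)
  · rw [gronwallBound_of_K_ne_0 (by norm_num)] at hgronwall
    convert hgronwall using 1
    simp only [sub_zero, mul_one, zero_mul, zero_add]
    ring
  · have ht' := Ico_subset_Icc_self ht
    have hmem := add_smul_mem_ball (y₀ := y₀) hh ht'
    rw [defect_deriv_eq_of_flat (hflat _ hmem h (t • v))]
    refine hA.norm_defect_deriv_le hmem (add_smul_mem_ball hv ht') (by simp) ?_ hh hv (hN t ht') _
    rw [norm_smul, Real.norm_of_nonneg ht'.1]
    exact mul_le_of_le_one_left (norm_nonneg v) ht'.2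

theorem isParallelOn_radialTransport (hflat : IsFlatOn A (Metric.ball y₀ r)) {Φ : E → ℝ → V}
    {F₀ : V} (h0 : ∀ h, ‖h‖ < r → Φ h 0 = F₀)
    (hΦ : ∀ h, ‖h‖ < r → IsRadialTransport A y₀ h (Φ h)) :
    IsParallelOn A (Metric.ball y₀ r) fun y => Φ (y - y₀) 1 := by
  intro y hy
  have hh : ‖y - y₀‖ < r := mem_ball_iff_norm.1 hy
  obtain ⟨N, hN⟩ := isCompact_Icc.exists_bound_of_continuousOn (hΦ _ hh).continuousOn
  rw [hasFDerivAt_iff_isLittleO_nhds_zero]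
  have hev : ∀ᶠ v in 𝓝 (0 : E), ‖y - y₀ + v‖ < r :=
    ContinuousAt.eventually_lt (by fun_prop) continuousAt_const (by simpa using hh)
  have hquadratic : (fun v => Φ (y + v - y₀) 1 - Φ (y - y₀) 1 - (A y).flip (Φ (y - y₀) 1) v)
      =O[𝓝 0] fun v : E => ‖v‖ ^ 2 := by
    refine Asymptotics.IsBigO.of_bound
      (2 * (Real.exp (1 / 2) - 1) * ((K₂ * r + K₁ + (K₁ * r + M) * M) * N)) ?_
    filter_upwards [hev] with v hv
    rw [norm_pow, norm_norm]
    simpa [transportDefect, sub_add_eq_add_sub] using hA.norm_transportDefect_le hflat hh hv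
      (hΦ _ hh) (hΦ _ hv) ((h0 _ hv).trans (h0 _ hh).symm) hN
  refine hquadratic.trans_isLittleO (Asymptotics.IsLittleO.of_norm_right ?_)
  simpa using Asymptotics.isLittleO_norm_pow_norm_pow (E' := E) one_lt_two

end IsControlledOnBall

-- Transport the initial value along the rays from `y₀`; flatness makes the result parallel in
-- all directions.
theorem exists_isParallelOn_of_isFlatOn [CompleteSpace V] {U : Set E} (hU : IsOpen U)
    (hA : ContDiffOn ℝ 2 A U) (hflat : IsFlatOn A U) (hy₀ : y₀ ∈ U) (F₀ : V) :
    ∃ r > 0, Metric.ball y₀ r ⊆ U ∧ ∃ F : E → V, F y₀ = F₀ ∧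
      IsParallelOn A (Metric.ball y₀ r) F := by
  obtain ⟨r, hr, M, K₁, K₂, hrU, hctrl⟩ :=
    exists_isControlledOnBall (hA.contDiffAt (hU.mem_nhds hy₀)) (hU.mem_nhds hy₀)
  have htransport : ∀ h : E, ∃ f, ‖h‖ < r → f 0 = F₀ ∧ IsRadialTransport A y₀ h f := fun h => by
    by_cases hh : ‖h‖ < r
    · obtain ⟨f, hf⟩ := hctrl.exists_isRadialTransport hh F₀
      exact ⟨f, fun _ => hf⟩
    · exact ⟨0, fun h' => absurd h' hh⟩
  choose Φ hΦ using htransport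
  refine ⟨r, hr, hrU, fun y => Φ (y - y₀) 1, ?_, hctrl.isParallelOn_radialTransport
    (fun y hy => hflat y (hrU hy)) (fun h hh => (hΦ h hh).1) (fun h hh => (hΦ h hh).2)⟩
  obtain ⟨h0, hf⟩ := hΦ 0 (by simpa using hr)
  simpa [h0] using hf.apply_one_of_zero

theorem IsParallelOn.contDiffOn {s : Set E} {F : E → V} (hs : IsOpen s) (hA : ContDiffOn ℝ ∞ A s)
    (hF : IsParallelOn A s F) : ContDiffOn ℝ ∞ F s := by
  refine contDiffOn_infty.2 fun n => ?_
  induction n with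
  | zero => exact contDiffOn_zero.2 fun y hy => (hF y hy).continuousAt.continuousWithinAt
  | succ n ih =>
    push_cast
    rw [contDiffOn_succ_iff_fderiv_of_isOpen hs]
    refine ⟨fun y hy => (hF y hy).differentiableAt.differentiableWithinAt, by simp, ?_⟩
    have hflip : ContDiffOn ℝ n (fun y => (A y).flip) s :=
      (ContinuousLinearMap.flipₗᵢ ℝ E V V).contDiff.comp_contDiffOn (hA.of_le (mod_cast le_top))
    exact (hflip.clm_apply ih).congr fun y hy => (hF y hy).fderiv

end Frobenius

/-! ### Patching local solutions by monodromy -/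

section Cocycle

variable {M G : Type*}

/-- The total space of the covering of `M` with fibre `G` and transition function `a`. -/
@[ext] structure CocycleSpace (a : M → M → G) where
  base : M
  val : G

variable [TopologicalSpace M] [Group G]

/-- A transition function `a` that satisfies the cocycle identity near the diagonal. -/
def IsLocalCocycle (a : M → M → G) : Prop :=
  ∀ x, ∀ᶠ y in 𝓝 x, ∀ᶠ z in 𝓝 y, a x z = a x y * a y z

/-- The domain of the local section of the covering defined by `a` through the point `x`. -/
def cocycleNhd (a : M → M → G) (x : M) : Set M :=
  interior {y | ∀ᶠ z in 𝓝 y, a x z = a x y * a y z}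

theorem isOpen_cocycleNhd {a : M → M → G} {x : M} : IsOpen (cocycleNhd a x) :=
  isOpen_interior

theorem eventually_eq_mul_of_mem_cocycleNhd {a : M → M → G} {x y : M} (hy : y ∈ cocycleNhd a x) :
    ∀ᶠ z in 𝓝 y, a x z = a x y * a y z := by
  have hy' : y ∈ {y | ∀ᶠ z in 𝓝 y, a x z = a x y * a y z} := interior_subset hy
  exact hy'

theorem IsLocalCocycle.mem_cocycleNhd {a : M → M → G} (ha : IsLocalCocycle a) (x : M) :
    x ∈ cocycleNhd a x :=
  mem_interior_iff_mem_nhds.2 (ha x)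

theorem IsLocalCocycle.apply_self {a : M → M → G} (ha : IsLocalCocycle a) (x : M) : a x x = 1 := by
  simpa using (ha x).self_of_nhds.self_of_nhds

namespace CocycleSpace

/-- The topology in which the local sections `y ↦ (y, g * a x y)` are continuous and open. -/
instance topologicalSpace (a : M → M → G) : TopologicalSpace (CocycleSpace a) where
  IsOpen W := ∀ e ∈ W, ∀ᶠ y in 𝓝 e.base, (⟨y, e.val * a e.base y⟩ : CocycleSpace a) ∈ W
  isOpen_univ _ _ := by simp
  isOpen_inter _ _ hs ht e he := (hs e he.1).and (ht e he.2)
  isOpen_sUnion _ hs e he := by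
    obtain ⟨t, ht, het⟩ := he
    exact (hs t ht e het).mono fun y hy => ⟨t, ht, hy⟩

variable {a : M → M → G}

theorem isOpen_iff {W : Set (CocycleSpace a)} :
    IsOpen W ↔ ∀ e ∈ W, ∀ᶠ y in 𝓝 e.base, (⟨y, e.val * a e.base y⟩ : CocycleSpace a) ∈ W :=
  Iff.rfl

theorem continuous_base : Continuous (base : CocycleSpace a → M) :=
  ⟨fun _ hU => isOpen_iff.2 fun _ he => hU.mem_nhds he⟩

theorem isOpen_sheet (x : M) (g : G) :
    IsOpen {e : CocycleSpace a | e.base ∈ cocycleNhd a x ∧ e.val = g * a x e.base} := by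
  refine isOpen_iff.2 fun e he => ?_
  filter_upwards [isOpen_cocycleNhd.mem_nhds he.1, eventually_eq_mul_of_mem_cocycleNhd he.1]
    with z hz hz'
  exact ⟨hz, by simp only [hz', he.2, mul_assoc]⟩

theorem continuous_localSection [TopologicalSpace G] [DiscreteTopology G] (x : M) :
    Continuous fun q : cocycleNhd a x × G => (⟨q.1, q.2 * a x q.1⟩ : CocycleSpace a) := by
  refine ⟨fun W hW => isOpen_iff_mem_nhds.2 ?_⟩
  rintro ⟨y, g⟩ hy
  rw [nhds_prod_eq, nhds_discrete G, Filter.prod_pure, Filter.mem_map, nhds_subtype]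
  refine Filter.mem_comap.2
    ⟨_, (isOpen_iff.1 hW _ hy).and (eventually_eq_mul_of_mem_cocycleNhd y.2), ?_⟩
  rintro z ⟨hz, hz'⟩
  simpa [hz', mul_assoc] using hz

theorem continuous_mul_inv [TopologicalSpace G] [DiscreteTopology G] (x : M) :
    Continuous fun e : base (a := a) ⁻¹' cocycleNhd a x => e.1.val * (a x e.1.base)⁻¹ := by
  refine continuous_discrete_rng.2 fun g => ?_
  convert (isOpen_sheet (a := a) x g).preimage continuous_subtype_val using 1
  ext e
  exact mul_inv_eq_iff_eq_mul.trans (and_iff_right e.2).symm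

theorem isCoveringMap (ha : IsLocalCocycle a) : IsCoveringMap (base : CocycleSpace a → M) := by
  intro x
  let _ : TopologicalSpace G := ⊥
  have : DiscreteTopology G := ⟨rfl⟩
  refine IsEvenlyCovered.to_isEvenlyCovered_preimage (I := G) ⟨inferInstance, cocycleNhd a x,
    ha.mem_cocycleNhd x, isOpen_cocycleNhd, isOpen_cocycleNhd.preimage continuous_base, ?_⟩
  exact ⟨{  toFun := fun e => (⟨e.1.base, e.2⟩, e.1.val * (a x e.1.base)⁻¹)
            invFun := fun q => ⟨⟨q.1, q.2 * a x q.1⟩, q.1.2⟩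
            left_inv := fun e => by ext <;> simp
            right_inv := fun q => by ext <;> simp
            continuous_toFun :=
              ((continuous_base.comp continuous_subtype_val).subtype_mk _).prodMk
                (continuous_mul_inv x)
            continuous_invFun := (continuous_localSection x).subtype_mk _ }, fun _ => rfl⟩

end CocycleSpace

variable [SimplyConnectedSpace M] [LocallyPathConnectedSpace M]

theorem IsLocalCocycle.exists_eventually_eq_mul {a : M → M → G} (ha : IsLocalCocycle a) :
    ∃ b : M → G, ∀ x, ∀ᶠ y in 𝓝 x, b y = b x * a x y := by
  obtain ⟨x₀⟩ : Nonempty M := inferInstance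
  obtain ⟨F, ⟨-, hF⟩, -⟩ := (CocycleSpace.isCoveringMap ha).existsUnique_continuousMap_lifts
    (ContinuousMap.id M) x₀ ⟨x₀, 1⟩ rfl
  have hbase : ∀ x, (F x).base = x := fun x => congrFun hF x
  refine ⟨fun x => (F x).val, fun x => ?_⟩
  have hsheet := (CocycleSpace.isOpen_sheet (a := a) x (F x).val).mem_nhds (x := F x)
    (by simp [hbase x, ha.mem_cocycleNhd x, ha.apply_self x])
  filter_upwards [F.continuous.continuousAt hsheet] with y hy
  simpa only [hbase y] using hy.2

theorem exists_global_of_local {X : Type*} [MulAction G X] (Sol : (M → X) → M → Prop)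
    (hcongr : ∀ s s' x, s =ᶠ[𝓝 x] s' → Sol s x → Sol s' x)
    (hsmul : ∀ (A : G) s x, Sol s x → Sol (fun y => A • s y) x)
    (hex : ∀ x, ∃ s, ∀ᶠ y in 𝓝 x, Sol s y)
    (huniq : ∀ s s' x, (∀ᶠ y in 𝓝 x, Sol s y) → (∀ᶠ y in 𝓝 x, Sol s' y) →
      ∃! A : G, ∀ᶠ y in 𝓝 x, s' y = A • s y) :
    ∃ s, ∀ x, Sol s x := by
  choose s hs using hex
  have hs' : ∀ x, ∀ᶠ y in 𝓝 x, ∀ᶠ z in 𝓝 y, Sol (s x) z :=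
    fun x => eventually_eventually_nhds.2 (hs x)
  have htrans : ∀ x y, ∃ A : G,
      (∀ᶠ z in 𝓝 y, Sol (s x) z) → ∀ᶠ z in 𝓝 y, s x z = A • s y z := by
    intro x y
    by_cases h : ∀ᶠ z in 𝓝 y, Sol (s x) z
    · exact (huniq (s y) (s x) y (hs y) h).exists.imp fun _ hA _ => hA
    · exact ⟨1, fun h' => absurd h' h⟩
  choose a ha using htrans
  have hcoc : IsLocalCocycle a := by
    intro x
    filter_upwards [hs' x] with y hy
    filter_upwards [eventually_eventually_nhds.2 (ha x y hy), eventually_eventually_nhds.2 hy,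
      hs' y] with z hz hxz hyz
    refine (huniq (s z) (s x) z (hs z) hxz).unique (ha x z hxz) ?_
    filter_upwards [hz, ha y z hyz] with t ht ht'
    rw [ht, ht', mul_smul]
  obtain ⟨b, hb⟩ := hcoc.exists_eventually_eq_mul
  refine ⟨fun y => b y • s y y, fun x => ?_⟩
  refine hcongr (fun y => b x • s x y) _ x ?_ (hsmul _ _ _ (hs x).self_of_nhds)
  filter_upwards [hb x, hs' x] with y hy hy'
  rw [hy, mul_smul, (ha x y hy').self_of_nhds]

end Cocycle

section Univalent

variable {f : ℂ → ℂ} {U : Set ℂ} {z z₀ : ℂ}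

theorem not_eventually_const_of_injOn (hU : IsOpen U) (hinj : InjOn f U) (hz : z ∈ U) :
    ¬ ∀ᶠ y in 𝓝 z, f y = f z := by
  intro h
  have hfalse : ∀ᶠ _ in 𝓝[≠] z, False := by
    filter_upwards [h.filter_mono nhdsWithin_le_nhds, self_mem_nhdsWithin,
      mem_nhdsWithin_of_mem_nhds (hU.mem_nhds hz)] with y hy hyz hyU
    exact hyz (hinj hyU hz hy)
  exact hfalse.exists.elim fun _ => id

theorem nhds_le_map_nhds_of_injOn (hU : IsOpen U) (hf : DifferentiableOn ℂ f U)
    (hinj : InjOn f U) (hz : z ∈ U) : 𝓝 (f z) ≤ Filter.map f (𝓝 z) :=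
  (hf.analyticOnNhd hU z hz).eventually_constant_or_nhds_le_map_nhds.resolve_left
    (not_eventually_const_of_injOn hU hinj hz)

theorem continuousAt_invFunOn_of_injOn (hU : IsOpen U) (hf : DifferentiableOn ℂ f U)
    (hinj : InjOn f U) (hz : z ∈ U) : ContinuousAt (Function.invFunOn f U) (f z) := by
  rw [ContinuousAt, hinj.leftInvOn_invFunOn hz]
  refine Filter.Tendsto.mono_left ?_ (nhds_le_map_nhds_of_injOn hU hf hinj hz)
  refine Filter.tendsto_map'_iff.2 (Filter.tendsto_id.congr' ?_)
  filter_upwards [hU.mem_nhds hz] with y hy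
  exact (hinj.leftInvOn_invFunOn hy).symm

theorem differentiableAt_invFunOn_of_deriv_ne_zero (hU : IsOpen U) (hf : DifferentiableOn ℂ f U)
    (hinj : InjOn f U) (hz : z ∈ U) (hd : deriv f z ≠ 0) :
    DifferentiableAt ℂ (Function.invFunOn f U) (f z) := by
  have hderiv : HasDerivAt f (deriv f z) (Function.invFunOn f U (f z)) := by
    rw [hinj.leftInvOn_invFunOn hz]
    exact (hf.differentiableAt (hU.mem_nhds hz)).hasDerivAt
  refine (HasDerivAt.of_local_left_inverse
    (continuousAt_invFunOn_of_injOn hU hf hinj hz) hderiv hd ?_).differentiableAt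
  filter_upwards [nhds_le_map_nhds_of_injOn hU hf hinj hz
    (Filter.image_mem_map (hU.mem_nhds hz))] with w hw
  exact Function.invFunOn_eq hw

theorem eventually_deriv_ne_zero_of_injOn (hU : IsOpen U) (hf : DifferentiableOn ℂ f U)
    (hinj : InjOn f U) (hz₀ : z₀ ∈ U) : ∀ᶠ z in 𝓝[≠] z₀, deriv f z ≠ 0 := by
  refine ((hf.analyticOnNhd hU).deriv z₀
    hz₀).eventually_eq_zero_or_eventually_ne_zero.resolve_left fun h => ?_
  obtain ⟨ε, hε, hball⟩ := Metric.eventually_nhds_iff_ball.1 (h.and (hU.mem_nhds hz₀))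
  refine not_eventually_const_of_injOn hU hinj hz₀ ?_
  filter_upwards [Metric.ball_mem_nhds z₀ hε] with y hy
  exact Metric.isOpen_ball.is_const_of_deriv_eq_zero (convex_ball z₀ ε).isPreconnected
    (hf.mono fun z hz => (hball z hz).2) (fun z hz => (hball z hz).1) hy
    (Metric.mem_ball_self hε)

theorem differentiableAt_invFunOn_of_injOn (hU : IsOpen U) (hf : DifferentiableOn ℂ f U)
    (hinj : InjOn f U) (hz₀ : z₀ ∈ U) : DifferentiableAt ℂ (Function.invFunOn f U) (f z₀) := by
  have hpunctured : {w | w ≠ f z₀ → DifferentiableAt ℂ (Function.invFunOn f U) w} ∈ 𝓝 (f z₀) := by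
    refine nhds_le_map_nhds_of_injOn hU hf hinj hz₀ (Filter.mem_map.2 ?_)
    filter_upwards [eventually_nhdsWithin_iff.1 (eventually_deriv_ne_zero_of_injOn hU hf hinj hz₀),
      hU.mem_nhds hz₀] with z hz hzU hne
    exact differentiableAt_invFunOn_of_deriv_ne_zero hU hf hinj hzU (hz fun h => hne (h ▸ rfl))
  exact ((Complex.differentiableOn_compl_singleton_and_continuousAt_iff hpunctured).1
    ⟨fun w hw => (hw.1 hw.2).differentiableWithinAt,
      continuousAt_invFunOn_of_injOn hU hf hinj hz₀⟩).differentiableAt hpunctured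

theorem deriv_ne_zero_of_injOn (hU : IsOpen U) (hf : DifferentiableOn ℂ f U) (hinj : InjOn f U)
    (hz₀ : z₀ ∈ U) : deriv f z₀ ≠ 0 := by
  intro h0
  have hcomp : HasDerivAt (Function.invFunOn f U ∘ f) (_ * deriv f z₀) z₀ :=
    (differentiableAt_invFunOn_of_injOn hU hf hinj hz₀).hasDerivAt.comp z₀
      (hf.differentiableAt (hU.mem_nhds hz₀)).hasDerivAt
  have hid : HasDerivAt (Function.invFunOn f U ∘ f) 1 z₀ := by
    refine (hasDerivAt_id z₀).congr_of_eventuallyEq ?_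
    filter_upwards [hU.mem_nhds hz₀] with y hy using hinj.leftInvOn_invFunOn hy
  simpa [h0] using hcomp.unique hid

end Univalent

section Frames

set_option maxSynthPendingDepth 3

/-- The action of coefficient matrices on frames of `ℂ³`. -/
def frameAction : (Fin 3 → Fin 3 → ℂ) →L[ℝ] (Fin 3 → C3) →L[ℝ] (Fin 3 → C3) :=
  LinearMap.toContinuousLinearMap
    ((LinearMap.toContinuousLinearMap :
      ((Fin 3 → C3) →ₗ[ℝ] (Fin 3 → C3)) ≃ₗ[ℝ] ((Fin 3 → C3) →L[ℝ] (Fin 3 → C3))).toLinearMap ∘ₗ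
    LinearMap.mk₂ ℝ (fun (m : Fin 3 → Fin 3 → ℂ) (Φ : Fin 3 → C3) b => ∑ c, m b c • Φ c)
      (fun m m' Φ => by ext; simp [add_smul, Finset.sum_add_distrib])
      (fun c m Φ => by ext; simp [Finset.mul_sum, mul_assoc])
      (fun m Φ Φ' => by ext; simp [Finset.sum_add_distrib])
      (fun c m Φ => by ext; simp [Finset.mul_sum, mul_left_comm]))

theorem frameAction_apply (m : Fin 3 → Fin 3 → ℂ) (Φ : Fin 3 → C3) (b : Fin 3) :
    frameAction m Φ b = ∑ c, m b c • Φ c := rfl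

/-- The `𝔤𝔩(3, ℂ)`-valued one-form with components `A₀`, `A₁`, acting on frames. -/
def connectionForm :
    (Fin 2 → Fin 3 → Fin 3 → ℂ) →L[ℝ] Plane →L[ℝ] (Fin 3 → C3) →L[ℝ] (Fin 3 → C3) :=
  LinearMap.toContinuousLinearMap
    { toFun := fun A => ∑ i, (EuclideanSpace.proj i : Plane →L[ℝ] ℝ).smulRight (frameAction (A i))
      map_add' := fun A B => by
        ext
        simp
        ring
      map_smul' := fun c A => by
        ext
        simp [mul_left_comm] }

theorem connectionForm_apply (A : Fin 2 → Fin 3 → Fin 3 → ℂ) (v : Plane) :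
    connectionForm A v = ∑ i, v i • frameAction (A i) := by
  change (∑ i, (EuclideanSpace.proj i : Plane →L[ℝ] ℝ).smulRight (frameAction (A i))) v = _
  rw [sum_apply]
  rfl

theorem connectionForm_single (A : Fin 2 → Fin 3 → Fin 3 → ℂ) (i : Fin 2) :
    connectionForm A (EuclideanSpace.single i 1) = frameAction (A i) := by
  rw [connectionForm_apply]
  fin_cases i <;> simp [zero_smul ℝ (_ : (Fin 3 → C3) →L[ℝ] (Fin 3 → C3))]

end Frames

section PartialDerivatives

variable {V : Type*} [NormedAddCommGroup V] [NormedSpace ℝ V] {f g : Plane → V} {y : Plane}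
  {U : Set Plane} (i j : Fin 2)

theorem pd_congr (h : f =ᶠ[𝓝 y] g) : pd i f y = pd i g y := by
  rw [pd, pd, h.fderiv_eq]

theorem pd_congr_on (hU : IsOpen U) (h : EqOn f g U) (hy : y ∈ U) : pd i f y = pd i g y :=
  pd_congr i (h.eventuallyEq_of_mem (hU.mem_nhds hy))

theorem fderiv_eq_sum_pd (v : Plane) : fderiv ℝ f y v = ∑ i, v i • pd i f y := by
  conv_lhs => rw [← (EuclideanSpace.basisFun (Fin 2) ℝ).sum_repr v]
  simp [pd]

theorem pd_const (c : V) : pd i (fun _ => c) y = 0 := by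
  simp [pd]

theorem pd_add (hf : DifferentiableAt ℝ f y) (hg : DifferentiableAt ℝ g y) :
    pd i (fun x => f x + g x) y = pd i f y + pd i g y := by
  simp only [pd, fderiv_fun_add hf hg, add_apply]

theorem pd_sub (hf : DifferentiableAt ℝ f y) (hg : DifferentiableAt ℝ g y) :
    pd i (fun x => f x - g x) y = pd i f y - pd i g y := by
  simp only [pd, fderiv_fun_sub hf hg, sub_apply]

theorem pd_mul {a b : Plane → ℂ} (ha : DifferentiableAt ℝ a y) (hb : DifferentiableAt ℝ b y) :
    pd i (fun x => a x * b x) y = pd i a y * b y + a y * pd i b y := by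
  simp only [pd, fderiv_fun_mul ha hb, add_apply, smul_apply, smul_eq_mul]
  ring

theorem pd_const_mul (c : ℂ) {a : Plane → ℂ} (ha : DifferentiableAt ℝ a y) :
    pd i (fun x => c * a x) y = c * pd i a y := by
  rw [pd_mul i (differentiableAt_const c) ha, pd_const]
  ring

theorem pd_smul [NormedSpace ℂ V] [IsScalarTower ℝ ℂ V] {a : Plane → ℂ}
    (ha : DifferentiableAt ℝ a y) (hf : DifferentiableAt ℝ f y) :
    pd i (fun x => a x • f x) y = pd i a y • f y + a y • pd i f y := by
  simp only [pd, fderiv_fun_smul ha hf, add_apply, smul_apply,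
    ContinuousLinearMap.smulRight_apply]
  rw [add_comm]

theorem pd_inv {a : Plane → ℂ} (ha : DifferentiableAt ℝ a y) (h0 : a y ≠ 0) :
    pd i (fun x => (a x)⁻¹) y = -pd i a y / a y ^ 2 := by
  have h := pd_mul i ha (ha.fun_inv h0)
  have h1 : pd i (fun x => a x * (a x)⁻¹) y = 0 := by
    rw [pd_congr (g := fun _ => 1) i, pd_const]
    filter_upwards [ha.continuousAt.eventually_ne h0] with x hx
    exact mul_inv_cancel₀ hx
  rw [h1] at h
  field_simp at h ⊢
  linear_combination -h

theorem pd_apply {W : Type*} [NormedAddCommGroup W] [NormedSpace ℝ W] (L : V →L[ℝ] W)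
    (hf : DifferentiableAt ℝ f y) : pd i (fun x => L (f x)) y = L (pd i f y) := by
  have h : HasFDerivAt (fun x => L (f x)) (L.comp (fderiv ℝ f y)) y :=
    L.hasFDerivAt.comp y hf.hasFDerivAt
  rw [pd, h.fderiv]
  rfl

theorem pd_pi_apply {F : Plane → C3} (hF : DifferentiableAt ℝ F y) (n : Fin 3) :
    pd i (fun x => F x n) y = pd i F y n :=
  pd_apply i (ContinuousLinearMap.proj (R := ℝ) (φ := fun _ : Fin 3 => ℂ) n) hF

theorem pd_comm (hf : ContDiffAt ℝ ∞ f y) : pd i (pd j f) y = pd j (pd i f) y := by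
  have hd : DifferentiableAt ℝ (fderiv ℝ f) y :=
    (hf.fderiv_right (m := 1) (WithTop.coe_le_coe.2 le_top)).differentiableAt (by norm_num)
  have h : ∀ i j, pd i (pd j f) y =
      fderiv ℝ (fderiv ℝ f) y (EuclideanSpace.single i 1) (EuclideanSpace.single j 1) := by
    intro i j
    have := pd_apply i (ContinuousLinearMap.apply ℝ V (EuclideanSpace.single j (1 : ℝ))) hd
    exact this
  rw [h, h]
  exact (hf.isSymmSndFDerivAt (by
    simpa using (WithTop.coe_le_coe.2 le_top : ((2 : ℕ∞) : WithTop ℕ∞) ≤ ∞))) _ _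

theorem contDiffOn_pd (hU : IsOpen U) (hf : ContDiffOn ℝ ∞ f U) : ContDiffOn ℝ ∞ (pd i f) U :=
  (hf.fderiv_of_isOpen hU (by simp)).clm_apply contDiffOn_const

theorem differentiableAt_of_contDiffOn (hU : IsOpen U) (hf : ContDiffOn ℝ ∞ f U) (hy : y ∈ U) :
    DifferentiableAt ℝ f y :=
  (hf.contDiffAt (hU.mem_nhds hy)).differentiableAt (by simp)

theorem pd_comp {τ : Plane → Plane} (hf : DifferentiableAt ℝ f (τ y))
    (hτ : DifferentiableAt ℝ τ y) :
    pd i (fun x => f (τ x)) y = ∑ k, pd i τ y k • pd k f (τ y) := by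
  have h : HasFDerivAt (fun x => f (τ x)) ((fderiv ℝ f (τ y)).comp (fderiv ℝ τ y)) y :=
    hf.hasFDerivAt.comp y hτ.hasFDerivAt
  rw [pd, h.fderiv]
  exact fderiv_eq_sum_pd _

end PartialDerivatives

section FrameSystem

set_option maxSynthPendingDepth 3

variable {U : Set Plane} {A : Fin 2 → Fin 3 → Fin 3 → Plane → ℂ} {F F' : Plane → Fin 3 → C3}
  {y₀ : Plane}

/-- The frame `F` solves the linear system `∂ᵢ F_b = ∑ A_{ibc} F_c` on `U`. -/
def IsParallelFrame (A : Fin 2 → Fin 3 → Fin 3 → Plane → ℂ) (U : Set Plane)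
    (F : Plane → Fin 3 → C3) : Prop :=
  ∀ y ∈ U, DifferentiableAt ℝ F y ∧ ∀ i b, pd i F y b = ∑ c, A i b c y • F y c

/-- The zero curvature condition for the coefficients of the system of `IsParallelFrame`. -/
def IsFlatCoeff (A : Fin 2 → Fin 3 → Fin 3 → Plane → ℂ) (U : Set Plane) : Prop :=
  ∀ y ∈ U, ∀ b c, pd 0 (A 1 b c) y + ∑ d, A 1 b d y * A 0 d c y =
    pd 1 (A 0 b c) y + ∑ d, A 0 b d y * A 1 d c y

theorem isParallelFrame_iff : IsParallelFrame A U F ↔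
    IsParallelOn (fun y => connectionForm fun i b c => A i b c y) U F := by
  refine forall₂_congr fun y _ => ⟨fun ⟨h, h'⟩ => h.hasFDerivAt.congr_fderiv ?_,
    fun h => ⟨h.differentiableAt, fun i b => ?_⟩⟩
  · ext1 v
    rw [fderiv_eq_sum_pd, ContinuousLinearMap.flip_apply, connectionForm_apply, sum_apply]
    refine Finset.sum_congr rfl fun i _ => ?_
    rw [smul_apply]
    congr 1
    funext b
    rw [h', frameAction_apply]
  · rw [pd, h.fderiv, ContinuousLinearMap.flip_apply, connectionForm_single, frameAction_apply]

theorem contDiffOn_coeff (hA : ∀ i b c, ContDiffOn ℝ ∞ (A i b c) U) :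
    ContDiffOn ℝ ∞ (fun y i b c => A i b c y) U :=
  contDiffOn_pi.2 fun i => contDiffOn_pi.2 fun b => contDiffOn_pi.2 fun c => hA i b c

theorem contDiffOn_connectionForm (hA : ∀ i b c, ContDiffOn ℝ ∞ (A i b c) U) :
    ContDiffOn ℝ ∞ (fun y => connectionForm fun i b c => A i b c y) U :=
  connectionForm.contDiff.comp_contDiffOn (contDiffOn_coeff hA)

theorem pd_coeff {y : Plane} (hA : DifferentiableAt ℝ (fun y i b c => A i b c y) y)
    (i j : Fin 2) (b c : Fin 3) : pd i (fun y i b c => A i b c y) y j b c = pd i (A j b c) y :=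
  (pd_apply i (((ContinuousLinearMap.proj (R := ℝ) (φ := fun _ : Fin 3 => ℂ) c).comp
    (ContinuousLinearMap.proj (R := ℝ) (φ := fun _ : Fin 3 => Fin 3 → ℂ) b)).comp
    (ContinuousLinearMap.proj (R := ℝ) (φ := fun _ : Fin 2 => Fin 3 → Fin 3 → ℂ) j)) hA).symm

theorem fderiv_connectionForm {B : Plane → Fin 2 → Fin 3 → Fin 3 → ℂ} {y : Plane}
    (hB : DifferentiableAt ℝ B y) (u v : Plane) :
    fderiv ℝ (fun y => connectionForm (B y)) y u v = connectionForm (fderiv ℝ B y u) v := by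
  have h : HasFDerivAt (fun y => connectionForm (B y)) (connectionForm.comp (fderiv ℝ B y)) y :=
    connectionForm.hasFDerivAt.comp y hB.hasFDerivAt
  rw [h.fderiv]
  rfl

theorem IsFlatCoeff.isFlatOn_connectionForm (hU : IsOpen U)
    (hA : ∀ i b c, ContDiffOn ℝ ∞ (A i b c) U) (hflat : IsFlatCoeff A U) :
    IsFlatOn (fun y => connectionForm fun i b c => A i b c y) U := by
  intro y hy u v
  have hd := differentiableAt_of_contDiffOn hU (contDiffOn_coeff hA) hy
  rw [fderiv_connectionForm hd, fderiv_connectionForm hd]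
  ext Φ b n
  have hcurv : ∑ c, (pd 0 (A 1 b c) y + ∑ d, A 1 b d y * A 0 d c y) * Φ c n =
      ∑ c, (pd 1 (A 0 b c) y + ∑ d, A 0 b d y * A 1 d c y) * Φ c n := by
    simp only [hflat y hy b]
  simp only [fderiv_eq_sum_pd, connectionForm_apply, add_apply, smul_apply,
    ContinuousLinearMap.comp_apply, Pi.add_apply, Pi.smul_apply, frameAction_apply,
    Fin.sum_univ_two, Fin.sum_univ_three, pd_coeff hd, smul_eq_mul, Complex.real_smul] at hcurv ⊢
  linear_combination ((u 0 : ℂ) * (v 1 : ℂ) - u 1 * v 0) * hcurv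

theorem exists_isParallelFrame (hU : IsOpen U) (hA : ∀ i b c, ContDiffOn ℝ ∞ (A i b c) U)
    (hflat : IsFlatCoeff A U) (hy₀ : y₀ ∈ U) (F₀ : Fin 3 → C3) :
    ∃ r > 0, Metric.ball y₀ r ⊆ U ∧ ∃ F : Plane → Fin 3 → C3, F y₀ = F₀ ∧
      IsParallelFrame A (Metric.ball y₀ r) F := by
  simp only [isParallelFrame_iff]
  exact exists_isParallelOn_of_isFlatOn hU
    ((contDiffOn_connectionForm hA).of_le (WithTop.coe_le_coe.2 le_top))
    (hflat.isFlatOn_connectionForm hU hA) hy₀ F₀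

theorem IsParallelFrame.contDiffOn (hU : IsOpen U) (hA : ∀ i b c, ContDiffOn ℝ ∞ (A i b c) U)
    (hF : IsParallelFrame A U F) : ContDiffOn ℝ ∞ F U :=
  (isParallelFrame_iff.1 hF).contDiffOn hU (contDiffOn_connectionForm hA)

theorem IsParallelFrame.eqOn_of_starConvex (hU : StarConvex ℝ y₀ U)
    (hA : ∀ i b c, ContDiffOn ℝ ∞ (A i b c) U) (hF : IsParallelFrame A U F)
    (hF' : IsParallelFrame A U F') (h0 : F y₀ = F' y₀) : EqOn F F' U :=
  (isParallelFrame_iff.1 hF).eqOn_of_starConvex hU (contDiffOn_connectionForm hA).continuousOn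
    (isParallelFrame_iff.1 hF') h0

end FrameSystem

/-! ### Metrics in null coordinates -/

section NullCoordinates

/-- The Jacobian determinant of a pair of complex functions. -/
def jac (z w : Plane → ℂ) (y : Plane) : ℂ := pd 0 z y * pd 1 w y - pd 1 z y * pd 0 w y

variable {V : Type*} [NormedAddCommGroup V] [NormedSpace ℝ V] [NormedSpace ℂ V]
  {z w : Plane → ℂ} {f g : Plane → V} {y : Plane} {U : Set Plane} (i j : Fin 2)

/-- The null derivative `∂f/∂z`: the coefficient of `dz` in `df = (∂f/∂z) dz + (∂f/∂w) dw`. -/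
def delZ (z w : Plane → ℂ) (f : Plane → V) (y : Plane) : V :=
  (jac z w y)⁻¹ • (pd 1 w y • pd 0 f y - pd 0 w y • pd 1 f y)

/-- The null derivative `∂f/∂w`: the coefficient of `dw` in `df = (∂f/∂z) dz + (∂f/∂w) dw`. -/
def delW (z w : Plane → ℂ) (f : Plane → V) (y : Plane) : V :=
  (jac z w y)⁻¹ • (pd 0 z y • pd 1 f y - pd 1 z y • pd 0 f y)

/-- A pair of smooth complex functions with independent differentials: in the application,
holomorphic coordinates of the two complex structures that define a conformal class. -/
structure NullCoords (U : Set Plane) (z w : Plane → ℂ) : Prop where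
  isOpen : IsOpen U
  smooth_z : ContDiffOn ℝ ∞ z U
  smooth_w : ContDiffOn ℝ ∞ w U
  jac_ne : ∀ y ∈ U, jac z w y ≠ 0

theorem pd_eq_delZ_add_delW (hJ : jac z w y ≠ 0) :
    pd i f y = pd i z y • delZ z w f y + pd i w y • delW z w f y := by
  have cramer : jac z w y • pd i f y = pd i z y • (pd 1 w y • pd 0 f y - pd 0 w y • pd 1 f y)
      + pd i w y • (pd 0 z y • pd 1 f y - pd 1 z y • pd 0 f y) := by
    fin_cases i <;> simp only [jac, Fin.zero_eta, Fin.mk_one] <;> module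
  rw [delZ, delW, smul_comm (pd i z y), smul_comm (pd i w y), ← smul_add, ← cramer,
    inv_smul_smul₀ hJ]

theorem delZ_eq (hJ : jac z w y ≠ 0) {a b : V} (h : ∀ i, pd i f y = pd i z y • a + pd i w y • b) :
    delZ z w f y = a := by
  have : pd 1 w y • pd 0 f y - pd 0 w y • pd 1 f y = jac z w y • a := by
    rw [h, h, jac]
    module
  rw [delZ, this, inv_smul_smul₀ hJ]

theorem delW_eq (hJ : jac z w y ≠ 0) {a b : V} (h : ∀ i, pd i f y = pd i z y • a + pd i w y • b) :
    delW z w f y = b := by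
  have : pd 0 z y • pd 1 f y - pd 1 z y • pd 0 f y = jac z w y • b := by
    rw [h, h, jac]
    module
  rw [delW, this, inv_smul_smul₀ hJ]

namespace NullCoords

variable (H : NullCoords U z w)
include H

theorem differentiableAt {E : Type*} [NormedAddCommGroup E] [NormedSpace ℝ E] {f : Plane → E}
    (hf : ContDiffOn ℝ ∞ f U) (hy : y ∈ U) : DifferentiableAt ℝ f y :=
  differentiableAt_of_contDiffOn H.isOpen hf hy

theorem smooth_pd {E : Type*} [NormedAddCommGroup E] [NormedSpace ℝ E] {f : Plane → E}
    (hf : ContDiffOn ℝ ∞ f U) : ContDiffOn ℝ ∞ (pd i f) U :=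
  contDiffOn_pd i H.isOpen hf

theorem smooth_jac : ContDiffOn ℝ ∞ (jac z w) U :=
  ((H.smooth_pd 0 H.smooth_z).mul (H.smooth_pd 1 H.smooth_w)).sub
    ((H.smooth_pd 1 H.smooth_z).mul (H.smooth_pd 0 H.smooth_w))

theorem smooth_jac_inv : ContDiffOn ℝ ∞ (fun y => (jac z w y)⁻¹) U :=
  H.smooth_jac.inv H.jac_ne

variable [IsScalarTower ℝ ℂ V]

theorem smooth_delZ (hf : ContDiffOn ℝ ∞ f U) : ContDiffOn ℝ ∞ (delZ z w f) U :=
  H.smooth_jac_inv.smul (((H.smooth_pd 1 H.smooth_w).smul (H.smooth_pd 0 hf)).sub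
    ((H.smooth_pd 0 H.smooth_w).smul (H.smooth_pd 1 hf)))

theorem smooth_delW (hf : ContDiffOn ℝ ∞ f U) : ContDiffOn ℝ ∞ (delW z w f) U :=
  H.smooth_jac_inv.smul (((H.smooth_pd 0 H.smooth_z).smul (H.smooth_pd 1 hf)).sub
    ((H.smooth_pd 1 H.smooth_z).smul (H.smooth_pd 0 hf)))

theorem pd_pd {a b : Plane → V} (ha : ContDiffOn ℝ ∞ a U) (hb : ContDiffOn ℝ ∞ b U)
    (hab : ∀ y ∈ U, ∀ i, pd i f y = pd i z y • a y + pd i w y • b y) (hy : y ∈ U) :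
    pd i (pd j f) y = pd i (pd j z) y • a y + pd j z y • pd i a y
      + (pd i (pd j w) y • b y + pd j w y • pd i b y) := by
  have hz := H.differentiableAt (H.smooth_pd j H.smooth_z) hy
  have hw := H.differentiableAt (H.smooth_pd j H.smooth_w) hy
  have hda := H.differentiableAt ha hy
  have hdb := H.differentiableAt hb hy
  rw [pd_congr_on (f := pd j f) i H.isOpen (fun y hy => hab y hy j) hy,
    pd_add i (hz.fun_smul hda) (hw.fun_smul hdb), pd_smul i hz hda, pd_smul i hw hdb]

theorem delW_delZ (hf : ContDiffOn ℝ ∞ f U) (hy : y ∈ U) :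
    delW z w (delZ z w f) y = delZ z w (delW z w f) y := by
  have h01 := H.pd_pd 0 1 (H.smooth_delZ hf) (H.smooth_delW hf)
    (fun y hy i => pd_eq_delZ_add_delW i (H.jac_ne y hy)) hy
  have h10 := H.pd_pd 1 0 (H.smooth_delZ hf) (H.smooth_delW hf)
    (fun y hy i => pd_eq_delZ_add_delW i (H.jac_ne y hy)) hy
  have hU := H.isOpen.mem_nhds hy
  rw [pd_comm 0 1 (hf.contDiffAt hU), h10, pd_comm 0 1 (H.smooth_z.contDiffAt hU),
    pd_comm 0 1 (H.smooth_w.contDiffAt hU)] at h01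
  have hclosed : pd 0 z y • pd 1 (delZ z w f) y - pd 1 z y • pd 0 (delZ z w f) y =
      pd 1 w y • pd 0 (delW z w f) y - pd 0 w y • pd 1 (delW z w f) y := by
    rw [← sub_eq_zero] at h01 ⊢
    rw [← h01]
    abel
  rw [delW, hclosed, delZ]

end NullCoords

end NullCoordinates

theorem contDiffOn_div {f g : Plane → ℂ} {U : Set Plane} (hf : ContDiffOn ℝ ∞ f U)
    (hg : ContDiffOn ℝ ∞ g U) (h0 : ∀ y ∈ U, g y ≠ 0) :
    ContDiffOn ℝ ∞ (fun y => f y / g y) U := by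
  simp only [div_eq_mul_inv]
  exact hf.mul (hg.inv h0)

/-- `G` is the matrix of the symmetric product `l dz dw` of two covectors with components `Z` and
`W`. -/
def IsNullForm (G : Matrix (Fin 2) (Fin 2) ℂ) (l : ℂ) (Z W : Fin 2 → ℂ) : Prop :=
  ∀ i j, G i j = l * ((1 / 2) * (Z i * W j + W i * Z j))

section NullMetric

variable {z w l : Plane → ℂ} {G : Plane → Matrix (Fin 2) (Fin 2) ℂ} {y : Plane} {U : Set Plane}

/-- The coefficient of `dz` in `dl / l`, that is, `∂(log l)/∂z`. -/
def logDelZ (z w l : Plane → ℂ) (y : Plane) : ℂ := delZ z w l y / l y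

/-- The coefficient of `dw` in `dl / l`, that is, `∂(log l)/∂w`. -/
def logDelW (z w l : Plane → ℂ) (y : Plane) : ℂ := delW z w l y / l y

/-- A complex metric in conformal form: `G = l dz dw` on `U`, with `l ≠ 0`. -/
structure NullMetric (U : Set Plane) (z w l : Plane → ℂ) (G : Plane → Matrix (Fin 2) (Fin 2) ℂ) :
    Prop extends NullCoords U z w where
  smooth_l : ContDiffOn ℝ ∞ l U
  l_ne : ∀ y ∈ U, l y ≠ 0
  form : ∀ y ∈ U, IsNullForm (G y) (l y) (fun i => pd i z y) (fun i => pd i w y)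

theorem IsNullForm.det {G : Matrix (Fin 2) (Fin 2) ℂ} {l : ℂ} {Z W : Fin 2 → ℂ}
    (h : IsNullForm G l Z W) : G.det = -(l ^ 2 / 4 * (Z 0 * W 1 - Z 1 * W 0) ^ 2) := by
  rw [Matrix.det_fin_two, h, h, h, h]
  ring

theorem IsNullForm.det_ne_zero {G : Matrix (Fin 2) (Fin 2) ℂ} {l : ℂ} {Z W : Fin 2 → ℂ}
    (h : IsNullForm G l Z W) (hl : l ≠ 0) (hJ : Z 0 * W 1 - Z 1 * W 0 ≠ 0) : G.det ≠ 0 := by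
  rw [h.det]
  simp [hl, hJ]

theorem IsNullForm.inv {G : Matrix (Fin 2) (Fin 2) ℂ} {l : ℂ} {Z W : Fin 2 → ℂ}
    (h : IsNullForm G l Z W) (hl : l ≠ 0) (hJ : Z 0 * W 1 - Z 1 * W 0 ≠ 0) (i j : Fin 2) :
    G⁻¹ i j = 2 / (l * (Z 0 * W 1 - Z 1 * W 0) ^ 2) *
      (![W 1, -W 0] i * ![-Z 1, Z 0] j + ![-Z 1, Z 0] i * ![W 1, -W 0] j) := by
  obtain ⟨J, hJ'⟩ : ∃ J, J = Z 0 * W 1 - Z 1 * W 0 := ⟨_, rfl⟩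
  rw [← hJ'] at hJ ⊢
  have : G⁻¹ = Matrix.of fun i j => 2 / (l * J ^ 2) *
      (![W 1, -W 0] i * ![-Z 1, Z 0] j + ![-Z 1, Z 0] i * ![W 1, -W 0] j) := by
    refine Matrix.inv_eq_right_inv ?_
    ext i j
    fin_cases i <;> fin_cases j <;>
      simp [Matrix.mul_apply, h _ _] <;> field_simp <;> (try rw [hJ']) <;> ring
  rw [this]
  rfl

namespace NullMetric

variable (H : NullMetric U z w l G)
include H

theorem smooth_logDelZ : ContDiffOn ℝ ∞ (logDelZ z w l) U :=
  contDiffOn_div (H.smooth_delZ H.smooth_l) H.smooth_l H.l_ne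

theorem smooth_logDelW : ContDiffOn ℝ ∞ (logDelW z w l) U :=
  contDiffOn_div (H.smooth_delW H.smooth_l) H.smooth_l H.l_ne

theorem pd_l (hy : y ∈ U) (i : Fin 2) : pd i l y =
    l y * (logDelZ z w l y * pd i z y + logDelW z w l y * pd i w y) := by
  have := pd_eq_delZ_add_delW (f := l) i (H.jac_ne y hy)
  have hl := H.l_ne y hy
  simp only [smul_eq_mul] at this
  rw [this, logDelZ, logDelW]
  field_simp

theorem pd_form (hy : y ∈ U) (i j k : Fin 2) : pd i (fun y => G y j k) y =
    pd i l y * ((1 / 2) * (pd j z y * pd k w y + pd j w y * pd k z y)) +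
      l y * ((1 / 2) * (pd i (pd j z) y * pd k w y + pd j z y * pd i (pd k w) y +
        (pd i (pd j w) y * pd k z y + pd j w y * pd i (pd k z) y))) := by
  have dz := fun j => H.differentiableAt (H.smooth_pd j H.smooth_z) hy
  have dw := fun j => H.differentiableAt (H.smooth_pd j H.smooth_w) hy
  have dl := H.differentiableAt H.smooth_l hy
  have hG : ∀ y ∈ U, G y j k =
      l y * ((1 / 2) * (pd j z y * pd k w y + pd j w y * pd k z y)) := fun y hy => H.form y hy j k
  have d1 := ((dz j).fun_mul (dw k)).fun_add ((dw j).fun_mul (dz k))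
  rw [pd_congr_on i H.isOpen hG hy, pd_mul i dl (d1.const_mul _), pd_const_mul i _ d1,
    pd_add i ((dz j).fun_mul (dw k)) ((dw j).fun_mul (dz k)), pd_mul i (dz j) (dw k),
    pd_mul i (dw j) (dz k)]

theorem sum_pd_form (hy : y ∈ U) (i j m : Fin 2) :
    pd i (fun y' => G y' j m) y + pd j (fun y' => G y' i m) y - pd m (fun y' => G y' i j) y =
      l y * ((pd i (pd j z) y + logDelZ z w l y * pd i z y * pd j z y) * pd m w y +
        (pd i (pd j w) y + logDelW z w l y * pd i w y * pd j w y) * pd m z y) := by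
  have hU := H.isOpen.mem_nhds hy
  have hz : ∀ i j, pd i (pd j z) y = pd j (pd i z) y := fun i j =>
    pd_comm i j (H.smooth_z.contDiffAt hU)
  have hw : ∀ i j, pd i (pd j w) y = pd j (pd i w) y := fun i j =>
    pd_comm i j (H.smooth_w.contDiffAt hU)
  rw [H.pd_form hy, H.pd_form hy, H.pd_form hy, H.pd_l hy, H.pd_l hy, H.pd_l hy, hz j i, hw j i,
    hz m i, hw m i, hz m j, hw m j]
  ring

theorem christoffel_eq (hy : y ∈ U) (k i j : Fin 2) : christoffel G k i j y =
    (jac z w y)⁻¹ * (![pd 1 w y, -pd 0 w y] k *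
        (pd i (pd j z) y + logDelZ z w l y * pd i z y * pd j z y)
      + ![-pd 1 z y, pd 0 z y] k *
        (pd i (pd j w) y + logDelW z w l y * pd i w y * pd j w y)) := by
  have hl := H.l_ne y hy
  have hJ := H.jac_ne y hy
  have hjac : pd 0 z y * pd 1 w y - pd 1 z y * pd 0 w y = jac z w y := rfl
  have hprod : pd 0 z y * pd 1 w y = jac z w y + pd 1 z y * pd 0 w y :=
    sub_eq_iff_eq_add.1 hjac
  simp only [christoffel, H.sum_pd_form hy, (H.form y hy).inv hl hJ, Fin.sum_univ_two, hjac]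
  generalize pd i (pd j z) y + logDelZ z w l y * pd i z y * pd j z y = X
  generalize pd i (pd j w) y + logDelW z w l y * pd i w y * pd j w y = Y
  generalize jac z w y = J at *
  fin_cases k <;> simp <;> field_simp
  · linear_combination (X * pd 1 w y - Y * pd 1 z y) * hprod
  · linear_combination (-X * pd 0 w y + Y * pd 0 z y) * hprod

theorem sum_pd_z_mul_christoffel (hy : y ∈ U) (i j : Fin 2) :
    ∑ k, pd k z y * christoffel G k i j y =
      pd i (pd j z) y + logDelZ z w l y * pd i z y * pd j z y := by
  have hJ := H.jac_ne y hy
  simp only [Fin.sum_univ_two, H.christoffel_eq hy]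
  have hJ' : jac z w y = pd 0 z y * pd 1 w y - pd 1 z y * pd 0 w y := rfl
  generalize jac z w y = J at *
  simp
  field_simp
  rw [hJ']
  ring

theorem sum_pd_w_mul_christoffel (hy : y ∈ U) (i j : Fin 2) :
    ∑ k, pd k w y * christoffel G k i j y =
      pd i (pd j w) y + logDelW z w l y * pd i w y * pd j w y := by
  have hJ := H.jac_ne y hy
  simp only [Fin.sum_univ_two, H.christoffel_eq hy]
  have hJ' : jac z w y = pd 0 z y * pd 1 w y - pd 1 z y * pd 0 w y := rfl
  generalize jac z w y = J at *
  simp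
  field_simp
  rw [hJ']
  ring

theorem smooth_christoffel (k i j : Fin 2) : ContDiffOn ℝ ∞ (christoffel G k i j) U := by
  refine ContDiffOn.congr ?_ fun y hy => H.christoffel_eq hy k i j
  have h1 := H.smooth_pd i (H.smooth_pd j H.smooth_z)
  have h2 := H.smooth_pd i (H.smooth_pd j H.smooth_w)
  have hz := fun i => H.smooth_pd i H.smooth_z
  have hw := fun i => H.smooth_pd i H.smooth_w
  have hX := h1.add ((H.smooth_logDelZ.mul (hz i)).mul (hz j))
  have hY := h2.add ((H.smooth_logDelW.mul (hw i)).mul (hw j))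
  refine H.smooth_jac_inv.mul (ContDiffOn.add (ContDiffOn.mul ?_ hX) (ContDiffOn.mul ?_ hY))
  · fin_cases k
    exacts [hw 1, (hw 0).neg]
  · fin_cases k
    exacts [(hz 1).neg, hz 0]

theorem delW_logDelZ (hy : y ∈ U) : delW z w (logDelZ z w l) y =
    delZ z w (logDelW z w l) y := by
  have hU := H.isOpen.mem_nhds hy
  have hl := H.l_ne y hy
  have da := H.differentiableAt H.smooth_logDelZ hy
  have db := H.differentiableAt H.smooth_logDelW hy
  have dl := H.differentiableAt H.smooth_l hy
  have dz := fun i => H.differentiableAt (H.smooth_pd i H.smooth_z) hy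
  have dw := fun i => H.differentiableAt (H.smooth_pd i H.smooth_w) hy
  have hpd : ∀ i j, pd i (pd j l) y = _ := fun i j => by
    rw [pd_congr_on i H.isOpen (fun y hy => H.pd_l hy j) hy,
      pd_mul i dl ((da.fun_mul (dz j)).fun_add (db.fun_mul (dw j))),
      pd_add i (da.fun_mul (dz j)) (db.fun_mul (dw j)), pd_mul i da (dz j), pd_mul i db (dw j),
      H.pd_l hy i]
  have hcomm := pd_comm 0 1 (H.smooth_l.contDiffAt hU)
  rw [hpd, hpd, pd_comm 0 1 (H.smooth_z.contDiffAt hU),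
    pd_comm 0 1 (H.smooth_w.contDiffAt hU)] at hcomm
  rw [delW, delZ]
  congr 1
  simp only [smul_eq_mul]
  refine mul_left_cancel₀ hl ?_
  linear_combination -hcomm

end NullMetric

theorem sum_pd_pd_mul_christoffel (hU : IsOpen U) {a : Plane → ℂ} (hz : ContDiffOn ℝ ∞ z U)
    (ha : ContDiffOn ℝ ∞ a U) (hΓ : ∀ k i j, ContDiffOn ℝ ∞ (christoffel G k i j) U)
    (hhess : ∀ y ∈ U, ∀ j k, ∑ m, pd m z y * christoffel G m j k y =
      pd j (pd k z) y + a y * pd j z y * pd k z y) (hy : y ∈ U) (i j k : Fin 2) :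
    ∑ m, (pd i (pd m z) y * christoffel G m j k y + pd m z y * pd i (christoffel G m j k) y) =
      pd i (pd j (pd k z)) y + ((pd i a y * pd j z y + a y * pd i (pd j z) y) * pd k z y +
        a y * pd j z y * pd i (pd k z) y) := by
  have dz := fun i => differentiableAt_of_contDiffOn hU (contDiffOn_pd i hU hz) hy
  have dz2 := fun i j =>
    differentiableAt_of_contDiffOn hU (contDiffOn_pd i hU (contDiffOn_pd j hU hz)) hy
  have da := differentiableAt_of_contDiffOn hU ha hy
  have dΓ := fun m j k => differentiableAt_of_contDiffOn hU (hΓ m j k) hy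
  have h := pd_congr_on i hU (fun y hy => hhess y hy j k) hy
  simp only [Fin.sum_univ_two] at h ⊢
  rwa [pd_add i ((dz 0).fun_mul (dΓ 0 j k)) ((dz 1).fun_mul (dΓ 1 j k)),
    pd_mul i (dz 0) (dΓ 0 j k), pd_mul i (dz 1) (dΓ 1 j k),
    pd_add i (dz2 j k) ((da.fun_mul (dz j)).fun_mul (dz k)),
    pd_mul i (da.fun_mul (dz j)) (dz k), pd_mul i da (dz j)] at h

-- The hypothesis `hhess` says `∇dz = -a dz²`, so that `R dz = da ∧ dz · dz` by the Ricci identity.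
theorem sum_pd_mul_riemann (hU : IsOpen U) {a : Plane → ℂ} (hz : ContDiffOn ℝ ∞ z U)
    (ha : ContDiffOn ℝ ∞ a U) (hΓ : ∀ k i j, ContDiffOn ℝ ∞ (christoffel G k i j) U)
    (hhess : ∀ y ∈ U, ∀ j k, ∑ m, pd m z y * christoffel G m j k y =
      pd j (pd k z) y + a y * pd j z y * pd k z y) (hy : y ∈ U) (i j k : Fin 2) :
    ∑ m, pd m z y * riemann G m i j k y =
      (pd i a y * pd j z y - pd j a y * pd i z y) * pd k z y := by
  have hijk := sum_pd_pd_mul_christoffel hU hz ha hΓ hhess hy i j k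
  have hjik := sum_pd_pd_mul_christoffel hU hz ha hΓ hhess hy j i k
  have hsum := fun j k => hhess y hy j k
  have hn := hU.mem_nhds hy
  have hcomm : pd i (pd j z) y = pd j (pd i z) y := pd_comm i j (hz.contDiffAt hn)
  have hcomm₃ : pd i (pd j (pd k z)) y = pd j (pd i (pd k z)) y :=
    pd_comm i j ((contDiffOn_pd k hU hz).contDiffAt hn)
  simp only [riemann, Fin.sum_univ_two] at hijk hjik hsum ⊢
  linear_combination hijk - hjik + hcomm₃ + christoffel G 0 j k y * hsum i 0 +
    christoffel G 1 j k y * hsum i 1 - christoffel G 0 i k y * hsum j 0 -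
    christoffel G 1 i k y * hsum j 1 + a y * pd i z y * hsum j k - a y * pd j z y * hsum i k +
    a y * pd k z y * hcomm

namespace NullMetric

variable (H : NullMetric U z w l G)
include H

theorem sum_pd_z_mul_riemann (hy : y ∈ U) (i j k : Fin 2) :
    ∑ m, pd m z y * riemann G m i j k y = delW z w (logDelZ z w l) y *
      (pd i w y * pd j z y - pd j w y * pd i z y) * pd k z y := by
  rw [sum_pd_mul_riemann H.isOpen H.smooth_z H.smooth_logDelZ H.smooth_christoffel
    (fun y hy => H.sum_pd_z_mul_christoffel hy) hy,
    pd_eq_delZ_add_delW (f := logDelZ z w l) i (H.jac_ne y hy),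
    pd_eq_delZ_add_delW (f := logDelZ z w l) j (H.jac_ne y hy)]
  simp only [smul_eq_mul]
  ring

theorem sum_pd_w_mul_riemann (hy : y ∈ U) (i j k : Fin 2) :
    ∑ m, pd m w y * riemann G m i j k y = delW z w (logDelZ z w l) y *
      (pd i z y * pd j w y - pd j z y * pd i w y) * pd k w y := by
  rw [sum_pd_mul_riemann H.isOpen H.smooth_w H.smooth_logDelW H.smooth_christoffel
    (fun y hy => H.sum_pd_w_mul_christoffel hy) hy,
    pd_eq_delZ_add_delW (f := logDelW z w l) i (H.jac_ne y hy),
    pd_eq_delZ_add_delW (f := logDelW z w l) j (H.jac_ne y hy), H.delW_logDelZ hy]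
  simp only [smul_eq_mul]
  ring

theorem curvature_eq (hy : y ∈ U) :
    curvature G y = -(2 / l y) * delW z w (logDelZ z w l) y := by
  have hJ := H.jac_ne y hy
  have hl := H.l_ne y hy
  have hz := H.sum_pd_z_mul_riemann hy 0 1 1
  have hw := H.sum_pd_w_mul_riemann hy 0 1 1
  have hG : ∀ i j, G y i j = l y * ((1 / 2) * (pd i z y * pd j w y + pd i w y * pd j z y)) :=
    H.form y hy
  have hjac : pd 0 z y * pd 1 w y - pd 1 z y * pd 0 w y = jac z w y := rfl
  rw [curvature, (H.form y hy).det, hjac, div_eq_iff (by simp [hJ, hl])]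
  generalize delW z w (logDelZ z w l) y = κ at *
  have hscale : -(2 / l y) * κ * -(l y ^ 2 / 4 * jac z w y ^ 2) = l y / 2 * κ * jac z w y ^ 2 := by
    field_simp
    ring
  rw [hscale]
  simp only [hG, Fin.sum_univ_two, ← hjac] at hz hw ⊢
  linear_combination (l y / 2 * pd 0 w y) * hz + (l y / 2 * pd 0 z y) * hw

theorem pd_pd_sub_sum_christoffel {f : Plane → ℂ} (hf : ContDiffOn ℝ ∞ f U) (hy : y ∈ U)
    (i j : Fin 2) : pd i (pd j f) y - ∑ k, christoffel G k i j y * pd k f y =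
      pd j z y * pd i (delZ z w f) y + pd j w y * pd i (delW z w f) y
      - logDelZ z w l y * pd i z y * pd j z y * delZ z w f y
      - logDelW z w l y * pd i w y * pd j w y * delW z w f y := by
  have hf' : ∀ i, pd i f y = _ := fun i => pd_eq_delZ_add_delW i (H.jac_ne y hy)
  have hz := H.sum_pd_z_mul_christoffel hy i j
  have hw := H.sum_pd_w_mul_christoffel hy i j
  simp only [Fin.sum_univ_two] at hz hw ⊢
  rw [H.pd_pd i j (H.smooth_delZ hf) (H.smooth_delW hf)
    (fun y hy i => pd_eq_delZ_add_delW i (H.jac_ne y hy)) hy, hf' 0, hf' 1]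
  simp only [smul_eq_mul]
  linear_combination -delZ z w f y * hz - delW z w f y * hw

theorem laplacian_eq {f : Plane → ℂ} (hf : ContDiffOn ℝ ∞ f U) (hy : y ∈ U) :
    laplacian G f y = 4 / l y * delW z w (delZ z w f) y := by
  have hJ := H.jac_ne y hy
  have hl := H.l_ne y hy
  have hZ : ∀ i, pd i (delZ z w f) y = _ := fun i => pd_eq_delZ_add_delW i hJ
  have hW : ∀ i, pd i (delW z w f) y = _ := fun i => pd_eq_delZ_add_delW i hJ
  have hjac : jac z w y = pd 0 z y * pd 1 w y - pd 1 z y * pd 0 w y := rfl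
  simp only [laplacian, H.pd_pd_sub_sum_christoffel hf hy]
  simp only [(H.form y hy).inv hl hJ, hZ, hW, ← H.delW_delZ hf hy, ← hjac, smul_eq_mul,
    Fin.sum_univ_two]
  generalize jac z w y = J at *
  simp
  field_simp
  rw [hjac]
  ring

end NullMetric

end NullMetric

section Algebra

variable {G : Matrix (Fin 2) (Fin 2) ℂ} {l s c : ℂ} {Z W v v' : Fin 2 → ℂ}

/-- A vector spanning the kernel of the covector `Z ≠ 0`: the isotropic directions of `l dz dw` are
spanned by the vectors `kerVec dz` and `kerVec dw`. -/
def kerVec (Z : Fin 2 → ℂ) : Fin 2 → ℂ := ![-Z 1, Z 0]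

theorem side_smul (c : ℂ) (v : Fin 2 → ℂ) : side (c • v) = Complex.normSq c * side v := by
  simp only [side, Pi.smul_apply, smul_eq_mul, map_mul, Complex.mul_im, Complex.mul_re,
    Complex.conj_re, Complex.conj_im, Complex.normSq_apply]
  ring

theorem side_kerVec (Z : Fin 2 → ℂ) : side (kerVec Z) = side Z := by
  simp [side, kerVec]
  ring

theorem dotProduct_kerVec (Z W : Fin 2 → ℂ) : Z ⬝ᵥ kerVec W = Z 1 * W 0 - Z 0 * W 1 := by
  simp [kerVec, dotProduct, Fin.sum_univ_two]
  ring

theorem exists_eq_smul_kerVec (hZ : Z 0 ≠ 0) (hv : Z ⬝ᵥ v = 0) : ∃ c : ℂ, v = c • kerVec Z := by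
  rw [dotProduct, Fin.sum_univ_two] at hv
  refine ⟨v 1 / Z 0, funext fun i => ?_⟩
  fin_cases i
  · simp [kerVec]
    field_simp
    linear_combination hv
  · simp [kerVec, hZ]

theorem exists_side_eq_normSq_mul (hZ : side Z ≠ 0) (hv : Z ⬝ᵥ v = 0) :
    ∃ c : ℂ, v = c • kerVec Z ∧ side v = Complex.normSq c * side Z := by
  obtain ⟨c, rfl⟩ := exists_eq_smul_kerVec (fun h0 => hZ (by simp [side, h0])) hv
  exact ⟨c, rfl, by rw [side_smul, side_kerVec]⟩

theorem dotProduct_ne_zero_of_side_mul_neg (h : side Z * side v < 0) : Z ⬝ᵥ v ≠ 0 := fun hv => by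
  obtain ⟨c, -, hc⟩ := exists_side_eq_normSq_mul (left_ne_zero_of_mul h.ne) hv
  rw [hc] at h
  nlinarith [mul_nonneg (Complex.normSq_nonneg c) (mul_self_nonneg (side Z))]

theorem jac_ne_zero_of_side (hZ : 0 < side Z) (hW : side W < 0) : Z 0 * W 1 - Z 1 * W 0 ≠ 0 := by
  have := dotProduct_ne_zero_of_side_mul_neg (Z := Z) (v := kerVec W)
    (by rw [side_kerVec]; exact mul_neg_of_pos_of_neg hZ hW)
  rw [dotProduct_kerVec] at this
  exact fun h => this (by linear_combination -h)

namespace IsNullForm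

variable (h : IsNullForm G l Z W)
include h

theorem dotProduct_mulVec (v v' : Fin 2 → ℂ) :
    v ⬝ᵥ G.mulVec v' = l / 2 * ((Z ⬝ᵥ v) * (W ⬝ᵥ v') + (W ⬝ᵥ v) * (Z ⬝ᵥ v')) := by
  simp only [dotProduct, Matrix.mulVec, Fin.sum_univ_two, h _ _]
  ring

theorem isIsotropic_iff (hl : l ≠ 0) : IsIsotropic G v ↔ Z ⬝ᵥ v = 0 ∨ W ⬝ᵥ v = 0 := by
  have : v ⬝ᵥ G.mulVec v = l * ((Z ⬝ᵥ v) * (W ⬝ᵥ v)) := by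
    rw [h.dotProduct_mulVec]
    ring
  rw [IsIsotropic, this, mul_eq_zero, mul_eq_zero, or_iff_right hl]

theorem isIsotropic_kerVec (hl : l ≠ 0) :
    IsIsotropic G (kerVec Z) ∧ IsIsotropic G (kerVec W) := by
  constructor
  · exact (h.isIsotropic_iff hl).2 (Or.inl (by rw [dotProduct_kerVec]; ring))
  · exact (h.isIsotropic_iff hl).2 (Or.inr (by rw [dotProduct_kerVec]; ring))

theorem isPositiveForm (hl : l ≠ 0) (hZ : 0 < side Z) (hW : side W < 0) : IsPositiveForm G := by
  have side_ne_zero : ∀ {Z v : Fin 2 → ℂ}, side Z ≠ 0 → v ≠ 0 → Z ⬝ᵥ v = 0 → side v ≠ 0 := by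
    intro Z v hZ hv hZv
    obtain ⟨c, rfl, hc⟩ := exists_side_eq_normSq_mul hZ hZv
    rw [hc]
    exact mul_ne_zero (mt Complex.normSq_eq_zero.1 (left_ne_zero_of_smul hv)) hZ
  refine ⟨fun v hv hiso => ?_, ⟨kerVec Z, (h.isIsotropic_kerVec hl).1, by rwa [side_kerVec]⟩,
    ⟨kerVec W, (h.isIsotropic_kerVec hl).2, by rwa [side_kerVec]⟩⟩
  rcases (h.isIsotropic_iff hl).1 hiso with hZv | hWv
  exacts [side_ne_zero hZ.ne' hv hZv, side_ne_zero hW.ne hv hWv]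

theorem isVolumeCoeff_iff (hl : l ≠ 0) (hZ : 0 < side Z) (hW : side W < 0) :
    IsVolumeCoeff G s ↔ s = Complex.I * l / 2 * (Z 0 * W 1 - Z 1 * W 0) := by
  constructor
  · rintro ⟨-, hs⟩
    have value := hs (kerVec W) (kerVec Z) (h.isIsotropic_kerVec hl).2 (h.isIsotropic_kerVec hl).1
      (by rwa [side_kerVec]) (by rwa [side_kerVec])
    simp only [h.dotProduct_mulVec, dotProduct_kerVec] at value
    simp only [kerVec, Matrix.cons_val_zero, Matrix.cons_val_one] at value
    refine mul_right_cancel₀ (jac_ne_zero_of_side hZ hW) ?_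
    linear_combination -value
  · rintro rfl
    refine ⟨?_, fun v v' hv hv' hneg hpos => ?_⟩
    · rw [h.det]
      linear_combination (l ^ 2 / 4 * (Z 0 * W 1 - Z 1 * W 0) ^ 2) * Complex.I_sq
    · have hWv : W ⬝ᵥ v = 0 := ((h.isIsotropic_iff hl).1 hv).resolve_left
        (dotProduct_ne_zero_of_side_mul_neg (mul_neg_of_pos_of_neg hZ hneg))
      have hZv' : Z ⬝ᵥ v' = 0 := ((h.isIsotropic_iff hl).1 hv').resolve_right
        (dotProduct_ne_zero_of_side_mul_neg (mul_neg_of_neg_of_pos hW hpos))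
      obtain ⟨c, rfl, -⟩ := exists_side_eq_normSq_mul hW.ne hWv
      obtain ⟨c', rfl, -⟩ := exists_side_eq_normSq_mul hZ.ne' hZv'
      simp only [h.dotProduct_mulVec, dotProduct_smul, dotProduct_kerVec]
      simp only [kerVec, Pi.smul_apply, smul_eq_mul, Matrix.cons_val_zero, Matrix.cons_val_one]
      ring

theorem sum_inv_mul (hl : l ≠ 0) (hJ : Z 0 * W 1 - Z 1 * W 0 ≠ 0) :
    ∑ i, ∑ j, G⁻¹ i j * (Z i * W j) = 2 / l := by
  simp only [h.inv hl hJ, Fin.sum_univ_two]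
  simp
  field_simp
  ring

theorem sum_pairing (hl : l ≠ 0) (hJ : Z 0 * W 1 - Z 1 * W 0 ≠ 0) (p q : ℂ) :
    ∑ i : Fin 3 → Fin 2, ∑ j : Fin 3 → Fin 2,
      (∏ a, G⁻¹ (i a) (j a)) * (p * ∏ a, Z (i a)) * (q * ∏ a, W (j a)) =
      8 * p * q / l ^ 3 := by
  have prod_sum : (∏ _a : Fin 3, ∑ i, ∑ j, G⁻¹ i j * (Z i * W j)) =
      ∑ i : Fin 3 → Fin 2, ∑ j : Fin 3 → Fin 2, ∏ a, (G⁻¹ (i a) (j a) * (Z (i a) * W (j a))) := by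
    simp only [Finset.prod_univ_sum, Fintype.piFinset_univ]
  have term_eq (i j : Fin 3 → Fin 2) :
      (∏ a, G⁻¹ (i a) (j a)) * (p * ∏ a, Z (i a)) * (q * ∏ a, W (j a)) =
        p * q * ∏ a, (G⁻¹ (i a) (j a) * (Z (i a) * W (j a))) := by
    rw [Finset.prod_mul_distrib, Finset.prod_mul_distrib]
    ring
  simp only [term_eq, ← Finset.mul_sum, ← prod_sum, h.sum_inv_mul hl hJ, Finset.prod_const,
    Finset.card_univ, Fintype.card_fin]
  ring

end IsNullForm

end Algebra

section Conformal

variable {z w l : Plane → ℂ} {G : Plane → Matrix (Fin 2) (Fin 2) ℂ} {y : Plane} {U : Set Plane}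

theorem pd_exp (i : Fin 2) {f : Plane → ℂ} (hf : DifferentiableAt ℝ f y) :
    pd i (fun x => Complex.exp (f x)) y = Complex.exp (f y) * pd i f y := by
  rw [pd, hf.hasFDerivAt.cexp.fderiv]
  rfl

namespace NullMetric

variable (H : NullMetric U z w l G)
include H

theorem exp_smul {u : Plane → ℂ} (hu : ContDiffOn ℝ ∞ u U) :
    NullMetric U z w (fun y => Complex.exp (2 * u y) * l y)
      (fun y => Complex.exp (2 * u y) • G y) where
  toNullCoords := H.toNullCoords
  smooth_l := ((contDiffOn_const.mul hu).cexp).mul H.smooth_l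
  l_ne y hy := mul_ne_zero (Complex.exp_ne_zero _) (H.l_ne y hy)
  form y hy i j := by
    rw [Matrix.smul_apply, H.form y hy i j, smul_eq_mul]
    ring

theorem logDelZ_exp_mul {u : Plane → ℂ} (hu : ContDiffOn ℝ ∞ u U) (hy : y ∈ U) :
    logDelZ z w (fun y => Complex.exp (2 * u y) * l y) y =
      2 * delZ z w u y + logDelZ z w l y := by
  have hJ := H.jac_ne y hy
  have du := H.differentiableAt hu hy
  have d2u : DifferentiableAt ℝ (fun y => 2 * u y) y := du.const_mul _
  have leibniz : delZ z w (fun y => Complex.exp (2 * u y) * l y) y =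
      Complex.exp (2 * u y) * (2 * delZ z w u y * l y + delZ z w l y) := by
    refine delZ_eq hJ (b := Complex.exp (2 * u y) * (2 * delW z w u y * l y + delW z w l y))
      fun i => ?_
    rw [pd_mul i d2u.cexp (H.differentiableAt H.smooth_l hy), pd_exp i d2u, pd_const_mul i 2 du,
      pd_eq_delZ_add_delW (f := u) i hJ, pd_eq_delZ_add_delW (f := l) i hJ]
    simp only [smul_eq_mul]
    ring
  have hl := H.l_ne y hy
  rw [logDelZ, leibniz, logDelZ]
  field_simp

theorem delW_logDelZ_exp_mul {u : Plane → ℂ} (hu : ContDiffOn ℝ ∞ u U) (hy : y ∈ U) :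
    delW z w (logDelZ z w fun y => Complex.exp (2 * u y) * l y) y =
      2 * delW z w (delZ z w u) y + delW z w (logDelZ z w l) y := by
  have hJ := H.jac_ne y hy
  refine delW_eq hJ (a := 2 * delZ z w (delZ z w u) y + delZ z w (logDelZ z w l) y) fun i => ?_
  have ddu := H.differentiableAt (H.smooth_delZ hu) hy
  rw [pd_congr_on i H.isOpen (fun y hy => H.logDelZ_exp_mul hu hy) hy,
    pd_add i (ddu.const_mul 2) (H.differentiableAt H.smooth_logDelZ hy), pd_const_mul i 2 ddu,
    pd_eq_delZ_add_delW (f := delZ z w u) i hJ, pd_eq_delZ_add_delW (f := logDelZ z w l) i hJ]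
  simp only [smul_eq_mul]
  ring

theorem curvature_exp_smul {u : Plane → ℂ} (hu : ContDiffOn ℝ ∞ u U) (hy : y ∈ U) :
    curvature (fun y => Complex.exp (2 * u y) • G y) y =
      Complex.exp (-(2 * u y)) * (curvature G y - laplacian G u y) := by
  have hl := H.l_ne y hy
  rw [(H.exp_smul hu).curvature_eq hy, H.delW_logDelZ_exp_mul hu hy, H.curvature_eq hy,
    H.laplacian_eq hu hy, Complex.exp_neg]
  field_simp
  ring

end NullMetric

theorem pd_inv_sub (i : Fin 2) (dz : DifferentiableAt ℝ z y) (dw : DifferentiableAt ℝ w y)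
    (hne : z y ≠ w y) :
    pd i (fun y => (z y - w y)⁻¹) y = -(pd i z y - pd i w y) / (z y - w y) ^ 2 := by
  rw [pd_inv i (dz.fun_sub dw) (sub_ne_zero.2 hne), pd_sub i dz dw]

namespace NullCoords

variable (H : NullCoords U z w) (hne : ∀ y ∈ U, z y ≠ w y)
include H hne

theorem differentiableAt_inv_sub (hy : y ∈ U) :
    DifferentiableAt ℝ (fun y => (z y - w y)⁻¹) y :=
  ((H.differentiableAt H.smooth_z hy).fun_sub (H.differentiableAt H.smooth_w hy)).fun_inv
    (sub_ne_zero.2 (hne y hy))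

theorem logDelZ_neg_four_div_sq (hy : y ∈ U) :
    logDelZ z w (fun y => -4 / (z y - w y) ^ 2) y = -2 * (z y - w y)⁻¹ := by
  have hd : z y - w y ≠ 0 := sub_ne_zero.2 (hne y hy)
  have dinv := H.differentiableAt_inv_sub hne hy
  have inv_mul_inv : (fun y => -4 / (z y - w y) ^ 2) =
      fun y => -4 * ((z y - w y)⁻¹ * (z y - w y)⁻¹) := by
    funext y
    rw [← mul_inv, div_eq_mul_inv, pow_two]
  have delZ_coeff : delZ z w (fun y => -4 / (z y - w y) ^ 2) y = 8 / (z y - w y) ^ 3 := by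
    refine delZ_eq (H.jac_ne y hy) (b := -8 / (z y - w y) ^ 3) fun i => ?_
    rw [inv_mul_inv, pd_const_mul i _ (dinv.fun_mul dinv), pd_mul i dinv dinv,
      pd_inv_sub i (H.differentiableAt H.smooth_z hy) (H.differentiableAt H.smooth_w hy)
        (hne y hy)]
    simp only [smul_eq_mul]
    field_simp
    ring
  rw [logDelZ, delZ_coeff]
  field_simp
  norm_num

theorem delW_logDelZ_neg_four_div_sq (hy : y ∈ U) :
    delW z w (logDelZ z w fun y => -4 / (z y - w y) ^ 2) y = -2 / (z y - w y) ^ 2 := by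
  have hd : z y - w y ≠ 0 := sub_ne_zero.2 (hne y hy)
  refine delW_eq (H.jac_ne y hy) (a := 2 / (z y - w y) ^ 2) fun i => ?_
  rw [pd_congr_on i H.isOpen (fun y hy => H.logDelZ_neg_four_div_sq hne hy) hy,
    pd_const_mul i _ (H.differentiableAt_inv_sub hne hy),
    pd_inv_sub i (H.differentiableAt H.smooth_z hy) (H.differentiableAt H.smooth_w hy) (hne y hy)]
  simp only [smul_eq_mul]
  field_simp
  ring

end NullCoords

theorem NullMetric.curvature_eq_neg_one
    (H : NullMetric U z w (fun y => -4 / (z y - w y) ^ 2) G) (hne : ∀ y ∈ U, z y ≠ w y)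
    (hy : y ∈ U) : curvature G y = -1 := by
  have hd : z y - w y ≠ 0 := sub_ne_zero.2 (hne y hy)
  rw [H.curvature_eq hy, H.toNullCoords.delW_logDelZ_neg_four_div_sq hne hy]
  field_simp
  norm_num

end Conformal

/-! ### Structure equations of affine spheres -/

section Det

/-- The determinant of three vectors of `ℂ³`. -/
def det3 (a b c : C3) : ℂ := (Matrix.of ![a, b, c]).det

theorem det3_eq (a b c : C3) : det3 a b c = a 0 * b 1 * c 2 - a 0 * b 2 * c 1 - a 1 * b 0 * c 2 +
    a 1 * b 2 * c 0 + a 2 * b 0 * c 1 - a 2 * b 1 * c 0 := by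
  simp [det3, Matrix.det_fin_three]

theorem frame_eq (σ ξ : Plane → C3) (y : Plane) :
    frame σ ξ y = (Matrix.of ![pd 0 σ y, pd 1 σ y, ξ y]).transpose := rfl

theorem inducedVolume_eq (σ ξ : Plane → C3) (y : Plane) :
    inducedVolume σ ξ y = det3 (pd 0 σ y) (pd 1 σ y) (ξ y) := by
  rw [inducedVolume, frame_eq, Matrix.det_transpose, det3]

theorem linearIndependent_iff_det3_ne_zero {a b c : C3} :
    LinearIndependent ℂ ![a, b, c] ↔ det3 a b c ≠ 0 := by
  have := Matrix.linearIndependent_rows_iff_isUnit (A := Matrix.of ![a, b, c])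
  rw [Matrix.isUnit_iff_isUnit_det, isUnit_iff_ne_zero] at this
  exact this

theorem smul_add_smul_add_smul_eq_iff {u v w : C3} (h : det3 u v w ≠ 0) {a b c a' b' c' : ℂ} :
    a • u + b • v + c • w = a' • u + b' • v + c' • w ↔ a = a' ∧ b = b' ∧ c = c' := by
  constructor
  · intro heq
    have coeff_eq := Fintype.linearIndependent_iff.1 (linearIndependent_iff_det3_ne_zero.2 h)
      ![a - a', b - b', c - c'] (by
        simp only [Fin.sum_univ_three, Matrix.cons_val]
        rw [← sub_eq_zero] at heq
        rw [← heq]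
        module)
    exact ⟨sub_eq_zero.1 (coeff_eq 0), sub_eq_zero.1 (coeff_eq 1), sub_eq_zero.1 (coeff_eq 2)⟩
  · rintro ⟨rfl, rfl, rfl⟩
    rfl

theorem det3_linear (a b c : C3) (z₀ z₁ w₀ w₁ : ℂ) :
    det3 (z₀ • a + w₀ • b) (z₁ • a + w₁ • b) c = (z₀ * w₁ - z₁ * w₀) * det3 a b c := by
  simp only [det3_eq, Pi.add_apply, Pi.smul_apply, smul_eq_mul]
  ring

theorem frame_mulVec (σ ξ : Plane → C3) (y : Plane) (c : Fin 3 → ℂ) :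
    (frame σ ξ y).mulVec c = c 0 • pd 0 σ y + c 1 • pd 1 σ y + c 2 • ξ y := by
  ext n
  simp [Matrix.mulVec, dotProduct, frame, Fin.sum_univ_three]
  ring

theorem component_eq_iff {σ ξ : Plane → C3} {y : Plane}
    (h : inducedVolume σ ξ y ≠ 0) {v : C3} {c : Fin 3 → ℂ} :
    component σ ξ y v = c ↔ v = c 0 • pd 0 σ y + c 1 • pd 1 σ y + c 2 • ξ y := by
  have hu : IsUnit (frame σ ξ y).det := isUnit_iff_ne_zero.2 h
  rw [← frame_mulVec, component]
  constructor
  · rintro rfl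
    rw [Matrix.mulVec_mulVec, Matrix.mul_nonsing_inv _ hu, Matrix.one_mulVec]
  · rintro rfl
    rw [Matrix.mulVec_mulVec, Matrix.nonsing_inv_mul _ hu, Matrix.one_mulVec]

theorem pd_mul_mul (i : Fin 2) {a b c : Plane → ℂ} {y : Plane} (ha : DifferentiableAt ℝ a y)
    (hb : DifferentiableAt ℝ b y) (hc : DifferentiableAt ℝ c y) :
    pd i (fun x => a x * b x * c x) y =
      pd i a y * b y * c y + a y * pd i b y * c y + a y * b y * pd i c y := by
  rw [pd_mul i (ha.fun_mul hb) hc, pd_mul i ha hb]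
  ring

theorem pd_det3 (i : Fin 2) {f g h : Plane → C3} {y : Plane} (hf : DifferentiableAt ℝ f y)
    (hg : DifferentiableAt ℝ g y) (hh : DifferentiableAt ℝ h y) :
    pd i (fun x => det3 (f x) (g x) (h x)) y =
      det3 (pd i f y) (g y) (h y) + det3 (f y) (pd i g y) (h y) + det3 (f y) (g y) (pd i h y) := by
  have df := differentiableAt_pi.1 hf
  have dg := differentiableAt_pi.1 hg
  have dh := differentiableAt_pi.1 hh
  have dt := fun m n k => ((df m).fun_mul (dg n)).fun_mul (dh k)
  simp only [det3_eq]
  rw [pd_sub i ((((((dt 0 1 2).fun_sub (dt 0 2 1)).fun_sub (dt 1 0 2)).fun_add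
      (dt 1 2 0))).fun_add (dt 2 0 1)) (dt 2 1 0),
    pd_add i (((((dt 0 1 2).fun_sub (dt 0 2 1)).fun_sub (dt 1 0 2)).fun_add (dt 1 2 0))) (dt 2 0 1),
    pd_add i (((dt 0 1 2).fun_sub (dt 0 2 1)).fun_sub (dt 1 0 2)) (dt 1 2 0),
    pd_sub i ((dt 0 1 2).fun_sub (dt 0 2 1)) (dt 1 0 2), pd_sub i (dt 0 1 2) (dt 0 2 1)]
  simp only [pd_mul_mul i (df _) (dg _) (dh _), pd_pi_apply i hf, pd_pi_apply i hg,
    pd_pi_apply i hh]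
  ring

end Det

section Sphere

variable {U : Set Plane} {z w l p q : Plane → ℂ} {G : Plane → Matrix (Fin 2) (Fin 2) ℂ}
  {C : Plane → (Fin 3 → Fin 2) → ℂ} {σ : Plane → C3} {y : Plane}

/-- The conditions on a map into `ℂ³` to be an affine sphere with metric `G` and Pick tensor `C`,
with the position vector as affine normal, at a point of the plane. -/
structure SphereAt (G : Plane → Matrix (Fin 2) (Fin 2) ℂ) (C : Plane → (Fin 3 → Fin 2) → ℂ)
    (σ : Plane → C3) (y : Plane) : Prop where
  transversal : LinearIndependent ℂ ![pd 0 σ y, pd 1 σ y, σ y]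
  metric : ∀ i j, fundamentalForm σ σ i j y = G y i j
  parallel : ∀ i, pd i (inducedVolume σ σ) y
    - (∑ k, inducedConnection σ σ k i k y) * inducedVolume σ σ y = 0
  volume : IsVolumeCoeff (G y) (inducedVolume σ σ y)
  shape : ∀ k i, shapeOperator σ σ k i y = if k = i then -1 else 0
  pick : ∀ i j k, C y ![i, j, k] =
    -2 * ∑ l, (inducedConnection σ σ l i j y - christoffel G l i j y) * G y l k

theorem SphereAt.inducedVolume_ne_zero (h : SphereAt G C σ y) : inducedVolume σ σ y ≠ 0 := by
  rw [inducedVolume_eq]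
  exact linearIndependent_iff_det3_ne_zero.1 h.transversal

/-- A metric `G = l dz dw` and a cubic tensor `C = p dz³ + q dw³` with `p`, `q` holomorphic. -/
structure PickData (U : Set Plane) (z w l p q : Plane → ℂ) (G : Plane → Matrix (Fin 2) (Fin 2) ℂ)
    (C : Plane → (Fin 3 → Fin 2) → ℂ) : Prop extends NullMetric U z w l G where
  side_z : ∀ y ∈ U, 0 < side fun i => pd i z y
  side_w : ∀ y ∈ U, side (fun i => pd i w y) < 0
  smooth_p : ContDiffOn ℝ ∞ p U
  smooth_q : ContDiffOn ℝ ∞ q U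
  delW_p : ∀ y ∈ U, delW z w p y = 0
  delZ_q : ∀ y ∈ U, delZ z w q y = 0
  cubic : ∀ y ∈ U, ∀ i, C y i = p y * ∏ a, pd (i a) z y + q y * ∏ a, pd (i a) w y

/-- The structure equations of an affine sphere in null coordinates. -/
structure StructureEqs (z w l p q : Plane → ℂ) (σ : Plane → C3) (y : Plane) : Prop where
  pd_delZ : ∀ i, pd i (delZ z w σ) y = pd i z y • (logDelZ z w l y • delZ z w σ y -
    (p y / l y) • delW z w σ y) + pd i w y • ((l y / 2) • σ y)
  pd_delW : ∀ i, pd i (delW z w σ) y = pd i z y • ((l y / 2) • σ y) +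
    pd i w y • (logDelW z w l y • delW z w σ y - (q y / l y) • delZ z w σ y)
  det : det3 (delZ z w σ y) (delW z w σ y) (σ y) = Complex.I * l y / 2

/-- The component `dz(∇ᵢ∂ⱼ)` of the connection `∇` whose Pick tensor relative to `l dz dw` is
`p dz³ + q dw³`. -/
def connZ (z w l q : Plane → ℂ) (i j : Fin 2) (y : Plane) : ℂ :=
  pd i (pd j z) y + logDelZ z w l y * pd i z y * pd j z y - q y / l y * pd i w y * pd j w y

/-- The component `dw(∇ᵢ∂ⱼ)` of the connection `∇` whose Pick tensor relative to `l dz dw` is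
`p dz³ + q dw³`. -/
def connW (z w l p : Plane → ℂ) (i j : Fin 2) (y : Plane) : ℂ :=
  pd i (pd j w) y + logDelW z w l y * pd i w y * pd j w y - p y / l y * pd i z y * pd j z y

theorem inducedVolume_eq_jac_mul (hJ : jac z w y ≠ 0) :
    inducedVolume σ σ y = jac z w y * det3 (delZ z w σ y) (delW z w σ y) (σ y) := by
  rw [inducedVolume_eq, pd_eq_delZ_add_delW (f := σ) 0 hJ, pd_eq_delZ_add_delW (f := σ) 1 hJ,
    det3_linear, jac]

theorem shapeOperator_self (hvol : inducedVolume σ σ y ≠ 0) (k i : Fin 2) :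
    shapeOperator σ σ k i y = if k = i then -1 else 0 := by
  have component_pd : component σ σ y (pd i σ y) =
      ![if 0 = i then 1 else 0, if 1 = i then 1 else 0, 0] := by
    rw [component_eq_iff hvol]
    fin_cases i <;> simp
  rw [shapeOperator, component_pd]
  fin_cases k <;> fin_cases i <;> simp

theorem pd_pd_eq_inducedConnection (hJ : jac z w y ≠ 0) (hvol : inducedVolume σ σ y ≠ 0)
    (i j : Fin 2) :
    pd i (pd j σ) y = (∑ m, pd m z y * inducedConnection σ σ m i j y) • delZ z w σ y +
      (∑ m, pd m w y * inducedConnection σ σ m i j y) • delW z w σ y +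
      fundamentalForm σ σ i j y • σ y := by
  have decomposition := (component_eq_iff hvol (v := pd i (pd j σ) y)).1 rfl
  change _ = inducedConnection σ σ 0 i j y • _ + inducedConnection σ σ 1 i j y • _ +
    fundamentalForm σ σ i j y • _ at decomposition
  rw [decomposition, pd_eq_delZ_add_delW (f := σ) 0 hJ, pd_eq_delZ_add_delW (f := σ) 1 hJ]
  simp only [Fin.sum_univ_two]
  module

theorem pd_pd_eq_iff (hJ : jac z w y ≠ 0) (hvol : inducedVolume σ σ y ≠ 0) (i j : Fin 2)
    {a b g : ℂ} :
    pd i (pd j σ) y = a • delZ z w σ y + b • delW z w σ y + g • σ y ↔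
      ∑ m, pd m z y * inducedConnection σ σ m i j y = a ∧
      ∑ m, pd m w y * inducedConnection σ σ m i j y = b ∧ fundamentalForm σ σ i j y = g := by
  have hdet : det3 (delZ z w σ y) (delW z w σ y) (σ y) ≠ 0 := by
    rw [inducedVolume_eq_jac_mul hJ] at hvol
    exact right_ne_zero_of_mul hvol
  rw [pd_pd_eq_inducedConnection hJ hvol]
  exact smul_add_smul_add_smul_eq_iff hdet

theorem StructureEqs.delZ_ne_zero (h : StructureEqs z w l p q σ y) (hl : l y ≠ 0) :
    delZ z w σ y ≠ 0 := by
  intro h0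
  have hdet := h.det
  rw [h0, det3_eq] at hdet
  simp only [Pi.zero_apply, zero_mul, sub_self, add_zero] at hdet
  exact div_ne_zero (mul_ne_zero Complex.I_ne_zero hl) two_ne_zero hdet.symm

theorem NullMetric.form_apply (H : NullMetric U z w l G) (hy : y ∈ U) (i j : Fin 2) :
    G y i j = l y * ((1 / 2) * (pd i z y * pd j w y + pd i w y * pd j z y)) :=
  H.form y hy i j

theorem NullCoords.pd_jac (H : NullCoords U z w) (hy : y ∈ U) (i : Fin 2) :
    pd i (jac z w) y = pd i (pd 0 z) y * pd 1 w y + pd 0 z y * pd i (pd 1 w) y -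
      (pd i (pd 1 z) y * pd 0 w y + pd 1 z y * pd i (pd 0 w) y) := by
  have dz := fun j => H.differentiableAt (H.smooth_pd j H.smooth_z) hy
  have dw := fun j => H.differentiableAt (H.smooth_pd j H.smooth_w) hy
  change pd i (fun y => pd 0 z y * pd 1 w y - pd 1 z y * pd 0 w y) y = _
  rw [pd_sub i ((dz 0).fun_mul (dw 1)) ((dz 1).fun_mul (dw 0)), pd_mul i (dz 0) (dw 1),
    pd_mul i (dz 1) (dw 0)]

namespace PickData

variable (H : PickData U z w l p q G C)
include H

theorem isVolumeCoeff_inducedVolume_iff (hy : y ∈ U) :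
    IsVolumeCoeff (G y) (inducedVolume σ σ y) ↔
      det3 (delZ z w σ y) (delW z w σ y) (σ y) = Complex.I * l y / 2 := by
  rw [(H.form y hy).isVolumeCoeff_iff (H.l_ne y hy) (H.side_z y hy) (H.side_w y hy),
    inducedVolume_eq_jac_mul (H.jac_ne y hy), jac, mul_comm]
  exact mul_left_inj' (H.jac_ne y hy)

theorem inducedVolume_eq_of_det (hy : y ∈ U)
    (h : det3 (delZ z w σ y) (delW z w σ y) (σ y) = Complex.I * l y / 2) :
    inducedVolume σ σ y = Complex.I / 2 * (jac z w y * l y) := by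
  rw [inducedVolume_eq_jac_mul (H.jac_ne y hy), h]
  ring

theorem pick_iff (hy : y ∈ U) (Γ : Fin 2 → ℂ) (i j : Fin 2) :
    (∀ k, C y ![i, j, k] = -2 * ∑ l, (Γ l - christoffel G l i j y) * G y l k) ↔
      ∑ m, pd m z y * Γ m = connZ z w l q i j y ∧ ∑ m, pd m w y * Γ m = connW z w l p i j y := by
  have hl := H.l_ne y hy
  have hcz := H.sum_pd_z_mul_christoffel hy i j
  have hcw := H.sum_pd_w_mul_christoffel hy i j
  have contraction (k : Fin 2) : C y ![i, j, k] + 2 * ∑ l, (Γ l - christoffel G l i j y) * G y l k =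
      l y * ((∑ m, pd m z y * Γ m - connZ z w l q i j y) * pd k w y +
        (∑ m, pd m w y * Γ m - connW z w l p i j y) * pd k z y) := by
    rw [H.cubic y hy]
    simp only [H.form_apply hy, connZ, connW, Fin.sum_univ_two, Fin.prod_univ_three,
      Matrix.cons_val] at hcz hcw ⊢
    field_simp
    linear_combination -(l y * pd k w y) * hcz - (l y * pd k z y) * hcw
  have pick_iff_contraction (k : Fin 2) :
      C y ![i, j, k] = -2 * ∑ l, (Γ l - christoffel G l i j y) * G y l k ↔
        (∑ m, pd m z y * Γ m - connZ z w l q i j y) * pd k w y +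
          (∑ m, pd m w y * Γ m - connW z w l p i j y) * pd k z y = 0 := by
    rw [neg_mul, eq_neg_iff_add_eq_zero, contraction, mul_eq_zero, or_iff_right hl]
  simp only [pick_iff_contraction]
  constructor
  · intro h
    have hJ := H.jac_ne y hy
    constructor <;> refine mul_left_cancel₀ hJ ?_ <;> rw [jac]
    · linear_combination pd 0 z y * h 1 - pd 1 z y * h 0
    · linear_combination pd 1 w y * h 0 - pd 0 w y * h 1
  · rintro ⟨hZ, hW⟩ k
    rw [hZ, hW]
    ring

theorem pd_pd_eq_iff_structureEqs (hσ : ContDiffOn ℝ ∞ σ U) (hy : y ∈ U) :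
    (∀ i j, pd i (pd j σ) y =
      connZ z w l q i j y • delZ z w σ y + connW z w l p i j y • delW z w σ y + G y i j • σ y) ↔
    (∀ i, pd i (delZ z w σ) y = pd i z y • (logDelZ z w l y • delZ z w σ y -
      (p y / l y) • delW z w σ y) + pd i w y • ((l y / 2) • σ y)) ∧
    (∀ i, pd i (delW z w σ) y = pd i z y • ((l y / 2) • σ y) +
      pd i w y • (logDelW z w l y • delW z w σ y - (q y / l y) • delZ z w σ y)) := by
  have hJ := H.jac_ne y hy
  simp only [H.pd_pd _ _ (H.smooth_delZ hσ) (H.smooth_delW hσ)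
    (fun y hy i => pd_eq_delZ_add_delW i (H.jac_ne y hy)) hy, connZ, connW, H.form_apply hy]
  constructor
  · intro h
    constructor <;> intro i <;> refine smul_right_injective _ hJ ?_ <;>
      simp only [jac, ← sub_eq_zero (b := _ • _)]
    · have cramer :=
        congr(pd 1 w y • $(sub_eq_zero.2 (h i 0)) - pd 0 w y • $(sub_eq_zero.2 (h i 1)))
      rw [smul_zero, smul_zero, sub_zero] at cramer
      rw [← cramer]
      module
    · have cramer :=
        congr(pd 0 z y • $(sub_eq_zero.2 (h i 1)) - pd 1 z y • $(sub_eq_zero.2 (h i 0)))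
      rw [smul_zero, smul_zero, sub_zero] at cramer
      rw [← cramer]
      module
  · rintro ⟨hZ, hW⟩ i j
    rw [hZ, hW]
    module

theorem metric_and_pick_iff (hσ : ContDiffOn ℝ ∞ σ U) (hy : y ∈ U)
    (hvol : inducedVolume σ σ y ≠ 0) :
    ((∀ i j, fundamentalForm σ σ i j y = G y i j) ∧ ∀ i j k, C y ![i, j, k] =
      -2 * ∑ l, (inducedConnection σ σ l i j y - christoffel G l i j y) * G y l k) ↔
    (∀ i, pd i (delZ z w σ) y = pd i z y • (logDelZ z w l y • delZ z w σ y -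
      (p y / l y) • delW z w σ y) + pd i w y • ((l y / 2) • σ y)) ∧
    (∀ i, pd i (delW z w σ) y = pd i z y • ((l y / 2) • σ y) +
      pd i w y • (logDelW z w l y • delW z w σ y - (q y / l y) • delZ z w σ y)) := by
  rw [← H.pd_pd_eq_iff_structureEqs hσ hy]
  simp only [pd_pd_eq_iff (H.jac_ne y hy) hvol, H.pick_iff hy, ← forall_and, ← and_assoc]
  exact forall₂_congr fun i j => by tauto

theorem pd_jac_mul_eq_trace (hy : y ∈ U) {Γ : Fin 2 → Fin 2 → ℂ} (i : Fin 2)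
    (hZ : ∀ j, ∑ m, pd m z y * Γ m j = connZ z w l q i j y)
    (hW : ∀ j, ∑ m, pd m w y * Γ m j = connW z w l p i j y) :
    pd i (fun y => jac z w y * l y) y = (∑ k, Γ k k) * (jac z w y * l y) := by
  rw [pd_mul i (H.differentiableAt H.smooth_jac hy) (H.differentiableAt H.smooth_l hy),
    H.pd_jac hy, H.pd_l hy]
  simp only [connZ, connW, Fin.sum_univ_two, jac] at hZ hW ⊢
  have hl := H.l_ne y hy
  field_simp at hZ hW
  linear_combination -pd 1 w y * hZ 0 + pd 0 w y * hZ 1 + pd 1 z y * hW 0 - pd 0 z y * hW 1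

theorem structureEqs_of_sphereAt (hσ : ContDiffOn ℝ ∞ σ U) (hy : y ∈ U) (h : SphereAt G C σ y) :
    StructureEqs z w l p q σ y := by
  obtain ⟨pd_delZ, pd_delW⟩ :=
    (H.metric_and_pick_iff hσ hy h.inducedVolume_ne_zero).1 ⟨h.metric, h.pick⟩
  exact ⟨pd_delZ, pd_delW, (H.isVolumeCoeff_inducedVolume_iff hy).1 h.volume⟩

theorem sphereAt_of_structureEqs (hσ : ContDiffOn ℝ ∞ σ U)
    (h : ∀ y ∈ U, StructureEqs z w l p q σ y) (hy : y ∈ U) : SphereAt G C σ y := by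
  have volume_eq : ∀ y ∈ U, inducedVolume σ σ y = Complex.I / 2 * (jac z w y * l y) :=
    fun y hy => H.inducedVolume_eq_of_det hy (h y hy).det
  have hvol : inducedVolume σ σ y ≠ 0 := by
    rw [volume_eq y hy]
    exact mul_ne_zero (div_ne_zero Complex.I_ne_zero two_ne_zero)
      (mul_ne_zero (H.jac_ne y hy) (H.l_ne y hy))
  obtain ⟨metric, pick⟩ :=
    (H.metric_and_pick_iff hσ hy hvol).2 ⟨(h y hy).pd_delZ, (h y hy).pd_delW⟩
  have contraction := fun i j => (H.pick_iff hy _ i j).1 (pick i j)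
  refine ⟨?_, metric, fun i => ?_, (H.isVolumeCoeff_inducedVolume_iff hy).2 (h y hy).det,
    shapeOperator_self hvol, pick⟩
  · rwa [linearIndependent_iff_det3_ne_zero, ← inducedVolume_eq]
  · rw [pd_congr_on i H.isOpen volume_eq hy, pd_const_mul i _ ((H.differentiableAt H.smooth_jac
      hy).fun_mul (H.differentiableAt H.smooth_l hy)), volume_eq y hy,
      H.pd_jac_mul_eq_trace hy i (fun j => (contraction i j).1) fun j => (contraction i j).2]
    ring

end PickData

end Sphere

section Integrability

variable {U : Set Plane} {z w l p q : Plane → ℂ} {G : Plane → Matrix (Fin 2) (Fin 2) ℂ}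
  {C : Plane → (Fin 3 → Fin 2) → ℂ} {σ : Plane → C3} {y y₀ : Plane}

namespace NullMetric

variable (H : NullMetric U z w l G)
include H

theorem pd_l_div_two (hy : y ∈ U) (i : Fin 2) : pd i (fun y => l y / 2) y =
    l y / 2 * (logDelZ z w l y * pd i z y + logDelW z w l y * pd i w y) := by
  have dl := H.differentiableAt H.smooth_l hy
  simp only [div_eq_inv_mul _ (2 : ℂ)]
  rw [pd_const_mul i _ dl, H.pd_l hy]
  ring

theorem differentiableAt_l_div_two (hy : y ∈ U) : DifferentiableAt ℝ (fun y => l y / 2) y :=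
  H.differentiableAt (H.smooth_l.div_const (2 : ℂ)) hy

theorem pd_div (hy : y ∈ U) (i : Fin 2) {f : Plane → ℂ} (hf : DifferentiableAt ℝ f y) :
    pd i (fun y => f y / l y) y = (pd i f y - f y * (logDelZ z w l y * pd i z y +
      logDelW z w l y * pd i w y)) / l y := by
  have hl := H.l_ne y hy
  have dl := H.differentiableAt H.smooth_l hy
  simp only [div_eq_mul_inv (f _)]
  rw [pd_mul i hf (dl.fun_inv hl), pd_inv i dl hl, H.pd_l hy]
  field_simp
  ring

end NullMetric

namespace PickData

variable (H : PickData U z w l p q G C)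
include H

theorem smooth_p_div : ContDiffOn ℝ ∞ (fun y => p y / l y) U :=
  contDiffOn_div H.smooth_p H.smooth_l H.l_ne

theorem smooth_q_div : ContDiffOn ℝ ∞ (fun y => q y / l y) U :=
  contDiffOn_div H.smooth_q H.smooth_l H.l_ne

theorem pd_p_div (hy : y ∈ U) (i : Fin 2) : pd i (fun y => p y / l y) y =
    pd i z y * delZ z w (fun y => p y / l y) y -
      pd i w y * (p y / l y * logDelW z w l y) := by
  have hJ := H.jac_ne y hy
  have pd_p (i : Fin 2) : pd i p y = pd i z y * delZ z w p y := by
    simpa [H.delW_p y hy] using pd_eq_delZ_add_delW (f := p) i hJ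
  have quotient : ∀ i, pd i (fun y => p y / l y) y = pd i z y •
      ((delZ z w p y - p y * logDelZ z w l y) / l y) +
      pd i w y • (-(p y / l y * logDelW z w l y)) := fun i => by
    rw [H.pd_div hy i (H.differentiableAt H.smooth_p hy), pd_p]
    simp only [smul_eq_mul]
    ring
  rw [delZ_eq hJ quotient, quotient]
  simp only [smul_eq_mul]
  ring

theorem pd_q_div (hy : y ∈ U) (i : Fin 2) : pd i (fun y => q y / l y) y =
    pd i w y * delW z w (fun y => q y / l y) y -
      pd i z y * (q y / l y * logDelZ z w l y) := by
  have hJ := H.jac_ne y hy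
  have pd_q (i : Fin 2) : pd i q y = pd i w y * delW z w q y := by
    simpa [H.delZ_q y hy] using pd_eq_delZ_add_delW (f := q) i hJ
  have quotient : ∀ i, pd i (fun y => q y / l y) y = pd i z y • (-(q y / l y * logDelZ z w l y)) +
      pd i w y • ((delW z w q y - q y * logDelW z w l y) / l y) := fun i => by
    rw [H.pd_div hy i (H.differentiableAt H.smooth_q hy), pd_q]
    simp only [smul_eq_mul]
    ring
  rw [delW_eq hJ quotient, quotient]
  simp only [smul_eq_mul]
  ring

theorem delW_delZ_delZ_of_structureEqs (hσ : ContDiffOn ℝ ∞ σ U)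
    (h : ∀ y ∈ U, StructureEqs z w l p q σ y) (hy : y ∈ U) :
    delW z w (delZ z w (delZ z w σ)) y =
      (delW z w (logDelZ z w l) y + p y / l y * (q y / l y)) • delZ z w σ y +
      (logDelZ z w l y * (l y / 2)) • σ y := by
  have hJ := H.jac_ne y hy
  have dσZ := H.differentiableAt (H.smooth_delZ hσ) hy
  have dσW := H.differentiableAt (H.smooth_delW hσ) hy
  have dlog := H.differentiableAt H.smooth_logDelZ hy
  have dp := H.differentiableAt H.smooth_p_div hy
  have delZ_delZ : ∀ y ∈ U, delZ z w (delZ z w σ) y =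
      logDelZ z w l y • delZ z w σ y - (p y / l y) • delW z w σ y := fun y hy =>
    delZ_eq (H.jac_ne y hy) (h y hy).pd_delZ
  refine delW_eq hJ (a := delZ z w (logDelZ z w l) y • delZ z w σ y +
    logDelZ z w l y • (logDelZ z w l y • delZ z w σ y - (p y / l y) • delW z w σ y) -
    (delZ z w (fun y => p y / l y) y • delW z w σ y + (p y / l y) • ((l y / 2) • σ y)))
    fun i => ?_
  rw [pd_congr_on i H.isOpen delZ_delZ hy, pd_sub i (dlog.fun_smul dσZ) (dp.fun_smul dσW),
    pd_smul i dlog dσZ, pd_smul i dp dσW, (h y hy).pd_delZ, (h y hy).pd_delW,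
    pd_eq_delZ_add_delW (f := logDelZ z w l) i hJ, H.pd_p_div hy]
  simp only [smul_eq_mul]
  module

theorem delZ_delW_delZ_of_structureEqs (hσ : ContDiffOn ℝ ∞ σ U)
    (h : ∀ y ∈ U, StructureEqs z w l p q σ y) (hy : y ∈ U) :
    delZ z w (delW z w (delZ z w σ)) y =
      (logDelZ z w l y * (l y / 2)) • σ y + (l y / 2) • delZ z w σ y := by
  have hJ := H.jac_ne y hy
  have delW_delZ : ∀ y ∈ U, delW z w (delZ z w σ) y = (l y / 2) • σ y := fun y hy =>
    delW_eq (H.jac_ne y hy) (h y hy).pd_delZ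
  refine delZ_eq hJ (b := (logDelW z w l y * (l y / 2)) • σ y + (l y / 2) • delW z w σ y)
    fun i => ?_
  rw [pd_congr_on i H.isOpen delW_delZ hy,
    pd_smul i (H.differentiableAt_l_div_two hy) (H.differentiableAt hσ hy), H.pd_l_div_two hy,
    pd_eq_delZ_add_delW (f := σ) i hJ]
  module

-- The Gauss equation says that the `∂/∂z` and `∂/∂w` derivatives of `∂σ/∂z` commute.
theorem integrability_of_structureEqs (hσ : ContDiffOn ℝ ∞ σ U)
    (h : ∀ y ∈ U, StructureEqs z w l p q σ y) (hy : y ∈ U) :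
    delW z w (logDelZ z w l) y + p y / l y * (q y / l y) = l y / 2 := by
  have mixed := H.delW_delZ (H.smooth_delZ hσ) hy
  rw [H.delW_delZ_delZ_of_structureEqs hσ h hy, H.delZ_delW_delZ_of_structureEqs hσ h hy,
    add_comm, add_right_inj] at mixed
  exact smul_left_injective ℂ ((h y hy).delZ_ne_zero (H.l_ne y hy)) mixed

theorem sum_pairing_eq (hy : y ∈ U) {C₁ C₂ : (Fin 3 → Fin 2) → ℂ}
    (h₁ : ∀ i, C₁ i = p y * ∏ a, pd (i a) z y) (h₂ : ∀ i, C₂ i = q y * ∏ a, pd (i a) w y) :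
    ∑ i : Fin 3 → Fin 2, ∑ j : Fin 3 → Fin 2, (∏ a, (G y)⁻¹ (i a) (j a)) * C₁ i * C₂ j =
      8 * p y * q y / l y ^ 3 := by
  simp only [h₁, h₂]
  exact (H.form y hy).sum_pairing (H.l_ne y hy) (H.jac_ne y hy) (p y) (q y)

theorem curvature_eq_iff (hy : y ∈ U) :
    curvature G y = -1 + (1 / 4) * (8 * p y * q y / l y ^ 3) ↔
      delW z w (logDelZ z w l) y + p y / l y * (q y / l y) = l y / 2 := by
  have hl := H.l_ne y hy
  rw [H.curvature_eq hy]
  constructor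
  · intro h
    field_simp at h ⊢
    linear_combination (-1 / 4) * h
  · intro h
    field_simp at h ⊢
    linear_combination (-4) * h

end PickData

/-- The coefficients of the structure equations as a linear system for `(∂σ/∂z, ∂σ/∂w, σ)`. -/
def structureCoeff (z w l p q : Plane → ℂ) (i : Fin 2) (b c : Fin 3) (y : Plane) : ℂ :=
  ![![pd i z y * logDelZ z w l y, -(pd i z y * (p y / l y)), pd i w y * (l y / 2)],
    ![-(pd i w y * (q y / l y)), pd i w y * logDelW z w l y, pd i z y * (l y / 2)],
    ![pd i z y, pd i w y, 0]] b c

/-- The frame `(∂σ/∂z, ∂σ/∂w, σ)` along a map `σ`. -/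
def nullFrame (z w : Plane → ℂ) (σ : Plane → C3) (y : Plane) : Fin 3 → C3 :=
  ![delZ z w σ y, delW z w σ y, σ y]

theorem IsParallelFrame.pd_apply {A : Fin 2 → Fin 3 → Fin 3 → Plane → ℂ} {F : Plane → Fin 3 → C3}
    (hF : IsParallelFrame A U F) (hy : y ∈ U) (i : Fin 2) (b : Fin 3) :
    pd i (fun y => F y b) y = ∑ c, A i b c y • F y c := by
  rw [← (hF y hy).2]
  exact CAS.pd_apply i (ContinuousLinearMap.proj (R := ℝ) (φ := fun _ : Fin 3 => C3) b)
    (hF y hy).1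

namespace PickData

variable (H : PickData U z w l p q G C)
include H

theorem isParallelFrame_nullFrame (hσ : ContDiffOn ℝ ∞ σ U)
    (h : ∀ y ∈ U, StructureEqs z w l p q σ y) :
    IsParallelFrame (structureCoeff z w l p q) U (nullFrame z w σ) := by
  intro y hy
  have diff : DifferentiableAt ℝ (nullFrame z w σ) y := by
    refine differentiableAt_pi.2 fun b => ?_
    fin_cases b
    exacts [H.differentiableAt (H.smooth_delZ hσ) hy, H.differentiableAt (H.smooth_delW hσ) hy,
      H.differentiableAt hσ hy]
  refine ⟨diff, fun i b => (pd_apply i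
    (ContinuousLinearMap.proj (R := ℝ) (φ := fun _ : Fin 3 => C3) b) diff).symm.trans ?_⟩
  simp only [Fin.sum_univ_three]
  fin_cases b
  · refine ((h y hy).pd_delZ i).trans ?_
    simp only [structureCoeff, nullFrame, Fin.zero_eta, Matrix.cons_val]
    module
  · refine ((h y hy).pd_delW i).trans ?_
    simp only [structureCoeff, nullFrame, Fin.mk_one, Matrix.cons_val]
    module
  · refine (pd_eq_delZ_add_delW (f := σ) i (H.jac_ne y hy)).trans ?_
    simp only [structureCoeff, nullFrame, Fin.reduceFinMk, Matrix.cons_val]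
    module

theorem smooth_structureCoeff (i : Fin 2) (b c : Fin 3) :
    ContDiffOn ℝ ∞ (structureCoeff z w l p q i b c) U := by
  have hz := H.smooth_pd i H.smooth_z
  have hw := H.smooth_pd i H.smooth_w
  have hl : ContDiffOn ℝ ∞ (fun y => l y / 2) U := H.smooth_l.div_const (2 : ℂ)
  fin_cases b <;> fin_cases c
  exacts [hz.mul H.smooth_logDelZ, (hz.mul H.smooth_p_div).neg, hw.mul hl,
    (hw.mul H.smooth_q_div).neg, hw.mul H.smooth_logDelW, hz.mul hl, hz, hw, contDiffOn_const]

theorem pd_structureCoeff (hy : y ∈ U) (i j : Fin 2) (b c : Fin 3) :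
    pd i (structureCoeff z w l p q j b c) y =
      ![![pd i (pd j z) y * logDelZ z w l y + pd j z y * pd i (logDelZ z w l) y,
          -(pd i (pd j z) y * (p y / l y) + pd j z y * pd i (fun y => p y / l y) y),
          pd i (pd j w) y * (l y / 2) + pd j w y * pd i (fun y => l y / 2) y],
        ![-(pd i (pd j w) y * (q y / l y) + pd j w y * pd i (fun y => q y / l y) y),
          pd i (pd j w) y * logDelW z w l y + pd j w y * pd i (logDelW z w l) y,
          pd i (pd j z) y * (l y / 2) + pd j z y * pd i (fun y => l y / 2) y],
        ![pd i (pd j z) y, pd i (pd j w) y, 0]] b c := by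
  have dz := H.differentiableAt (H.smooth_pd j H.smooth_z) hy
  have dw := H.differentiableAt (H.smooth_pd j H.smooth_w) hy
  have dl := H.differentiableAt_l_div_two hy
  have pd_neg (f : Plane → ℂ) : pd i (fun y => -f y) y = -pd i f y := by simp [pd]
  fin_cases b <;> fin_cases c
  · exact pd_mul i dz (H.differentiableAt H.smooth_logDelZ hy)
  · exact (pd_neg _).trans (congrArg _ (pd_mul i dz (H.differentiableAt H.smooth_p_div hy)))
  · exact pd_mul i dw dl
  · exact (pd_neg _).trans (congrArg _ (pd_mul i dw (H.differentiableAt H.smooth_q_div hy)))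
  · exact pd_mul i dw (H.differentiableAt H.smooth_logDelW hy)
  · exact pd_mul i dz dl
  · rfl
  · rfl
  · exact pd_const i 0

theorem isFlatCoeff_structureCoeff
    (hG : ∀ y ∈ U, delW z w (logDelZ z w l) y + p y / l y * (q y / l y) = l y / 2) :
    IsFlatCoeff (structureCoeff z w l p q) U := by
  intro y hy b c
  have hJ := H.jac_ne y hy
  have hn := H.isOpen.mem_nhds hy
  have hz : pd 0 (pd 1 z) y = pd 1 (pd 0 z) y := pd_comm 0 1 (H.smooth_z.contDiffAt hn)
  have hw : pd 0 (pd 1 w) y = pd 1 (pd 0 w) y := pd_comm 0 1 (H.smooth_w.contDiffAt hn)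
  have hlogZ := fun i => pd_eq_delZ_add_delW (f := logDelZ z w l) i hJ
  have hlogW := fun i => pd_eq_delZ_add_delW (f := logDelW z w l) i hJ
  rw [H.pd_structureCoeff hy, H.pd_structureCoeff hy, hlogZ, hlogZ, hlogW, hlogW, H.pd_p_div hy,
    H.pd_p_div hy, H.pd_q_div hy, H.pd_q_div hy, H.pd_l_div_two hy, H.pd_l_div_two hy, hz, hw,
    ← H.delW_logDelZ hy, eq_sub_of_add_eq (hG y hy)]
  simp only [structureCoeff, Fin.sum_univ_three, smul_eq_mul]
  generalize p y / l y = P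
  generalize q y / l y = Q
  generalize logDelZ z w l y = a
  generalize logDelW z w l y = b'
  fin_cases b <;> fin_cases c <;> simp <;> ring

theorem pd_det3_div_of_isParallelFrame {F : Plane → Fin 3 → C3} (hy : y ∈ U)
    (hF : IsParallelFrame (structureCoeff z w l p q) U F) (i : Fin 2) :
    DifferentiableAt ℝ (fun y => det3 (F y 0) (F y 1) (F y 2) / l y) y ∧
      pd i (fun y => det3 (F y 0) (F y 1) (F y 2) / l y) y = 0 := by
  have dF := differentiableAt_pi.1 (hF y hy).1
  have dFn := fun b => differentiableAt_pi.1 (dF b)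
  have ddet : DifferentiableAt ℝ (fun y => det3 (F y 0) (F y 1) (F y 2)) y := by
    simp only [det3_eq]
    fun_prop
  constructor
  · simp only [div_eq_mul_inv]
    exact ddet.fun_mul ((H.differentiableAt H.smooth_l hy).fun_inv (H.l_ne y hy))
  · rw [H.pd_div hy i ddet, pd_det3 i (dF 0) (dF 1) (dF 2), hF.pd_apply hy, hF.pd_apply hy,
      hF.pd_apply hy, div_eq_zero_iff]
    left
    simp only [structureCoeff, Fin.sum_univ_three, Matrix.cons_val, det3_eq, Pi.add_apply,
      Pi.smul_apply, smul_eq_mul]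
    ring

theorem det3_eq_of_isParallelFrame (hU : IsPreconnected U) {F : Plane → Fin 3 → C3}
    (hF : IsParallelFrame (structureCoeff z w l p q) U F) (hy₀ : y₀ ∈ U)
    (h₀ : det3 (F y₀ 0) (F y₀ 1) (F y₀ 2) = Complex.I * l y₀ / 2) (hy : y ∈ U) :
    det3 (F y 0) (F y 1) (F y 2) = Complex.I * l y / 2 := by
  have const := H.isOpen.is_const_of_fderiv_eq_zero (𝕜 := ℝ) hU
    (fun y hy => (H.pd_det3_div_of_isParallelFrame hy hF 0).1.differentiableWithinAt)
    (fun y hy => by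
      ext v
      rw [fderiv_eq_sum_pd]
      simp [(H.pd_det3_div_of_isParallelFrame hy hF _).2]) hy hy₀
  have hl := H.l_ne y hy
  have hl₀ := H.l_ne y₀ hy₀
  simp only [h₀] at const
  field_simp at const ⊢
  exact const

theorem structureEqs_of_isParallelFrame {F : Plane → Fin 3 → C3}
    (hF : IsParallelFrame (structureCoeff z w l p q) U F) (hy : y ∈ U)
    (hdet : det3 (F y 0) (F y 1) (F y 2) = Complex.I * l y / 2) :
    StructureEqs z w l p q (fun y => F y 2) y := by
  have pd_two : ∀ y ∈ U, ∀ i, pd i (fun y => F y 2) y = pd i z y • F y 0 + pd i w y • F y 1 :=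
    fun y hy i => by
      rw [hF.pd_apply hy]
      simp [structureCoeff, Fin.sum_univ_three]
  have hZ : EqOn (delZ z w fun y => F y 2) (fun y => F y 0) U := fun y hy =>
    delZ_eq (H.jac_ne y hy) (pd_two y hy)
  have hW : EqOn (delW z w fun y => F y 2) (fun y => F y 1) U := fun y hy =>
    delW_eq (H.jac_ne y hy) (pd_two y hy)
  refine ⟨fun i => ?_, fun i => ?_, by rw [hZ hy, hW hy, hdet]⟩
  · rw [pd_congr_on i H.isOpen hZ hy, hF.pd_apply hy, hZ hy, hW hy]
    simp only [structureCoeff, Fin.sum_univ_three, Matrix.cons_val]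
    module
  · rw [pd_congr_on i H.isOpen hW hy, hF.pd_apply hy, hZ hy, hW hy]
    simp only [structureCoeff, Fin.sum_univ_three, Matrix.cons_val]
    module

theorem mono {V : Set Plane} (hV : IsOpen V) (hVU : V ⊆ U) : PickData V z w l p q G C where
  isOpen := hV
  smooth_z := H.smooth_z.mono hVU
  smooth_w := H.smooth_w.mono hVU
  jac_ne y hy := H.jac_ne y (hVU hy)
  smooth_l := H.smooth_l.mono hVU
  l_ne y hy := H.l_ne y (hVU hy)
  form y hy := H.form y (hVU hy)
  side_z y hy := H.side_z y (hVU hy)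
  side_w y hy := H.side_w y (hVU hy)
  smooth_p := H.smooth_p.mono hVU
  smooth_q := H.smooth_q.mono hVU
  delW_p y hy := H.delW_p y (hVU hy)
  delZ_q y hy := H.delZ_q y (hVU hy)
  cubic y hy := H.cubic y (hVU hy)

theorem exists_structureEqs (hG : ∀ y ∈ U,
    delW z w (logDelZ z w l) y + p y / l y * (q y / l y) = l y / 2) (hy₀ : y₀ ∈ U) :
    ∃ V ⊆ U, IsOpen V ∧ y₀ ∈ V ∧ ∃ σ : Plane → C3, ContDiffOn ℝ ∞ σ V ∧
      ∀ y ∈ V, StructureEqs z w l p q σ y := by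
  obtain ⟨r, hr, hrU, F, hF₀, hF⟩ := exists_isParallelFrame H.isOpen H.smooth_structureCoeff
    (H.isFlatCoeff_structureCoeff hG) hy₀ ![![1, 0, 0], ![0, 1, 0], ![0, 0, Complex.I * l y₀ / 2]]
  have hy₀r : y₀ ∈ Metric.ball y₀ r := Metric.mem_ball_self hr
  have HB := H.mono Metric.isOpen_ball hrU
  have det₀ : det3 (F y₀ 0) (F y₀ 1) (F y₀ 2) = Complex.I * l y₀ / 2 := by
    rw [hF₀, det3_eq]
    simp
  exact ⟨Metric.ball y₀ r, hrU, HB.isOpen, hy₀r, fun y => F y 2,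
    contDiffOn_pi.1 (hF.contDiffOn HB.isOpen HB.smooth_structureCoeff) 2, fun y hy =>
      HB.structureEqs_of_isParallelFrame hF hy
        (HB.det3_eq_of_isParallelFrame (convex_ball y₀ r).isPreconnected hF hy₀r det₀ hy)⟩

end PickData

end Integrability

section Invariance

variable {U V : Set Plane} {z w l p q z' w' l' p' q' : Plane → ℂ}
  {G G' : Plane → Matrix (Fin 2) (Fin 2) ℂ} {C C' : Plane → (Fin 3 → Fin 2) → ℂ}
  {σ σ' : Plane → C3} {y y₀ : Plane}

section Congr

variable {E : Type*} [NormedAddCommGroup E] [NormedSpace ℝ E] {f g : Plane → E}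

theorem pd_eventuallyEq (i : Fin 2) (h : f =ᶠ[𝓝 y] g) : pd i f =ᶠ[𝓝 y] pd i g :=
  h.eventuallyEq_nhds.mono fun _ hx => pd_congr i hx

variable [NormedSpace ℂ E]

theorem delZ_congr (hz : z =ᶠ[𝓝 y] z') (hw : w =ᶠ[𝓝 y] w') (h : f =ᶠ[𝓝 y] g) :
    delZ z w f y = delZ z' w' g y := by
  simp only [delZ, jac, pd_congr _ hz, pd_congr _ hw, pd_congr _ h]

theorem delW_congr (hz : z =ᶠ[𝓝 y] z') (hw : w =ᶠ[𝓝 y] w') (h : f =ᶠ[𝓝 y] g) :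
    delW z w f y = delW z' w' g y := by
  simp only [delW, jac, pd_congr _ hz, pd_congr _ hw, pd_congr _ h]

theorem delZ_eventuallyEq (hz : z =ᶠ[𝓝 y] z') (hw : w =ᶠ[𝓝 y] w') (h : f =ᶠ[𝓝 y] g) :
    delZ z w f =ᶠ[𝓝 y] delZ z' w' g := by
  filter_upwards [hz.eventuallyEq_nhds, hw.eventuallyEq_nhds, h.eventuallyEq_nhds] with x hz hw h
  exact delZ_congr hz hw h

theorem delW_eventuallyEq (hz : z =ᶠ[𝓝 y] z') (hw : w =ᶠ[𝓝 y] w') (h : f =ᶠ[𝓝 y] g) :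
    delW z w f =ᶠ[𝓝 y] delW z' w' g := by
  filter_upwards [hz.eventuallyEq_nhds, hw.eventuallyEq_nhds, h.eventuallyEq_nhds] with x hz hw h
  exact delW_congr hz hw h

theorem pd_comp_eq {τ : Plane → Plane} (i : Fin 2) (hJ : jac z w (τ y) ≠ 0)
    (hz : DifferentiableAt ℝ z (τ y)) (hw : DifferentiableAt ℝ w (τ y))
    (hf : DifferentiableAt ℝ f (τ y)) (hτ : DifferentiableAt ℝ τ y) [IsScalarTower ℝ ℂ E] :
    pd i (f ∘ τ) y = pd i (z ∘ τ) y • delZ z w f (τ y) + pd i (w ∘ τ) y • delW z w f (τ y) := by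
  have chain_f := pd_comp i hf hτ
  have chain_z := pd_comp i hz hτ
  have chain_w := pd_comp i hw hτ
  simp only [Fin.sum_univ_two] at chain_f chain_z chain_w
  change pd i (fun x => f (τ x)) y = pd i (fun x => z (τ x)) y • _ + pd i (fun x => w (τ x)) y • _
  rw [chain_f, chain_z, chain_w, pd_eq_delZ_add_delW (f := f) 0 hJ,
    pd_eq_delZ_add_delW (f := f) 1 hJ]
  simp only [smul_add, add_smul, smul_assoc]
  abel

theorem NullCoords.pd_comp (H : NullCoords U z w) (hf : ContDiffOn ℝ ∞ f U) {τ : Plane → Plane}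
    (hτ : DifferentiableAt ℝ τ y) (hy : τ y ∈ U) [IsScalarTower ℝ ℂ E] (i : Fin 2) :
    pd i (f ∘ τ) y = pd i (z ∘ τ) y • delZ z w f (τ y) + pd i (w ∘ τ) y • delW z w f (τ y) :=
  pd_comp_eq i (H.jac_ne _ hy) (H.differentiableAt H.smooth_z hy) (H.differentiableAt H.smooth_w hy)
    (H.differentiableAt hf hy) hτ

theorem NullCoords.delZ_comp (H : NullCoords U z w) (hf : ContDiffOn ℝ ∞ f U) {τ : Plane → Plane}
    (hτ : DifferentiableAt ℝ τ y) (hy : τ y ∈ U) (hJ : jac (z ∘ τ) (w ∘ τ) y ≠ 0)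
    [IsScalarTower ℝ ℂ E] : delZ (z ∘ τ) (w ∘ τ) (f ∘ τ) y = delZ z w f (τ y) :=
  delZ_eq hJ (H.pd_comp hf hτ hy)

theorem NullCoords.delW_comp (H : NullCoords U z w) (hf : ContDiffOn ℝ ∞ f U) {τ : Plane → Plane}
    (hτ : DifferentiableAt ℝ τ y) (hy : τ y ∈ U) (hJ : jac (z ∘ τ) (w ∘ τ) y ≠ 0)
    [IsScalarTower ℝ ℂ E] : delW (z ∘ τ) (w ∘ τ) (f ∘ τ) y = delW z w f (τ y) :=
  delW_eq hJ (H.pd_comp hf hτ hy)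

end Congr

theorem StructureEqs.congr (h : StructureEqs z w l p q σ y) (hz : z =ᶠ[𝓝 y] z')
    (hw : w =ᶠ[𝓝 y] w') (hl : l =ᶠ[𝓝 y] l') (hp : p y = p' y) (hq : q y = q' y)
    (hσ : σ =ᶠ[𝓝 y] σ') : StructureEqs z' w' l' p' q' σ' y where
  pd_delZ i := by
    rw [← pd_congr i (delZ_eventuallyEq hz hw hσ), h.pd_delZ, pd_congr i hz, pd_congr i hw,
      logDelZ, logDelZ, delZ_congr hz hw hl, delZ_congr hz hw hσ, delW_congr hz hw hσ,
      hl.eq_of_nhds, hp, hσ.eq_of_nhds]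
  pd_delW i := by
    rw [← pd_congr i (delW_eventuallyEq hz hw hσ), h.pd_delW, pd_congr i hz, pd_congr i hw,
      logDelW, logDelW, delW_congr hz hw hl, delZ_congr hz hw hσ, delW_congr hz hw hσ,
      hl.eq_of_nhds, hq, hσ.eq_of_nhds]
  det := by
    rw [← delZ_congr hz hw hσ, ← delW_congr hz hw hσ, ← hσ.eq_of_nhds, ← hl.eq_of_nhds, h.det]

theorem StructureEqs.comp (H : NullMetric U z w l G) (hσ : ContDiffOn ℝ ∞ σ U)
    (h : ∀ y ∈ U, StructureEqs z w l p q σ y) {τ : Plane → Plane} (hV : IsOpen V)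
    (hτ : ContDiffOn ℝ ∞ τ V) (hm : MapsTo τ V U) (hJ : ∀ y ∈ V, jac (z ∘ τ) (w ∘ τ) y ≠ 0)
    (hy : y ∈ V) : StructureEqs (z ∘ τ) (w ∘ τ) (l ∘ τ) (p ∘ τ) (q ∘ τ) (σ ∘ τ) y := by
  have dτ := fun y hy => differentiableAt_of_contDiffOn hV hτ (y := y) hy
  have delZ_σ : EqOn (delZ (z ∘ τ) (w ∘ τ) (σ ∘ τ)) (delZ z w σ ∘ τ) V := fun y hy =>
    H.delZ_comp hσ (dτ y hy) (hm hy) (hJ y hy)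
  have delW_σ : EqOn (delW (z ∘ τ) (w ∘ τ) (σ ∘ τ)) (delW z w σ ∘ τ) V := fun y hy =>
    H.delW_comp hσ (dτ y hy) (hm hy) (hJ y hy)
  have hs := h _ (hm hy)
  have hJτ := H.jac_ne _ (hm hy)
  refine ⟨fun i => ?_, fun i => ?_, ?_⟩
  · rw [pd_congr_on i hV delZ_σ hy, H.pd_comp (H.smooth_delZ hσ) (dτ y hy) (hm hy),
      delZ_eq hJτ hs.pd_delZ, delW_eq hJτ hs.pd_delZ, delZ_σ hy, delW_σ hy,
      logDelZ, logDelZ, H.delZ_comp H.smooth_l (dτ y hy) (hm hy) (hJ y hy)]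
    rfl
  · rw [pd_congr_on i hV delW_σ hy, H.pd_comp (H.smooth_delW hσ) (dτ y hy) (hm hy),
      delZ_eq hJτ hs.pd_delW, delW_eq hJτ hs.pd_delW, delZ_σ hy, delW_σ hy,
      logDelW, logDelW, H.delW_comp H.smooth_l (dτ y hy) (hm hy) (hJ y hy)]
    rfl
  · rw [delZ_σ hy, delW_σ hy]
    exact hs.det

end Invariance

section LinearAction

variable {U : Set Plane} {z w l p q : Plane → ℂ} {G : Plane → Matrix (Fin 2) (Fin 2) ℂ}
  {C : Plane → (Fin 3 → Fin 2) → ℂ} {σ σ' : Plane → C3} {y y₀ : Plane}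

/-- The action of a complex matrix on `ℂ³`, as a real linear map. -/
def mulVecReal (A : Matrix (Fin 3) (Fin 3) ℂ) : C3 →L[ℝ] C3 :=
  (LinearMap.toContinuousLinearMap A.mulVecLin).restrictScalars ℝ

theorem mulVecReal_apply (A : Matrix (Fin 3) (Fin 3) ℂ) (v : C3) : mulVecReal A v = A.mulVec v :=
  rfl

theorem pd_mulVec (A : Matrix (Fin 3) (Fin 3) ℂ) (i : Fin 2) {f : Plane → C3}
    (hf : DifferentiableAt ℝ f y) : pd i (fun y => A.mulVec (f y)) y = A.mulVec (pd i f y) :=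
  pd_apply i (mulVecReal A) hf

theorem contDiffAt_mulVec (A : Matrix (Fin 3) (Fin 3) ℂ) {f : Plane → C3}
    (hf : ContDiffAt ℝ ∞ f y) : ContDiffAt ℝ ∞ (fun y => A.mulVec (f y)) y :=
  (mulVecReal A).contDiff.contDiffAt.comp y hf

theorem delZ_mulVec (A : Matrix (Fin 3) (Fin 3) ℂ) {f : Plane → C3}
    (hf : DifferentiableAt ℝ f y) :
    delZ z w (fun y => A.mulVec (f y)) y = A.mulVec (delZ z w f y) := by
  simp only [delZ, pd_mulVec A _ hf, Matrix.mulVec_smul, Matrix.mulVec_sub]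

theorem delW_mulVec (A : Matrix (Fin 3) (Fin 3) ℂ) {f : Plane → C3}
    (hf : DifferentiableAt ℝ f y) :
    delW z w (fun y => A.mulVec (f y)) y = A.mulVec (delW z w f y) := by
  simp only [delW, pd_mulVec A _ hf, Matrix.mulVec_smul, Matrix.mulVec_sub]

theorem eventually_differentiableAt {f : Plane → C3} (hf : ContDiffAt ℝ ∞ f y) :
    ∀ᶠ x in 𝓝 y, DifferentiableAt ℝ f x := by
  have h1 : ContDiffAt ℝ 1 f y := hf.of_le (WithTop.coe_le_coe.2 le_top)
  filter_upwards [h1.eventually (by simp)] with x hx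
  exact hx.differentiableAt (by norm_num)

theorem differentiableAt_pd {f : Plane → C3} (hf : ContDiffAt ℝ ∞ f y) (i : Fin 2) :
    DifferentiableAt ℝ (pd i f) y :=
  ((hf.fderiv_right (m := 1) (WithTop.coe_le_coe.2 le_top)).clm_apply
    contDiffAt_const).differentiableAt one_ne_zero

theorem pd_pd_mulVec (A : Matrix (Fin 3) (Fin 3) ℂ) {f : Plane → C3} (hf : ContDiffAt ℝ ∞ f y)
    (i j : Fin 2) :
    pd i (pd j fun y => A.mulVec (f y)) y = A.mulVec (pd i (pd j f) y) := by
  have first : pd j (fun y => A.mulVec (f y)) =ᶠ[𝓝 y] fun y => A.mulVec (pd j f y) :=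
    (eventually_differentiableAt hf).mono fun x hx => pd_mulVec A j hx
  rw [pd_congr i first, pd_mulVec A i (differentiableAt_pd hf j)]

theorem frame_matrix_mulVec (A : Matrix (Fin 3) (Fin 3) ℂ) {f : Plane → C3}
    (hf : DifferentiableAt ℝ f y) (ξ : Plane → C3) :
    frame (fun y => A.mulVec (f y)) (fun y => A.mulVec (ξ y)) y = A * frame f ξ y := by
  ext a b
  fin_cases b <;> simp [frame, pd_mulVec A _ hf, Matrix.mul_apply, Matrix.mulVec, dotProduct]

theorem component_mulVec (A : Matrix.SpecialLinearGroup (Fin 3) ℂ) {f : Plane → C3}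
    (hf : DifferentiableAt ℝ f y) (ξ : Plane → C3) (v : C3) :
    component (fun y => A.1.mulVec (f y)) (fun y => A.1.mulVec (ξ y)) y (A.1.mulVec v) =
      component f ξ y v := by
  have hA : IsUnit A.1.det := by rw [A.2]; exact isUnit_one
  rw [component, component, frame_matrix_mulVec A.1 hf, Matrix.mul_inv_rev, ← Matrix.mulVec_mulVec,
    Matrix.mulVec_mulVec v, Matrix.nonsing_inv_mul _ hA, Matrix.one_mulVec]

theorem inducedVolume_mulVec (A : Matrix.SpecialLinearGroup (Fin 3) ℂ) {f : Plane → C3}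
    (hf : DifferentiableAt ℝ f y) (ξ : Plane → C3) :
    inducedVolume (fun y => A.1.mulVec (f y)) (fun y => A.1.mulVec (ξ y)) y =
      inducedVolume f ξ y := by
  rw [inducedVolume, inducedVolume, frame_matrix_mulVec A.1 hf, Matrix.det_mul, A.2, one_mul]

theorem inducedConnection_mulVec (A : Matrix.SpecialLinearGroup (Fin 3) ℂ) {f : Plane → C3}
    (hf : ContDiffAt ℝ ∞ f y) (ξ : Plane → C3) (k i j : Fin 2) :
    inducedConnection (fun y => A.1.mulVec (f y)) (fun y => A.1.mulVec (ξ y)) k i j y =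
      inducedConnection f ξ k i j y := by
  rw [inducedConnection, pd_pd_mulVec A.1 hf,
    component_mulVec A (eventually_differentiableAt hf).self_of_nhds, inducedConnection]

theorem SphereAt.mulVec (h : SphereAt G C σ y) (hσ : ContDiffAt ℝ ∞ σ y)
    (A : Matrix.SpecialLinearGroup (Fin 3) ℂ) : SphereAt G C (fun y => A.1.mulVec (σ y)) y := by
  have diff := eventually_differentiableAt hσ
  have volume_eq : inducedVolume (fun y => A.1.mulVec (σ y)) (fun y => A.1.mulVec (σ y)) =ᶠ[𝓝 y]
      inducedVolume σ σ := diff.mono fun x hx => inducedVolume_mulVec A hx σ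
  refine ⟨?_, fun i j => ?_, fun i => ?_, ?_, fun k i => ?_, fun i j k => ?_⟩
  · have := h.inducedVolume_ne_zero
    rwa [← volume_eq.eq_of_nhds, inducedVolume_eq, ← linearIndependent_iff_det3_ne_zero] at this
  · rw [fundamentalForm, pd_pd_mulVec A.1 hσ, component_mulVec A diff.self_of_nhds]
    exact h.metric i j
  · rw [pd_congr i volume_eq, volume_eq.eq_of_nhds]
    simp only [inducedConnection_mulVec A hσ]
    exact h.parallel i
  · rw [volume_eq.eq_of_nhds]
    exact h.volume
  · rw [shapeOperator, pd_mulVec A.1 i diff.self_of_nhds, component_mulVec A diff.self_of_nhds]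
    exact h.shape k i
  · simp only [inducedConnection_mulVec A hσ]
    exact h.pick i j k

theorem frame_self_eventuallyEq (hσ : σ =ᶠ[𝓝 y] σ') : frame σ σ =ᶠ[𝓝 y] frame σ' σ' := by
  filter_upwards [pd_eventuallyEq 0 hσ, pd_eventuallyEq 1 hσ, hσ] with x h0 h1 h2
  simp only [frame, h0, h1, h2]

theorem component_self_congr (hσ : σ =ᶠ[𝓝 y] σ') : component σ σ y = component σ' σ' y := by
  funext v
  simp only [component, (frame_self_eventuallyEq hσ).eq_of_nhds]

theorem inducedConnection_self_congr (hσ : σ =ᶠ[𝓝 y] σ') (k i j : Fin 2) :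
    inducedConnection σ σ k i j y = inducedConnection σ' σ' k i j y := by
  rw [inducedConnection, component_self_congr hσ, pd_congr i (pd_eventuallyEq j hσ),
    inducedConnection]

theorem SphereAt.congr (h : SphereAt G C σ y) (hσ : σ =ᶠ[𝓝 y] σ') : SphereAt G C σ' y := by
  have volume_eq : inducedVolume σ σ =ᶠ[𝓝 y] inducedVolume σ' σ' :=
    (frame_self_eventuallyEq hσ).mono fun x hx => by simp only [inducedVolume, hx]
  refine ⟨?_, fun i j => ?_, fun i => ?_, ?_, fun k i => ?_, fun i j k => ?_⟩
  · rw [← pd_congr 0 hσ, ← pd_congr 1 hσ, ← hσ.eq_of_nhds]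
    exact h.transversal
  · rw [← h.metric, fundamentalForm, fundamentalForm, component_self_congr hσ,
      pd_congr i (pd_eventuallyEq j hσ)]
  · rw [← pd_congr i volume_eq, ← volume_eq.eq_of_nhds]
    simp only [← inducedConnection_self_congr hσ]
    exact h.parallel i
  · rw [← volume_eq.eq_of_nhds]
    exact h.volume
  · rw [← h.shape, shapeOperator, shapeOperator, component_self_congr hσ, pd_congr i hσ]
  · simp only [← inducedConnection_self_congr hσ]
    exact h.pick i j k

theorem existsUnique_mulVec_row_eq {n K : Type*} [Fintype n] [DecidableEq n] [Field K]
    {M N : Matrix n n K} (hM : M.det ≠ 0) (hMN : N.det = M.det) :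
    ∃! A : Matrix.SpecialLinearGroup n K, ∀ b, A.1.mulVec (M b) = N b := by
  have rows (A : Matrix n n K) : (∀ b, A.mulVec (M b) = N b) ↔ M * A.transpose = N := by
    simp only [← Matrix.vecMul_transpose, ← Matrix.mul_apply_eq_vecMul]
    exact funext_iff.symm
  have hu : IsUnit M.det := isUnit_iff_ne_zero.2 hM
  refine ⟨⟨(M⁻¹ * N).transpose, ?_⟩, ?_, fun B hB => Subtype.ext ?_⟩
  · rw [Matrix.det_transpose, Matrix.det_mul, Matrix.det_nonsing_inv, Ring.inverse_eq_inv', hMN,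
      inv_mul_cancel₀ hM]
  · refine (rows _).2 ?_
    rw [Matrix.transpose_transpose, Matrix.mul_nonsing_inv_cancel_left _ _ hu]
  · change B.1 = (M⁻¹ * N).transpose
    rw [← (rows _).1 hB, Matrix.nonsing_inv_mul_cancel_left _ _ hu, Matrix.transpose_transpose]

theorem IsParallelFrame.mulVec {S : Fin 2 → Fin 3 → Fin 3 → Plane → ℂ} {F : Plane → Fin 3 → C3}
    (hF : IsParallelFrame S U F) (A : Matrix (Fin 3) (Fin 3) ℂ) :
    IsParallelFrame S U fun y b => A.mulVec (F y b) := by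
  intro y hy
  have row_diff := differentiableAt_pi.1 (hF y hy).1
  have diff : DifferentiableAt ℝ (fun y b => A.mulVec (F y b)) y :=
    differentiableAt_pi.2 fun b => (mulVecReal A).differentiableAt.comp y (row_diff b)
  refine ⟨diff, fun i b => (CAS.pd_apply i
    (ContinuousLinearMap.proj (R := ℝ) (φ := fun _ : Fin 3 => C3) b) diff).symm.trans ?_⟩
  refine (pd_mulVec A i (row_diff b)).trans ?_
  rw [hF.pd_apply hy, ← mulVecReal_apply, map_sum]
  simp only [mulVecReal_apply, Matrix.mulVec_smul]

theorem nullFrame_mulVec (A : Matrix (Fin 3) (Fin 3) ℂ) (hσ : DifferentiableAt ℝ σ y) :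
    nullFrame z w (fun y => A.mulVec (σ y)) y = fun b => A.mulVec (nullFrame z w σ y b) := by
  funext b
  fin_cases b
  exacts [delZ_mulVec A hσ, delW_mulVec A hσ, rfl]

theorem nullFrame_congr (hσ : σ =ᶠ[𝓝 y] σ') : nullFrame z w σ y = nullFrame z w σ' y := by
  rw [nullFrame, nullFrame, delZ_congr .rfl .rfl hσ, delW_congr .rfl .rfl hσ, hσ.eq_of_nhds]

theorem PickData.eventually_eq_mulVec_iff (H : PickData U z w l p q G C)
    (hσ : ContDiffOn ℝ ∞ σ U) (h : ∀ y ∈ U, StructureEqs z w l p q σ y)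
    (hσ' : ContDiffOn ℝ ∞ σ' U) (h' : ∀ y ∈ U, StructureEqs z w l p q σ' y) (hy₀ : y₀ ∈ U)
    (A : Matrix (Fin 3) (Fin 3) ℂ) :
    (∀ᶠ y in 𝓝 y₀, σ' y = A.mulVec (σ y)) ↔
      ∀ b, A.mulVec (nullFrame z w σ y₀ b) = nullFrame z w σ' y₀ b := by
  constructor
  · intro (heq : σ' =ᶠ[𝓝 y₀] fun y => A.mulVec (σ y)) b
    rw [nullFrame_congr heq, nullFrame_mulVec A (H.differentiableAt hσ hy₀)]
  · intro heq
    obtain ⟨r, hr, hrU⟩ := Metric.isOpen_iff.1 H.isOpen y₀ hy₀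
    have parallel := (H.isParallelFrame_nullFrame hσ h).mulVec A
    have parallel' := H.isParallelFrame_nullFrame hσ' h'
    have frames_eq := IsParallelFrame.eqOn_of_starConvex
      ((convex_ball y₀ r).starConvex (Metric.mem_ball_self hr))
      (fun i b c => (H.smooth_structureCoeff i b c).mono hrU)
      (fun y hy => parallel' y (hrU hy)) (fun y hy => parallel y (hrU hy)) (funext heq).symm
    filter_upwards [Metric.ball_mem_nhds y₀ hr] with y hy
    exact congrFun (frames_eq hy) 2

theorem PickData.existsUnique_mulVec (H : PickData U z w l p q G C) (hσ : ContDiffOn ℝ ∞ σ U)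
    (h : ∀ y ∈ U, StructureEqs z w l p q σ y) (hσ' : ContDiffOn ℝ ∞ σ' U)
    (h' : ∀ y ∈ U, StructureEqs z w l p q σ' y) (hy₀ : y₀ ∈ U) :
    ∃! A : Matrix.SpecialLinearGroup (Fin 3) ℂ, ∀ᶠ y in 𝓝 y₀, σ' y = A.1.mulVec (σ y) := by
  have det_nullFrame {σ : Plane → C3} (hs : StructureEqs z w l p q σ y₀) :
      (Matrix.of (nullFrame z w σ y₀)).det = Complex.I * l y₀ / 2 := hs.det
  simp only [H.eventually_eq_mulVec_iff hσ h hσ' h' hy₀]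
  refine existsUnique_mulVec_row_eq (M := Matrix.of (nullFrame z w σ y₀)) ?_
    ((det_nullFrame (h' y₀ hy₀)).trans (det_nullFrame (h y₀ hy₀)).symm)
  rw [det_nullFrame (h y₀ hy₀)]
  exact div_ne_zero (mul_ne_zero Complex.I_ne_zero (H.l_ne y₀ hy₀)) two_ne_zero

end LinearAction

/-! ### Holomorphic coordinates and lifted charts -/

section Holomorphic

variable {F : ℂ → ℂ} {f : Plane → ℂ} {y : Plane} {Ω : Set ℂ} {U : Set Plane}

theorem pd_comp_holomorphic (i : Fin 2) (hF : DifferentiableAt ℂ F (f y))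
    (hf : DifferentiableAt ℝ f y) : pd i (F ∘ f) y = deriv F (f y) * pd i f y := by
  have h := (hF.hasDerivAt.hasFDerivAt.restrictScalars ℝ).comp y hf.hasFDerivAt
  rw [pd, h.fderiv]
  simp [pd, mul_comm]

theorem contDiffOn_comp_holomorphic (hΩ : IsOpen Ω) (hF : DifferentiableOn ℂ F Ω)
    (hf : ContDiffOn ℝ ∞ f U) (hm : MapsTo f U Ω) : ContDiffOn ℝ ∞ (F ∘ f) U :=
  ((hF.contDiffOn (n := ∞) hΩ).restrict_scalars ℝ).comp hf hm

theorem NullCoords.delW_comp_holomorphic {z w : Plane → ℂ} (H : NullCoords U z w) (hy : y ∈ U)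
    (hF : DifferentiableAt ℂ F (z y)) : delW z w (F ∘ z) y = 0 :=
  delW_eq (H.jac_ne y hy) (a := deriv F (z y)) fun i => by
    rw [pd_comp_holomorphic i hF (H.differentiableAt H.smooth_z hy), smul_zero, add_zero,
      smul_eq_mul, mul_comm]

theorem NullCoords.delZ_comp_holomorphic {z w : Plane → ℂ} (H : NullCoords U z w) (hy : y ∈ U)
    (hF : DifferentiableAt ℂ F (w y)) : delZ z w (F ∘ w) y = 0 :=
  delZ_eq (H.jac_ne y hy) (b := deriv F (w y)) fun i => by
    rw [pd_comp_holomorphic i hF (H.differentiableAt H.smooth_w hy), smul_zero, zero_add,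
      smul_eq_mul, mul_comm]

end Holomorphic

section Lift

variable {S M H : Type*} [TopologicalSpace S] [TopologicalSpace M] [TopologicalSpace H]
  {p : M → S} {e : OpenPartialHomeomorph S H} {κ : OpenPartialHomeomorph M H}

theorem IsLift.mem_target (h : IsLift p e κ) {y : H} (hy : y ∈ κ.target) : y ∈ e.target := by
  obtain ⟨hp, h⟩ := h _ (κ.map_target hy)
  rw [κ.right_inv hy] at h
  exact h ▸ e.map_source hp

theorem IsLift.apply_symm (h : IsLift p e κ) {y : H} (hy : y ∈ κ.target) :
    p (κ.symm y) = e.symm y := by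
  obtain ⟨hp, h⟩ := h _ (κ.map_target hy)
  rw [κ.right_inv hy] at h
  exact ((congrArg e.symm h).trans (e.left_inv hp)).symm

theorem IsLift.symm_apply (h : IsLift p e κ) {x : M} (hx : x ∈ κ.source) :
    e.symm (κ x) = p x := by
  rw [(h x hx).2, e.left_inv (h x hx).1]

theorem exists_isLift (hp : IsLocalHomeomorph p) {x : M} (hx : p x ∈ e.source) :
    ∃ κ : OpenPartialHomeomorph M H, IsLift p e κ ∧ x ∈ κ.source := by
  obtain ⟨q, hq, rfl⟩ := hp x
  exact ⟨q ≫ₕ e, fun y hy => ⟨by simpa using hy.2, rfl⟩, by simpa using ⟨hq, hx⟩⟩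

theorem exists_isLift_of_target (hp : IsLocalHomeomorph p) (hs : Function.Surjective p) {y : H}
    (hy : y ∈ e.target) : ∃ κ : OpenPartialHomeomorph M H, IsLift p e κ ∧ y ∈ κ.target := by
  obtain ⟨x, hx⟩ := hs (e.symm y)
  obtain ⟨κ, hκ, hxκ⟩ := exists_isLift (e := e) hp (x := x) (hx ▸ e.map_target hy)
  refine ⟨κ, hκ, ?_⟩
  have := κ.map_source hxκ
  rwa [(hκ x hxκ).2, hx, e.right_inv hy] at this

theorem IsLift.exists_isLift_comp_eventuallyEq {H' V : Type*} [TopologicalSpace H']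
    {z : OpenPartialHomeomorph S H'} {y : H} (hκ : IsLift p e κ) (hp : IsLocalHomeomorph p)
    (hy : y ∈ κ.target) (hyz : e.symm y ∈ z.source) (f : M → V) :
    ∃ ζ : OpenPartialHomeomorph M H', IsLift p z ζ ∧ z (e.symm y) ∈ ζ.target ∧
      f ∘ κ.symm =ᶠ[𝓝 y] (f ∘ ζ.symm) ∘ z ∘ e.symm := by
  obtain ⟨ζ, hζ, hxζ⟩ := exists_isLift hp (x := κ.symm y) (by rwa [hκ.apply_symm hy])
  have apply_lift : ∀ y ∈ κ.target, κ.symm y ∈ ζ.source → ζ (κ.symm y) = z (e.symm y) :=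
    fun y hy hyζ => by rw [(hζ _ hyζ).2, hκ.apply_symm hy]
  refine ⟨ζ, hζ, apply_lift y hy hxζ ▸ ζ.map_source hxζ, ?_⟩
  filter_upwards [(κ.symm.isOpen_inter_preimage ζ.open_source).mem_nhds ⟨hy, hxζ⟩] with y' hy'
  simp only [Function.comp_apply, ← apply_lift y' hy'.1 hy'.2, ζ.left_inv hy'.2]

variable (p) in
/-- The atlas of lifted charts on a space over the surface. -/
abbrev liftedAtlas [ChartedSpace Plane S] (hp : IsLocalHomeomorph p) : ChartedSpace Plane M where
  atlas := {κ | ∃ e ∈ atlas Plane S, IsLift p e κ}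
  chartAt x := (exists_isLift hp (mem_chart_source Plane (p x))).choose
  mem_chart_source x := (exists_isLift hp (mem_chart_source Plane (p x))).choose_spec.2
  chart_mem_atlas x := ⟨_, chart_mem_atlas Plane (p x),
    (exists_isLift hp (mem_chart_source Plane (p x))).choose_spec.1⟩

theorem locallyPathConnectedSpace_of_isLocalHomeomorph [ChartedSpace Plane S]
    (hp : IsLocalHomeomorph p) : LocallyPathConnectedSpace M :=
  let _ := liftedAtlas p hp
  ChartedSpace.locallyPathConnectedSpace Plane M

end Lift

section Coordinates

variable {S : Type*} [TopologicalSpace S] [ChartedSpace Plane S] {c c₁ c₂ : ComplexStructure S}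
  {z w : OpenPartialHomeomorph S ℂ} {e e' : OpenPartialHomeomorph S Plane} {y : Plane}

/-- The part of the range of the chart `e` where the complex coordinates `z`, `w` are defined. -/
def chartDomain (z w : OpenPartialHomeomorph S ℂ) (e : OpenPartialHomeomorph S Plane) : Set Plane :=
  e.target ∩ e.symm ⁻¹' (z.source ∩ w.source)

omit [ChartedSpace Plane S] in
theorem isOpen_chartDomain : IsOpen (chartDomain z w e) :=
  e.symm.isOpen_inter_preimage (z.open_source.inter w.open_source)

section Smooth

variable [IsManifold (𝓡 2) ∞ S]

theorem contMDiffOn_chart_symm (he : e ∈ atlas Plane S) :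
    ContMDiffOn (𝓡 2) (𝓡 2) ∞ e.symm e.target :=
  contMDiffOn_symm_of_mem_maximalAtlas (IsManifold.subset_maximalAtlas he)

theorem contMDiffOn_chart (he : e ∈ atlas Plane S) : ContMDiffOn (𝓡 2) (𝓡 2) ∞ e e.source :=
  contMDiffOn_of_mem_maximalAtlas (IsManifold.subset_maximalAtlas he)

theorem contDiffOn_transition (he : e ∈ atlas Plane S) (he' : e' ∈ atlas Plane S) :
    ContDiffOn ℝ ∞ (e' ∘ e.symm) (e.target ∩ e.symm ⁻¹' e'.source) :=
  contMDiffOn_iff_contDiffOn.1 ((contMDiffOn_chart he').comp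
    ((contMDiffOn_chart_symm he).mono inter_subset_left) fun _ hy => hy.2)

theorem contDiffOn_comp_chart_symm (he : e ∈ atlas Plane S) {f : S → ℂ} {s : Set S}
    (hf : ContMDiffOn (𝓡 2) 𝓘(ℝ, ℂ) ∞ f s) :
    ContDiffOn ℝ ∞ (f ∘ e.symm) (e.target ∩ e.symm ⁻¹' s) :=
  contMDiffOn_iff_contDiffOn.1 (hf.comp ((contMDiffOn_chart_symm he).mono inter_subset_left)
    fun _ hy => hy.2)

theorem mdifferentiable_of_mem_atlas_infty (he : e ∈ atlas Plane S) :
    e.MDifferentiable (𝓡 2) (𝓡 2) :=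
  have : IsManifold (𝓡 2) 1 S := .of_le (n := ∞) (WithTop.coe_le_coe.2 le_top)
  mdifferentiable_of_mem_atlas he

theorem dcoord_mfderiv_symm (hz : z ∈ c.charts) (he : e ∈ atlas Plane S) (hy : y ∈ e.target)
    (hyz : e.symm y ∈ z.source) (v : Plane) :
    dcoord z (e.symm y) (mfderiv (𝓡 2) (𝓡 2) e.symm y v) = fderiv ℝ (z ∘ e.symm) y v := by
  have hz' : MDifferentiableAt (𝓡 2) 𝓘(ℝ, ℂ) z (e.symm y) :=
    ((c.smooth z hz).contMDiffAt (z.open_source.mem_nhds hyz)).mdifferentiableAt (by simp)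
  have he' : MDifferentiableAt (𝓡 2) (𝓡 2) e.symm y :=
    (mdifferentiable_of_mem_atlas_infty he).symm.mdifferentiableAt hy
  exact (mfderiv_comp_apply y hz' he' v).symm.trans (by rw [mfderiv_eq_fderiv]; rfl)

theorem mfderiv_chart_symm_surjective (he : e ∈ atlas Plane S) (hy : y ∈ e.target) :
    Function.Surjective (mfderiv (𝓡 2) (𝓡 2) e.symm y) :=
  (mdifferentiable_of_mem_atlas_infty he).symm.mfderiv_surjective hy

end Smooth

section PickData

variable [IsManifold (𝓡 2) ∞ S] {g : CTensor S 2} {Q Q₁ Q₂ : CTensor S 3} {l : S → ℂ}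

theorem ComplexStructure.contDiffOn (hz : z ∈ c.charts) (he : e ∈ atlas Plane S) :
    ContDiffOn ℝ ∞ (z ∘ e.symm) (e.target ∩ e.symm ⁻¹' z.source) :=
  contDiffOn_comp_chart_symm he (c.smooth z hz)

theorem ComplexStructure.contDiffAt (hz : z ∈ c.charts)
    (he : e ∈ atlas Plane S) (hy : y ∈ e.target) (hyz : e.symm y ∈ z.source) :
    ContDiffAt ℝ ∞ (z ∘ e.symm) y :=
  (c.contDiffOn hz he).contDiffAt ((e.symm.isOpen_inter_preimage z.open_source).mem_nhds ⟨hy, hyz⟩)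

omit [IsManifold (𝓡 2) ∞ S] in
theorem ComplexStructure.IsCompatible.side_pos (hc : c.IsCompatible) (hz : z ∈ c.charts)
    (he : e ∈ atlas Plane S) (hy : y ∈ e.target) (hyz : e.symm y ∈ z.source) :
    0 < side fun i => pd i (z ∘ e.symm) y := hc z hz e he y hy hyz

omit [IsManifold (𝓡 2) ∞ S] in
theorem ComplexStructure.IsAntiCompatible.side_neg (hc : c.IsAntiCompatible) (hz : z ∈ c.charts)
    (he : e ∈ atlas Plane S) (hy : y ∈ e.target) (hyz : e.symm y ∈ z.source) :
    side (fun i => pd i (z ∘ e.symm) y) < 0 := hc z hz e he y hy hyz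

theorem nullCoords_chartDomain (hc₁ : c₁.IsCompatible) (hc₂ : c₂.IsAntiCompatible)
    (hz : z ∈ c₁.charts) (hw : w ∈ c₂.charts) (he : e ∈ atlas Plane S) :
    NullCoords (chartDomain z w e) (z ∘ e.symm) (w ∘ e.symm) where
  isOpen := isOpen_chartDomain
  smooth_z := (c₁.contDiffOn hz he).mono (inter_subset_inter_right _ fun _ hy => hy.1)
  smooth_w := (c₂.contDiffOn hw he).mono (inter_subset_inter_right _ fun _ hy => hy.2)
  jac_ne _ hy := jac_ne_zero_of_side (hc₁.side_pos hz he hy.1 hy.2.1)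
    (hc₂.side_neg hw he hy.1 hy.2.2)

omit [IsManifold (𝓡 2) ∞ S] in
theorem CTensor.coeff_eq_gram (g : CTensor S 2) (i : Fin 2 → Fin 2) :
    g.coeff e y i = gram g e y (i 0) (i 1) :=
  congrArg (g.coeff e y) (FinVec.etaExpand_eq i).symm

theorem isNullForm_gram_iff (hz : z ∈ c₁.charts) (hw : w ∈ c₂.charts) (he : e ∈ atlas Plane S)
    {a : ℂ} (hy : y ∈ chartDomain z w e) :
    IsNullForm (gram g e y) a (fun i => pd i (z ∘ e.symm) y) (fun i => pd i (w ∘ e.symm) y) ↔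
      ∀ v v' : TangentSpace (𝓡 2) (e.symm y), g (e.symm y) ![v, v'] = a * ((1 / 2) *
        (dcoord z (e.symm y) v * dcoord w (e.symm y) v' +
          dcoord w (e.symm y) v * dcoord z (e.symm y) v')) := by
  have dz := dcoord_mfderiv_symm hz he hy.1 hy.2.1
  have dw := dcoord_mfderiv_symm hw he hy.1 hy.2.2
  constructor
  · intro hG v v'
    have hsurj : ∀ v, ∃ b : Plane, mfderiv (𝓡 2) (𝓡 2) e.symm y b = v :=
      mfderiv_chart_symm_surjective he hy.1
    obtain ⟨b, rfl⟩ := hsurj v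
    obtain ⟨b', rfl⟩ := hsurj v'
    set Z : Plane →ₗ[ℝ] ℂ := (fderiv ℝ (z ∘ e.symm) y).toLinearMap
    set W : Plane →ₗ[ℝ] ℂ := (fderiv ℝ (w ∘ e.symm) y).toLinearMap
    set L : Plane →ₗ[ℝ] TangentSpace (𝓡 2) (e.symm y) :=
      (mfderiv (𝓡 2) (𝓡 2) e.symm y).toLinearMap
    set P : MultilinearMap ℝ (fun _ : Fin 2 => ℂ) ℂ := MultilinearMap.mkPiAlgebra ℝ (Fin 2) ℂ
    have pullback_eq : (g (e.symm y)).compLinearMap (fun _ => L) =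
        a • ((1 / 2 : ℂ) • (P.compLinearMap ![Z, W] + P.compLinearMap ![W, Z])) := by
      refine Module.Basis.ext_multilinear
        (fun _ => (EuclideanSpace.basisFun (Fin 2) ℝ).toBasis) fun i => ?_
      have value := hG (i 0) (i 1)
      rw [← CTensor.coeff_eq_gram] at value
      simp only [smul_apply, add_apply, MultilinearMap.compLinearMap_apply, P,
        MultilinearMap.mkPiAlgebra_apply, Fin.prod_univ_two, smul_eq_mul,
        OrthonormalBasis.coe_toBasis, EuclideanSpace.basisFun_apply]
      exact value
    have value := DFunLike.congr_fun pullback_eq ![b, b']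
    simp only [smul_apply, add_apply, MultilinearMap.compLinearMap_apply, P,
      MultilinearMap.mkPiAlgebra_apply, Fin.prod_univ_two, smul_eq_mul] at value
    rw [dz, dz, dw, dw]
    refine Eq.trans (congrArg (g (e.symm y)) (funext fun i => ?_)) value
    fin_cases i <;> rfl
  · intro hg i j
    have value := hg (mfderiv (𝓡 2) (𝓡 2) e.symm y (EuclideanSpace.single i (1 : ℝ)))
      (mfderiv (𝓡 2) (𝓡 2) e.symm y (EuclideanSpace.single j (1 : ℝ)))
    rw [dz, dz, dw, dw] at value
    refine Eq.trans (congrArg (g (e.symm y)) (funext fun k => ?_)) value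
    fin_cases k <;> rfl

theorem IsNullForm.eq_coefficient {G : Matrix (Fin 2) (Fin 2) ℂ} {a : ℂ} {Z W : Fin 2 → ℂ}
    (h : IsNullForm G a Z W) (hJ : Z 0 * W 1 - Z 1 * W 0 ≠ 0) :
    a = 2 * (W 1 * (Z 0 * G 0 1 - Z 1 * G 0 0) - W 0 * (Z 0 * G 1 1 - Z 1 * G 1 0)) /
      (Z 0 * W 1 - Z 1 * W 0) ^ 2 := by
  rw [h, h, h, h, eq_div_iff (pow_ne_zero 2 hJ)]
  ring

omit [IsManifold (𝓡 2) ∞ S] in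
theorem CTensor.IsSmooth.contDiffOn_gram (hg : g.IsSmooth) (he : e ∈ atlas Plane S) (i j : Fin 2) :
    ContDiffOn ℝ ∞ (fun y => gram g e y i j) e.target := hg e he ![i, j]

theorem nullMetric_chartDomain (hc₁ : c₁.IsCompatible) (hc₂ : c₂.IsAntiCompatible)
    (hz : z ∈ c₁.charts) (hw : w ∈ c₂.charts) (he : e ∈ atlas Plane S) (hg : g.IsSmooth)
    (hl : ∀ x ∈ z.source ∩ w.source, l x ≠ 0 ∧ ∀ v v' : TangentSpace (𝓡 2) x, g x ![v, v'] =
      l x * ((1 / 2) * (dcoord z x v * dcoord w x v' + dcoord w x v * dcoord z x v'))) :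
    NullMetric (chartDomain z w e) (z ∘ e.symm) (w ∘ e.symm) (l ∘ e.symm) (gram g e) := by
  have N := nullCoords_chartDomain hc₁ hc₂ hz hw he
  have hform : ∀ y ∈ chartDomain z w e, IsNullForm (gram g e y) (l (e.symm y))
      (fun i => pd i (z ∘ e.symm) y) (fun i => pd i (w ∘ e.symm) y) := fun y hy =>
    (isNullForm_gram_iff hz hw he hy).2 (hl _ hy.2).2
  refine ⟨N, ?_, fun y hy => (hl _ hy.2).1, hform⟩
  have hG := fun i j => (hg.contDiffOn_gram he i j).mono (inter_subset_left : chartDomain z w e ⊆ _)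
  have dz := fun i => N.smooth_pd i N.smooth_z
  have dw := fun i => N.smooth_pd i N.smooth_w
  refine (contDiffOn_div ((contDiffOn_const (c := (2 : ℂ))).mul
    (((dw 1).mul (((dz 0).mul (hG 0 1)).sub ((dz 1).mul (hG 0 0)))).sub
      ((dw 0).mul (((dz 0).mul (hG 1 1)).sub ((dz 1).mul (hG 1 0))))))
    (N.smooth_jac.pow 2) fun y hy => pow_ne_zero 2 (N.jac_ne y hy)).congr fun y hy => ?_
  exact (hform y hy).eq_coefficient (N.jac_ne y hy)

theorem coeff_cubic (hz : z ∈ c.charts) (he : e ∈ atlas Plane S) {φ : ℂ → ℂ}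
    (hQ : ∀ x ∈ z.source, ∀ v : Fin 3 → TangentSpace (𝓡 2) x,
      Q x v = φ (z x) * ∏ a, dcoord z x (v a)) (hy : y ∈ e.target) (hyz : e.symm y ∈ z.source)
    (i : Fin 3 → Fin 2) :
    Q.coeff e y i = (φ ∘ (z ∘ e.symm)) y * ∏ a, pd (i a) (z ∘ e.symm) y := by
  rw [CTensor.coeff, hQ _ hyz]
  simp only [dcoord_mfderiv_symm hz he hy hyz]
  rfl

variable (z w) in
/-- In the coordinates `z`, `w` one has `g = l dz dw`, `Q₁ = φ dz³` and `Q₂ = ψ dw³`. -/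
structure CoordinateData (l φ ψ : S → ℂ) (g : CTensor S 2) (Q₁ Q₂ : CTensor S 3) : Prop where
  pick : ∀ e ∈ atlas Plane S, PickData (chartDomain z w e) (z ∘ e.symm) (w ∘ e.symm)
    (l ∘ e.symm) (φ ∘ e.symm) (ψ ∘ e.symm) (gram g e) ((Q₁ + Q₂).coeff e)
  coeff_left : ∀ e ∈ atlas Plane S, ∀ y ∈ chartDomain z w e, ∀ i,
    Q₁.coeff e y i = (φ ∘ e.symm) y * ∏ a, pd (i a) (z ∘ e.symm) y
  coeff_right : ∀ e ∈ atlas Plane S, ∀ y ∈ chartDomain z w e, ∀ i,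
    Q₂.coeff e y i = (ψ ∘ e.symm) y * ∏ a, pd (i a) (w ∘ e.symm) y

theorem exists_coordinateData (hc₁ : c₁.IsCompatible) (hc₂ : c₂.IsAntiCompatible)
    (hQ₁ : IsHolomorphicCubic c₁ Q₁) (hQ₂ : IsHolomorphicCubic c₂ Q₂) (hg : g.IsSmooth)
    (hgc : HasConformalClass g c₁ c₂) (x : S) :
    ∃ (z w : OpenPartialHomeomorph S ℂ) (l φ ψ : S → ℂ), x ∈ z.source ∩ w.source ∧
      CoordinateData z w l φ ψ g Q₁ Q₂ := by
  classical
  obtain ⟨z, hz, hxz⟩ := c₁.cover x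
  obtain ⟨w, hw, hxw⟩ := c₂.cover x
  choose! l hl using hgc z hz w hw
  obtain ⟨φ, hφ, hφQ⟩ := hQ₁ z hz
  obtain ⟨ψ, hψ, hψQ⟩ := hQ₂ w hw
  refine ⟨z, w, l, φ ∘ z, ψ ∘ w, ⟨hxz, hxw⟩, fun e he => ?_, fun e he y hy i =>
    coeff_cubic hz he hφQ hy.1 hy.2.1 i, fun e he y hy i => coeff_cubic hw he hψQ hy.1 hy.2.2 i⟩
  have H := nullMetric_chartDomain hc₁ hc₂ hz hw he hg hl
  have mz : MapsTo (z ∘ e.symm) (chartDomain z w e) z.target := fun y hy => z.map_source hy.2.1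
  have mw : MapsTo (w ∘ e.symm) (chartDomain z w e) w.target := fun y hy => w.map_source hy.2.2
  have holφ : ∀ y ∈ chartDomain z w e, DifferentiableAt ℂ φ (z (e.symm y)) := fun y hy =>
    hφ.differentiableAt (z.open_target.mem_nhds (mz hy))
  have holψ : ∀ y ∈ chartDomain z w e, DifferentiableAt ℂ ψ (w (e.symm y)) := fun y hy =>
    hψ.differentiableAt (w.open_target.mem_nhds (mw hy))
  exact ⟨H, fun y hy => hc₁.side_pos hz he hy.1 hy.2.1, fun y hy =>
    hc₂.side_neg hw he hy.1 hy.2.2, contDiffOn_comp_holomorphic z.open_target hφ H.smooth_z mz,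
    contDiffOn_comp_holomorphic w.open_target hψ H.smooth_w mw,
    fun y hy => H.delW_comp_holomorphic hy (holφ y hy),
    fun y hy => H.delZ_comp_holomorphic hy (holψ y hy),
    fun y hy i => congrArg₂ (· + ·) (coeff_cubic hz he hφQ hy.1 hy.2.1 i)
      (coeff_cubic hw he hψQ hy.1 hy.2.2 i)⟩

end PickData

end Coordinates

/-! ### Affine spheres on the covering surface -/

section Spheres

variable {S M : Type*} [TopologicalSpace S] [ChartedSpace Plane S] [TopologicalSpace M]
  {p : M → S} {g : CTensor S 2} {C Q₁ Q₂ : CTensor S 3} {σ σ' : M → C3} {x : M}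
  {z w : OpenPartialHomeomorph S ℂ} {l φ ψ : S → ℂ} {e e' : OpenPartialHomeomorph S Plane}
  {κ : OpenPartialHomeomorph M Plane}

theorem CoordinateData.gauss_iff (D : CoordinateData z w l φ ψ g Q₁ Q₂) (he : e ∈ atlas Plane S)
    {y : Plane} (hy : y ∈ chartDomain z w e) :
    curvature (gram g e) y = -1 + (1 / 4) * cubicPairing g Q₁ Q₂ e y ↔
      delW (z ∘ e.symm) (w ∘ e.symm)
        (logDelZ (z ∘ e.symm) (w ∘ e.symm) (l ∘ e.symm)) y +
        (φ ∘ e.symm) y / (l ∘ e.symm) y * ((ψ ∘ e.symm) y / (l ∘ e.symm) y) =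
        (l ∘ e.symm) y / 2 := by
  rw [← (D.pick e he).curvature_eq_iff hy, cubicPairing,
    (D.pick e he).sum_pairing_eq hy (D.coeff_left e he y hy) (D.coeff_right e he y hy)]

variable (p g C) in
/-- `σ` is an affine sphere, with itself as affine normal, at the point `x` of the covering. -/
def IsSphereNear (σ : M → C3) (x : M) : Prop :=
  ∀ e ∈ atlas Plane S, ∀ κ : OpenPartialHomeomorph M Plane, IsLift p e κ → x ∈ κ.source →
    ContDiffAt ℝ ∞ (σ ∘ κ.symm) (κ x) ∧ SphereAt (gram g e) (C.coeff e) (σ ∘ κ.symm) (κ x)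

theorem isEquivariantCAS_iff : IsEquivariantCAS p g C σ ↔
    IsPositiveComplexMetric g ∧ (∀ x, IsSphereNear p g C σ x) ∧ IsEquivariant p σ σ := by
  constructor
  · rintro ⟨ξ, h, hC, hρ, hξ⟩
    obtain rfl : σ = ξ := funext fun x => sub_eq_zero.1 (hξ x)
    refine ⟨h.positive, fun x e he κ hκ hx => ?_, hρ⟩
    have hy := κ.map_source hx
    exact ⟨(h.smooth e he κ hκ).contDiffAt (κ.open_target.mem_nhds hy),
      h.transversal e he κ hκ _ hy, h.metric e he κ hκ _ hy, h.parallel e he κ hκ _ hy,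
      h.volume e he κ hκ _ hy, h.shape e he κ hκ _ hy, hC e he κ hκ _ hy⟩
  · rintro ⟨hg, h, hρ⟩
    have hσ : ∀ e ∈ atlas Plane S, ∀ κ : OpenPartialHomeomorph M Plane, IsLift p e κ →
        ∀ y ∈ κ.target, ContDiffAt ℝ ∞ (σ ∘ κ.symm) y ∧
          SphereAt (gram g e) (C.coeff e) (σ ∘ κ.symm) y := fun e he κ hκ y hy => by
      have := h (κ.symm y) e he κ hκ (κ.map_target hy)
      rwa [κ.right_inv hy] at this
    have hsmooth : SmoothOnCover p σ := fun e he κ hκ y hy =>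
      (hσ e he κ hκ y hy).1.contDiffWithinAt
    exact ⟨σ, ⟨⟨⟨hsmooth, hsmooth, fun e he κ hκ y hy => (hσ e he κ hκ y hy).2.transversal⟩, hg,
      fun e he κ hκ y hy => (hσ e he κ hκ y hy).2.metric,
      fun e he κ hκ y hy => (hσ e he κ hκ y hy).2.parallel,
      fun e he κ hκ y hy => (hσ e he κ hκ y hy).2.volume⟩,
      fun e he κ hκ y hy => (hσ e he κ hκ y hy).2.shape⟩,
      fun e he κ hκ y hy => (hσ e he κ hκ y hy).2.pick, hρ, fun x => sub_self _⟩

theorem IsSphereNear.congr (h : IsSphereNear p g C σ x) (hσ : σ =ᶠ[𝓝 x] σ') :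
    IsSphereNear p g C σ' x := fun e he κ hκ hx => by
  have hev : σ ∘ κ.symm =ᶠ[𝓝 (κ x)] σ' ∘ κ.symm :=
    (κ.eventually_nhds' (fun y => σ y = σ' y) hx).2 hσ
  obtain ⟨hsmooth, hsphere⟩ := h e he κ hκ hx
  exact ⟨hsmooth.congr_of_eventuallyEq hev.symm, hsphere.congr hev⟩

theorem IsSphereNear.mulVec (h : IsSphereNear p g C σ x)
    (A : Matrix.SpecialLinearGroup (Fin 3) ℂ) :
    IsSphereNear p g C (fun y => A.1.mulVec (σ y)) x := fun e he κ hκ hx => by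
  obtain ⟨hsmooth, hsphere⟩ := h e he κ hκ hx
  exact ⟨contDiffAt_mulVec A.1 hsmooth, hsphere.mulVec hsmooth A⟩

omit [TopologicalSpace S] [ChartedSpace Plane S] in
theorem apply_symm_of_mem_deckGroup {d : M ≃ₜ M} (hd : d ∈ deckGroup p) (x : M) :
    p (d.symm x) = p x := by
  have := hd (d.symm x)
  rwa [d.apply_symm_apply, eq_comm] at this

theorem IsSphereNear.comp_deck {d : M ≃ₜ M} (hd : d ∈ deckGroup p)
    (h : IsSphereNear p g C σ (d x)) : IsSphereNear p g C (σ ∘ d) x := fun e he κ hκ hx => by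
  have hlift : IsLift p e (d.symm.transOpenPartialHomeomorph κ) := fun x' hx' =>
    apply_symm_of_mem_deckGroup hd x' ▸ hκ (d.symm x') hx'
  simpa [Function.comp_def] using h e he _ hlift (by simpa using hx)

section Local

variable (D : CoordinateData z w l φ ψ g Q₁ Q₂)
include D

theorem CoordinateData.exists_structureEqs_of_sphere (he : e ∈ atlas Plane S) (hκ : IsLift p e κ)
    (hx : x ∈ κ.source) (hpx : p x ∈ z.source ∩ w.source)
    (hσ : ∀ᶠ x' in 𝓝 x, IsSphereNear p g (Q₁ + Q₂) σ x') :
    ∃ V ⊆ chartDomain z w e, IsOpen V ∧ κ x ∈ V ∧ ContDiffOn ℝ ∞ (σ ∘ κ.symm) V ∧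
      ∀ y ∈ V, StructureEqs (z ∘ e.symm) (w ∘ e.symm) (l ∘ e.symm) (φ ∘ e.symm) (ψ ∘ e.symm)
        (σ ∘ κ.symm) y := by
  obtain ⟨V, hV, hVo, hxV⟩ := eventually_nhds_iff.1 <|
    ((κ.eventually_nhds' (IsSphereNear p g (Q₁ + Q₂) σ) hx).2 hσ).and
      (κ.open_target.mem_nhds (κ.map_source hx))
  have hsphere : ∀ y ∈ V, ContDiffAt ℝ ∞ (σ ∘ κ.symm) y ∧
      SphereAt (gram g e) ((Q₁ + Q₂).coeff e) (σ ∘ κ.symm) y := fun y hy => by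
    have := (hV y hy).1 e he κ hκ (κ.map_target (hV y hy).2)
    rwa [κ.right_inv (hV y hy).2] at this
  have H := (D.pick e he).mono (hVo.inter isOpen_chartDomain) inter_subset_right
  have hsm : ContDiffOn ℝ ∞ (σ ∘ κ.symm) (V ∩ chartDomain z w e) := fun y hy =>
    (hsphere y hy.1).1.contDiffWithinAt
  refine ⟨_, inter_subset_right, hVo.inter isOpen_chartDomain, ⟨hxV, hκ.mem_target
    (κ.map_source hx), ?_⟩, hsm, fun y hy => H.structureEqs_of_sphereAt hsm hy (hsphere y hy.1).2⟩
  rw [mem_preimage, hκ.symm_apply hx]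
  exact hpx

theorem CoordinateData.existsUnique_mulVec (he : e ∈ atlas Plane S) (hκ : IsLift p e κ)
    (hx : x ∈ κ.source) (hpx : p x ∈ z.source ∩ w.source)
    (hσ : ∀ᶠ x' in 𝓝 x, IsSphereNear p g (Q₁ + Q₂) σ x')
    (hσ' : ∀ᶠ x' in 𝓝 x, IsSphereNear p g (Q₁ + Q₂) σ' x') :
    ∃! A : Matrix.SpecialLinearGroup (Fin 3) ℂ, ∀ᶠ y in 𝓝 x, σ' y = A.1.mulVec (σ y) := by
  obtain ⟨V, hVs, hVo, hxV, hs, h⟩ := D.exists_structureEqs_of_sphere he hκ hx hpx hσ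
  obtain ⟨V', -, hVo', hxV', hs', h'⟩ := D.exists_structureEqs_of_sphere he hκ hx hpx hσ'
  have H := (D.pick e he).mono (hVo.inter hVo') (inter_subset_left.trans hVs)
  have := H.existsUnique_mulVec (hs.mono inter_subset_left) (fun y hy => h y hy.1)
    (hs'.mono inter_subset_right) (fun y hy => h' y hy.2) ⟨hxV, hxV'⟩
  refine (existsUnique_congr fun A => ?_).1 this
  exact κ.eventually_nhds' (fun y => σ' y = A.1.mulVec (σ y)) hx

theorem CoordinateData.gauss_of_sphere (he : e ∈ atlas Plane S) (hκ : IsLift p e κ)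
    (hx : x ∈ κ.source) (hpx : p x ∈ z.source ∩ w.source)
    (hσ : ∀ᶠ x' in 𝓝 x, IsSphereNear p g (Q₁ + Q₂) σ x') :
    curvature (gram g e) (κ x) = -1 + (1 / 4) * cubicPairing g Q₁ Q₂ e (κ x) := by
  obtain ⟨V, hVs, hVo, hxV, hs, h⟩ := D.exists_structureEqs_of_sphere he hκ hx hpx hσ
  exact (D.gauss_iff he (hVs hxV)).2
    (((D.pick e he).mono hVo hVs).integrability_of_structureEqs hs h hxV)

theorem CoordinateData.structureEqs_comp_transition [IsManifold (𝓡 2) ∞ S] {V V' : Set Plane}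
    (he : e ∈ atlas Plane S) (he' : e' ∈ atlas Plane S) (hVo : IsOpen V)
    (hV : V ⊆ chartDomain z w e) {s : Plane → C3} (hs : ContDiffOn ℝ ∞ s V)
    (h : ∀ y ∈ V, StructureEqs (z ∘ e.symm) (w ∘ e.symm) (l ∘ e.symm) (φ ∘ e.symm) (ψ ∘ e.symm)
      s y) (hVo' : IsOpen V') (hV' : V' ⊆ chartDomain z w e') (hsub : V' ⊆ e'.symm ⁻¹' e.source)
    (hm : MapsTo (e ∘ e'.symm) V' V) {y : Plane} (hy : y ∈ V') :
    StructureEqs (z ∘ e'.symm) (w ∘ e'.symm) (l ∘ e'.symm) (φ ∘ e'.symm) (ψ ∘ e'.symm)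
      (s ∘ e ∘ e'.symm) y := by
  have transition_eq {E : Type} (f : S → E) {y} (hy : y ∈ V') :
      (f ∘ e.symm) ∘ e ∘ e'.symm =ᶠ[𝓝 y] f ∘ e'.symm := by
    filter_upwards [hVo'.mem_nhds hy] with y' hy'
    exact congrArg f (e.left_inv (hsub hy'))
  have hJ : ∀ y ∈ V', jac ((z ∘ e.symm) ∘ e ∘ e'.symm) ((w ∘ e.symm) ∘ e ∘ e'.symm) y ≠ 0 :=
    fun y hy => by
      simp only [jac, pd_congr _ (transition_eq z hy), pd_congr _ (transition_eq w hy)]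
      exact (D.pick e' he').jac_ne y (hV' hy)
  have hτ : ContDiffOn ℝ ∞ (e ∘ e'.symm) V' :=
    (contDiffOn_transition he' he).mono fun y hy => ⟨(hV' hy).1, hsub hy⟩
  exact (StructureEqs.comp ((D.pick e he).mono hVo hV).toNullMetric hs h hVo' hτ hm hJ hy).congr
    (transition_eq z hy) (transition_eq w hy) (transition_eq l hy)
    (transition_eq φ hy).eq_of_nhds (transition_eq ψ hy).eq_of_nhds .rfl

theorem CoordinateData.isSphereNear_of_structureEqs [IsManifold (𝓡 2) ∞ S]
    (he : e ∈ atlas Plane S) (hκ : IsLift p e κ) {V : Set Plane} (hVo : IsOpen V)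
    (hV : V ⊆ chartDomain z w e) {s : Plane → C3} (hs : ContDiffOn ℝ ∞ s V)
    (h : ∀ y ∈ V, StructureEqs (z ∘ e.symm) (w ∘ e.symm) (l ∘ e.symm) (φ ∘ e.symm) (ψ ∘ e.symm)
      s y) (hx : x ∈ κ.source) (hxV : κ x ∈ V) : IsSphereNear p g (Q₁ + Q₂) (s ∘ κ) x := by
  intro e' he' κ' hκ' hx'
  set V' : Set Plane := (e'.symm ≫ₕ e).source ∩ (e'.symm ≫ₕ e) ⁻¹' V
  have hVo' : IsOpen V' := (e'.symm ≫ₕ e).isOpen_inter_preimage hVo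
  have hsub : V' ⊆ e'.symm ⁻¹' e.source := fun y hy => hy.1.2
  have hV' : V' ⊆ chartDomain z w e' := fun y hy => by
    refine ⟨hy.1.1, ?_⟩
    rw [mem_preimage, ← e.left_inv (hsub hy)]
    exact (hV hy.2).2
  have hxV' : κ' x ∈ V' := by
    have hpx := hκ'.symm_apply hx'
    refine ⟨⟨hκ'.mem_target (κ'.map_source hx'), ?_⟩, ?_⟩
    · simpa [hpx] using (hκ x hx).1
    · simpa [hpx, ← (hκ x hx).2] using hxV
  have hτ : ContDiffOn ℝ ∞ (e ∘ e'.symm) V' :=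
    (contDiffOn_transition he' he).mono fun y hy => hy.1
  have hsτ : ContDiffOn ℝ ∞ (s ∘ e ∘ e'.symm) V' := hs.comp hτ fun y hy => hy.2
  have hev : s ∘ e ∘ e'.symm =ᶠ[𝓝 (κ' x)] (s ∘ κ) ∘ κ'.symm := by
    filter_upwards [(κ'.symm ≫ₕ κ).open_source.mem_nhds
      (by simpa [κ'.left_inv hx'] using ⟨κ'.map_source hx', hx⟩)] with y hy
    exact congrArg s ((congrArg e (hκ'.apply_symm hy.1)).symm.trans (hκ _ hy.2).2.symm)
  have H := (D.pick e' he').mono hVo' hV'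
  exact ⟨(hsτ.contDiffAt (hVo'.mem_nhds hxV')).congr_of_eventuallyEq hev.symm,
    (H.sphereAt_of_structureEqs hsτ (fun y hy => D.structureEqs_comp_transition he he' hVo hV hs h
      hVo' hV' hsub (fun y hy => hy.2) hy) hxV').congr hev⟩

theorem CoordinateData.exists_sphere [IsManifold (𝓡 2) ∞ S] (hG : GaussEquation g Q₁ Q₂)
    (he : e ∈ atlas Plane S) (hκ : IsLift p e κ)
    (hx : x ∈ κ.source) (hpx : p x ∈ z.source ∩ w.source) :
    ∃ σ : M → C3, ∀ᶠ y in 𝓝 x, IsSphereNear p g (Q₁ + Q₂) σ y := by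
  have hxU : κ x ∈ chartDomain z w e := ⟨hκ.mem_target (κ.map_source hx), by
    rwa [mem_preimage, hκ.symm_apply hx]⟩
  obtain ⟨V, hV, hVo, hxV, s, hs, h⟩ := (D.pick e he).exists_structureEqs
    (fun y hy => (D.gauss_iff he hy).1 (hG e he y hy.1)) hxU
  refine ⟨s ∘ κ, ?_⟩
  filter_upwards [(κ.isOpen_inter_preimage hVo).mem_nhds ⟨hx, hxV⟩] with x' hx'
  exact D.isSphereNear_of_structureEqs he hκ hVo hV hs h hx'.1 hx'.2

end Local

end Spheres

section Global

variable {S M : Type*} [TopologicalSpace S] [ChartedSpace Plane S] [TopologicalSpace M]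
  {p : M → S} {g : CTensor S 2} {C Q₁ Q₂ : CTensor S 3} {σ σ' : M → C3}

/-- The standard action of `SL(3, ℂ)` on `ℂ³`. -/
abbrev specialLinearAction : MulAction (Matrix.SpecialLinearGroup (Fin 3) ℂ) C3 where
  smul A v := A.1.mulVec v
  one_smul v := Matrix.one_mulVec v
  mul_smul A B v := (Matrix.mulVec_mulVec v A.1 B.1).symm

variable (g Q₁ Q₂) in
/-- The surface is covered by coordinates in which `g = l dz dw`, `Q₁ = φ dz³`, `Q₂ = ψ dw³`. -/
def HasCoordinateData : Prop :=
  ∀ x, ∃ (z w : OpenPartialHomeomorph S ℂ) (l φ ψ : S → ℂ), x ∈ z.source ∩ w.source ∧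
    CoordinateData z w l φ ψ g Q₁ Q₂

variable (D : HasCoordinateData g Q₁ Q₂) (hp : IsLocalHomeomorph p)
include D hp

theorem HasCoordinateData.existsUnique_local {x : M}
    (hσ : ∀ᶠ x' in 𝓝 x, IsSphereNear p g (Q₁ + Q₂) σ x')
    (hσ' : ∀ᶠ x' in 𝓝 x, IsSphereNear p g (Q₁ + Q₂) σ' x') :
    ∃! A : Matrix.SpecialLinearGroup (Fin 3) ℂ, ∀ᶠ y in 𝓝 x, σ' y = A.1.mulVec (σ y) := by
  obtain ⟨z, w, l, φ, ψ, hx, D'⟩ := D (p x)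
  obtain ⟨κ, hκ, hxκ⟩ := exists_isLift hp (mem_chart_source Plane (p x))
  exact D'.existsUnique_mulVec (chart_mem_atlas Plane (p x)) hκ hxκ hx hσ hσ'

theorem HasCoordinateData.existsUnique_global [ConnectedSpace M]
    (hσ : ∀ x, IsSphereNear p g (Q₁ + Q₂) σ x) (hσ' : ∀ x, IsSphereNear p g (Q₁ + Q₂) σ' x) :
    ∃! A : Matrix.SpecialLinearGroup (Fin 3) ℂ, ∀ x, σ' x = A.1.mulVec (σ x) := by
  have hloc := fun x => D.existsUnique_local hp (x := x) (.of_forall hσ) (.of_forall hσ')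
  obtain ⟨x₀⟩ : Nonempty M := inferInstance
  obtain ⟨A, hA, huniq⟩ := hloc x₀
  have hopen : IsOpen {x | ∀ᶠ y in 𝓝 x, σ' y = A.1.mulVec (σ y)} :=
    isOpen_iff_mem_nhds.2 fun x hx => hx.eventually_nhds
  have hclosed : IsClosed {x | ∀ᶠ y in 𝓝 x, σ' y = A.1.mulVec (σ y)} := by
    refine ⟨isOpen_iff_mem_nhds.2 fun x hx => ?_⟩
    obtain ⟨B, hB, -⟩ := hloc x
    filter_upwards [hB.eventually_nhds] with y hy hAy
    have hBA : B = A := (hloc y).unique hy hAy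
    exact hx (hBA ▸ hB)
  have huniv := IsClopen.eq_univ ⟨hclosed, hopen⟩ ⟨x₀, hA⟩
  exact ⟨A, fun x => (eq_univ_iff_forall.1 huniv x).self_of_nhds,
    fun B hB => huniq B (.of_forall hB)⟩

theorem HasCoordinateData.isEquivariant [ConnectedSpace M]
    (hσ : ∀ x, IsSphereNear p g (Q₁ + Q₂) σ x) : IsEquivariant p σ σ := by
  choose ρ hρ huniq using fun d : deckGroup p => D.existsUnique_global hp hσ
    (σ' := σ ∘ d.1) fun x => (hσ (d.1 x)).comp_deck d.2
  refine ⟨MonoidHom.mk' ρ fun d d' => ?_, fun d x => ⟨hρ d x, hρ d x⟩⟩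
  refine (huniq _ _ fun x => ?_).symm
  have hcomp := hρ d (d'.1 x)
  rw [show σ (d'.1 x) = _ from hρ d' x, Matrix.mulVec_mulVec] at hcomp
  exact hcomp

theorem HasCoordinateData.gauss_of_sphere (hs : Function.Surjective p)
    (hσ : ∀ x, IsSphereNear p g (Q₁ + Q₂) σ x) : GaussEquation g Q₁ Q₂ := by
  intro e he y hy
  obtain ⟨κ, hκ, hyκ⟩ := exists_isLift_of_target hp hs hy
  obtain ⟨z, w, l, φ, ψ, hx, D'⟩ := D (p (κ.symm y))
  have := D'.gauss_of_sphere he hκ (κ.map_target hyκ) hx (.of_forall hσ)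
  rwa [κ.right_inv hyκ] at this

theorem HasCoordinateData.exists_sphere [IsManifold (𝓡 2) ∞ S] [SimplyConnectedSpace M]
    (hG : GaussEquation g Q₁ Q₂) : ∃ σ : M → C3, ∀ x, IsSphereNear p g (Q₁ + Q₂) σ x := by
  have : LocallyPathConnectedSpace M := locallyPathConnectedSpace_of_isLocalHomeomorph hp
  let _ := specialLinearAction
  refine exists_global_of_local (G := Matrix.SpecialLinearGroup (Fin 3) ℂ)
    (IsSphereNear p g (Q₁ + Q₂)) (fun s s' x h hs => hs.congr h) (fun A s x hs => hs.mulVec A)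
    (fun x => ?_) fun s s' x hs hs' => D.existsUnique_local hp hs hs'
  obtain ⟨z, w, l, φ, ψ, hx, D'⟩ := D (p x)
  obtain ⟨κ, hκ, hxκ⟩ := exists_isLift hp (mem_chart_source Plane (p x))
  exact D'.exists_sphere hG (chart_mem_atlas Plane (p x)) hκ hxκ hx

theorem HasCoordinateData.exists_isEquivariantCAS_iff [IsManifold (𝓡 2) ∞ S]
    [SimplyConnectedSpace M] (hs : Function.Surjective p) (hg : IsPositiveComplexMetric g) :
    (∃ σ : M → C3, IsEquivariantCAS p g (Q₁ + Q₂) σ) ↔ GaussEquation g Q₁ Q₂ := by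
  constructor
  · rintro ⟨σ, h⟩
    exact D.gauss_of_sphere hp hs (isEquivariantCAS_iff.1 h).2.1
  · intro hG
    obtain ⟨σ, hσ⟩ := D.exists_sphere hp hG
    exact ⟨σ, isEquivariantCAS_iff.2 ⟨hg, hσ, D.isEquivariant hp hσ⟩⟩

end Global

/-! ### Conformal classes and Bers metrics -/

section ConformalClass

variable {S : Type*} [TopologicalSpace S] [ChartedSpace Plane S] [IsManifold (𝓡 2) ∞ S]
  {c₁ c₂ : ComplexStructure S} {z w : OpenPartialHomeomorph S ℂ}
  {e : OpenPartialHomeomorph S Plane} {y : Plane} {g h : CTensor S 2} {u : S → ℂ}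

theorem HasConformalClass.isPositiveComplexMetric (hc₁ : c₁.IsCompatible)
    (hc₂ : c₂.IsAntiCompatible) (hg : g.IsSmooth) (hgc : HasConformalClass g c₁ c₂) :
    IsPositiveComplexMetric g := by
  have hform : ∀ e ∈ atlas Plane S, ∀ y ∈ e.target, (gram g e y).det ≠ 0 ∧
      IsPositiveForm (gram g e y) := by
    intro e he y hy
    obtain ⟨z, hz, hxz⟩ := c₁.cover (e.symm y)
    obtain ⟨w, hw, hxw⟩ := c₂.cover (e.symm y)
    obtain ⟨l, hl, h⟩ := hgc z hz w hw _ ⟨hxz, hxw⟩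
    have hN := (isNullForm_gram_iff hz hw he ⟨hy, hxz, hxw⟩).2 h
    have hZ := hc₁.side_pos hz he hy hxz
    have hW := hc₂.side_neg hw he hy hxw
    exact ⟨hN.det_ne_zero hl (jac_ne_zero_of_side hZ hW), hN.isPositiveForm hl hZ hW⟩
  refine ⟨fun x v v' => ?_, hg, fun e he y hy => (hform e he y hy).1,
    fun e he y hy => (hform e he y hy).2⟩
  obtain ⟨z, hz, hxz⟩ := c₁.cover x
  obtain ⟨w, hw, hxw⟩ := c₂.cover x
  obtain ⟨l, -, h⟩ := hgc z hz w hw _ ⟨hxz, hxw⟩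
  rw [h, h]
  ring

omit [IsManifold (𝓡 2) ∞ S] in
theorem HasConformalClass.conformalMetric (hh : HasConformalClass h c₁ c₂) :
    HasConformalClass (conformalMetric u h) c₁ c₂ := by
  intro z hz w hw x hx
  obtain ⟨l, hl, H⟩ := hh z hz w hw x hx
  refine ⟨Complex.exp (2 * u x) * l, mul_ne_zero (Complex.exp_ne_zero _) hl, fun v v' => ?_⟩
  rw [CAS.conformalMetric, smul_apply, H, smul_eq_mul, mul_assoc]

omit [IsManifold (𝓡 2) ∞ S] in
theorem gram_conformalMetric : gram (conformalMetric u h) e =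
    fun y => Complex.exp (2 * (u ∘ e.symm) y) • gram h e y := rfl

theorem contDiffOn_comp_symm (hu : ContMDiff (𝓡 2) 𝓘(ℝ, ℂ) ∞ u) (he : e ∈ atlas Plane S) :
    ContDiffOn ℝ ∞ (u ∘ e.symm) e.target := by
  simpa using contDiffOn_comp_chart_symm he (hu.contMDiffOn (s := univ))

theorem CTensor.IsSmooth.conformalMetric (hu : ContMDiff (𝓡 2) 𝓘(ℝ, ℂ) ∞ u) (hh : h.IsSmooth) :
    (conformalMetric u h).IsSmooth := fun e he i =>
  ((contDiffOn_const.mul (contDiffOn_comp_symm hu he)).cexp).mul (hh e he i)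

omit [IsManifold (𝓡 2) ∞ S] in
theorem cubicPairing_conformalMetric (Q₁ Q₂ : CTensor S 3) (hdet : (gram h e y).det ≠ 0) :
    cubicPairing (conformalMetric u h) Q₁ Q₂ e y =
      Complex.exp (-6 * u (e.symm y)) * cubicPairing h Q₁ Q₂ e y := by
  have hinv : (gram (conformalMetric u h) e y)⁻¹ =
      Complex.exp (-2 * u (e.symm y)) • (gram h e y)⁻¹ := by
    refine Matrix.inv_eq_right_inv ?_
    rw [gram_conformalMetric, Matrix.smul_mul, Matrix.mul_smul, smul_smul, ← Complex.exp_add,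
      Matrix.mul_nonsing_inv _ (isUnit_iff_ne_zero.2 hdet)]
    simp
  have hexp : Complex.exp (-6 * u (e.symm y)) = Complex.exp (-2 * u (e.symm y)) ^ 3 := by
    rw [← Complex.exp_nat_mul]
    ring_nf
  simp only [cubicPairing, hinv, Finset.mul_sum, Matrix.smul_apply, smul_eq_mul,
    Finset.prod_mul_distrib, Finset.prod_const, Finset.card_univ, Fintype.card_fin, hexp,
    mul_assoc]

end ConformalClass

section Bers

variable {S M : Type*} [TopologicalSpace S] [ChartedSpace Plane S] [IsManifold (𝓡 2) ∞ S]
  [TopologicalSpace M] {p : M → S} {c c₁ c₂ : ComplexStructure S}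
  {z w : OpenPartialHomeomorph S ℂ} {e : OpenPartialHomeomorph S Plane}
  {κ : OpenPartialHomeomorph M Plane} {y : Plane} {f : M → ℂ} {h : CTensor S 2} {u : S → ℂ}
  {Q₁ Q₂ : CTensor S 3}

theorem HolomorphicOnCover.smoothOnCover (hp : IsLocalHomeomorph p)
    (hf : HolomorphicOnCover p c f) : SmoothOnCover p f := by
  intro e he κ hκ y hy
  obtain ⟨z, hz, hyz⟩ := c.cover (e.symm y)
  obtain ⟨ζ, hζ, hyζ, hev⟩ := hκ.exists_isLift_comp_eventuallyEq hp hy hyz f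
  have hsmooth : ContDiffAt ℝ ∞ (f ∘ ζ.symm) (z (e.symm y)) :=
    (((hf z hz ζ hζ).contDiffOn ζ.open_target).contDiffAt
      (ζ.open_target.mem_nhds hyζ)).restrict_scalars ℝ
  exact ((hsmooth.comp y (c.contDiffAt hz he (hκ.mem_target hy) hyz)).congr_of_eventuallyEq
    hev).contDiffWithinAt

theorem HolomorphicOnCover.exists_pd_eq (hp : IsLocalHomeomorph p)
    (hf : HolomorphicOnCover p c f) (hinj : Function.Injective f) (hz : z ∈ c.charts)
    (he : e ∈ atlas Plane S) (hκ : IsLift p e κ) (hy : y ∈ κ.target)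
    (hyz : e.symm y ∈ z.source) :
    ∃ a : ℂ, a ≠ 0 ∧ ∀ i, pd i (f ∘ κ.symm) y = a * pd i (z ∘ e.symm) y := by
  obtain ⟨ζ, hζ, hyζ, hev⟩ := hκ.exists_isLift_comp_eventuallyEq hp hy hyz f
  have hF := hf z hz ζ hζ
  refine ⟨deriv (f ∘ ζ.symm) (z (e.symm y)), deriv_ne_zero_of_injOn ζ.open_target hF
    (hinj.comp_injOn ζ.symm.injOn) hyζ, fun i => ?_⟩
  rw [pd_congr i hev]
  exact pd_comp_holomorphic i (hF.differentiableAt (ζ.open_target.mem_nhds hyζ))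
    ((c.contDiffAt hz he (hκ.mem_target hy) hyz).differentiableAt (by simp))

theorem IsNullForm.of_smul {G : Matrix (Fin 2) (Fin 2) ℂ} {l a b : ℂ} {Z W Z' W' : Fin 2 → ℂ}
    (hG : IsNullForm G l Z' W') (hZ : ∀ i, Z' i = a * Z i) (hW : ∀ i, W' i = b * W i) :
    IsNullForm G (l * (a * b)) Z W := by
  intro i j
  rw [hG, hZ, hZ, hW, hW]
  ring

/-- The data which a Bers metric provides on a covering surface. -/
structure BersData (p : M → S) (c₁ c₂ : ComplexStructure S) (h : CTensor S 2) (f₁ f₂ : M → ℂ) :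
    Prop where
  holomorphic_left : HolomorphicOnCover p c₁ f₁
  holomorphic_right : HolomorphicOnCover p c₂ f₂
  injective_left : Function.Injective f₁
  injective_right : Function.Injective f₂
  ne : ∀ x x', f₁ x ≠ f₂ x'
  gram_eq : ∀ e ∈ atlas Plane S, ∀ κ : OpenPartialHomeomorph M Plane, IsLift p e κ →
    ∀ y ∈ κ.target, IsNullForm (gram h e y) (-4 / (f₁ (κ.symm y) - f₂ (κ.symm y)) ^ 2)
      (fun i => pd i (f₁ ∘ κ.symm) y) (fun i => pd i (f₂ ∘ κ.symm) y)

omit [IsManifold (𝓡 2) ∞ S] in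
theorem IsBersMetric.exists_bersData (hh : IsBersMetric p c₁ c₂ h) :
    ∃ f₁ f₂ : M → ℂ, BersData p c₁ c₂ h f₁ f₂ := by
  obtain ⟨γ, ρ, f₁, f₂, -, -, -, ⟨hf₁, hf₂⟩, ⟨hinj₁, hinj₂⟩, hd, -, -, hG⟩ := hh
  exact ⟨f₁, f₂, hf₁, hf₂, hinj₁, hinj₂, fun x x' hx =>
    disjoint_left.1 hd (mem_range_self x) (hx ▸ mem_range_self x'), hG⟩

namespace BersData

variable {f₁ f₂ : M → ℂ} (B : BersData p c₁ c₂ h f₁ f₂) (hp : IsLocalHomeomorph p)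
  (hc₁ : c₁.IsCompatible) (hc₂ : c₂.IsAntiCompatible)
include B hp

theorem exists_isNullForm (hz : z ∈ c₁.charts) (hw : w ∈ c₂.charts) (he : e ∈ atlas Plane S)
    (hκ : IsLift p e κ) (hy : y ∈ κ.target) (hyz : e.symm y ∈ z.source)
    (hyw : e.symm y ∈ w.source) : ∃ a : ℂ, a ≠ 0 ∧
      IsNullForm (gram h e y) a (fun i => pd i (z ∘ e.symm) y) (fun i => pd i (w ∘ e.symm) y) := by
  obtain ⟨a, ha, hZ⟩ := B.holomorphic_left.exists_pd_eq hp B.injective_left hz he hκ hy hyz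
  obtain ⟨b, hb, hW⟩ := B.holomorphic_right.exists_pd_eq hp B.injective_right hw he hκ hy hyw
  refine ⟨_, mul_ne_zero (div_ne_zero (by norm_num) (pow_ne_zero 2 (sub_ne_zero.2 (B.ne _ _))))
    (mul_ne_zero ha hb), (B.gram_eq e he κ hκ y hy).of_smul hZ hW⟩

theorem hasConformalClass (hs : Function.Surjective p) : HasConformalClass h c₁ c₂ := by
  intro z hz w hw x hx
  obtain ⟨e, he, y, hy, rfl⟩ : ∃ e ∈ atlas Plane S, ∃ y ∈ e.target, e.symm y = x :=
    ⟨chartAt Plane x, chart_mem_atlas _ x, chartAt Plane x x, mem_chart_target Plane x,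
      (chartAt Plane x).left_inv (mem_chart_source _ x)⟩
  obtain ⟨κ, hκ, hyκ⟩ := exists_isLift_of_target hp hs hy
  obtain ⟨a, ha, hN⟩ := B.exists_isNullForm hp hz hw he hκ hyκ hx.1 hx.2
  exact ⟨a, ha, (isNullForm_gram_iff hz hw he ⟨hy, hx⟩).1 hN⟩

include hc₁ hc₂ in
theorem jac_ne_zero (he : e ∈ atlas Plane S) (hκ : IsLift p e κ) (hy : y ∈ κ.target) :
    jac (f₁ ∘ κ.symm) (f₂ ∘ κ.symm) y ≠ 0 := by
  obtain ⟨z, hz, hyz⟩ := c₁.cover (e.symm y)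
  obtain ⟨w, hw, hyw⟩ := c₂.cover (e.symm y)
  obtain ⟨a, ha, hZ⟩ := B.holomorphic_left.exists_pd_eq hp B.injective_left hz he hκ hy hyz
  obtain ⟨b, hb, hW⟩ := B.holomorphic_right.exists_pd_eq hp B.injective_right hw he hκ hy hyw
  have hJ : jac (z ∘ e.symm) (w ∘ e.symm) y ≠ 0 := jac_ne_zero_of_side
    (hc₁.side_pos hz he (hκ.mem_target hy) hyz) (hc₂.side_neg hw he (hκ.mem_target hy) hyw)
  convert mul_ne_zero (mul_ne_zero ha hb) hJ using 1
  rw [jac, jac, hZ, hZ, hW, hW]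
  ring

include hc₁ hc₂ in
theorem nullMetric (he : e ∈ atlas Plane S) (hκ : IsLift p e κ) :
    NullMetric κ.target (f₁ ∘ κ.symm) (f₂ ∘ κ.symm)
      (fun y => -4 / ((f₁ ∘ κ.symm) y - (f₂ ∘ κ.symm) y) ^ 2) (gram h e) := by
  have hsmooth₁ := B.holomorphic_left.smoothOnCover hp e he κ hκ
  have hsmooth₂ := B.holomorphic_right.smoothOnCover hp e he κ hκ
  have hne : ∀ y, (f₁ ∘ κ.symm) y - (f₂ ∘ κ.symm) y ≠ 0 := fun y => sub_ne_zero.2 (B.ne _ _)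
  exact ⟨⟨κ.open_target, hsmooth₁, hsmooth₂, fun y hy => B.jac_ne_zero hp hc₁ hc₂ he hκ hy⟩,
    contDiffOn_div contDiffOn_const ((hsmooth₁.sub hsmooth₂).pow 2) fun y _ =>
      pow_ne_zero 2 (hne y),
    fun y _ => div_ne_zero (by norm_num) (pow_ne_zero 2 (hne y)), B.gram_eq e he κ hκ⟩

include hc₁ hc₂ in
theorem isSmooth (hs : Function.Surjective p) : h.IsSmooth := by
  intro e he i y hy
  obtain ⟨κ, hκ, hyκ⟩ := exists_isLift_of_target hp hs hy
  have N := B.nullMetric hp hc₁ hc₂ he hκ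
  have dz := fun i => N.smooth_pd i N.smooth_z
  have dw := fun i => N.smooth_pd i N.smooth_w
  have hsmooth : ContDiffOn ℝ ∞ (fun y => gram h e y (i 0) (i 1)) κ.target :=
    (N.smooth_l.mul (contDiffOn_const.mul (((dz (i 0)).mul (dw (i 1))).add
      ((dw (i 0)).mul (dz (i 1)))))).congr fun y hy => N.form y hy (i 0) (i 1)
  simp only [CTensor.coeff_eq_gram]
  exact (hsmooth.contDiffAt (κ.open_target.mem_nhds hyκ)).contDiffWithinAt

include hc₁ hc₂ in
theorem gaussEquation_conformalMetric_iff (hs : Function.Surjective p)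
    (hu : ContMDiff (𝓡 2) 𝓘(ℝ, ℂ) ∞ u) :
    GaussEquation (conformalMetric u h) Q₁ Q₂ ↔ GaussPDE h Q₁ Q₂ u := by
  refine forall₂_congr fun e he => forall₂_congr fun y hy => ?_
  obtain ⟨κ, hκ, hyκ⟩ := exists_isLift_of_target hp hs hy
  have N := B.nullMetric hp hc₁ hc₂ he hκ
  have hu' : ContDiffOn ℝ ∞ (u ∘ e.symm) κ.target :=
    (contDiffOn_comp_symm hu he).mono fun y hy => hκ.mem_target hy
  have hdet := (N.form y hyκ).det_ne_zero (N.l_ne y hyκ) (N.jac_ne y hyκ)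
  rw [cubicPairing_conformalMetric Q₁ Q₂ hdet, gram_conformalMetric,
    N.curvature_exp_smul hu' hyκ, N.curvature_eq_neg_one (fun y _ => B.ne _ _) hyκ]
  set E := Complex.exp (u (e.symm y)) with hE
  have hE0 : E ≠ 0 := Complex.exp_ne_zero _
  have exp_two_mul : Complex.exp (2 * u (e.symm y)) = E ^ 2 := by
    rw [hE, ← Complex.exp_nat_mul]; norm_num
  have exp_neg_four_mul : Complex.exp (-4 * u (e.symm y)) = (E ^ 4)⁻¹ := by
    rw [hE, ← Complex.exp_nat_mul, ← Complex.exp_neg]; norm_num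
  have exp_neg_six_mul : Complex.exp (-6 * u (e.symm y)) = (E ^ 6)⁻¹ := by
    rw [hE, ← Complex.exp_nat_mul, ← Complex.exp_neg]; norm_num
  rw [Complex.exp_neg, Function.comp_apply, exp_two_mul, exp_neg_four_mul, exp_neg_six_mul]
  generalize laplacian (gram h e) (u ∘ e.symm) y = L
  generalize cubicPairing h Q₁ Q₂ e y = K
  field_simp
  constructor <;> intro H <;> linear_combination (-1 : ℂ) * H

end BersData

end Bers

end CAS

end

theorem mainTheorem7_general {S M : Type*}
    [TopologicalSpace S] [ChartedSpace Plane S] [IsManifold (𝓡 2) ∞ S]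
    [TopologicalSpace M] [SimplyConnectedSpace M]
    (p : M → S) (hp : IsLocalHomeomorph p) (hp_surj : Function.Surjective p)
    (c₁ c₂ : ComplexStructure S) (hc₁ : c₁.IsCompatible) (hc₂ : c₂.IsAntiCompatible)
    (Q₁ Q₂ : CTensor S 3) (hQ₁ : IsHolomorphicCubic c₁ Q₁) (hQ₂ : IsHolomorphicCubic c₂ Q₂) :
    (∀ g : CTensor S 2, IsPositiveComplexMetric g → HasConformalClass g c₁ c₂ →
      ((∃ σ : M → C3, IsEquivariantCAS p g (Q₁ + Q₂) σ) ↔ GaussEquation g Q₁ Q₂) ∧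
      (∀ σ σ' : M → C3, IsEquivariantCAS p g (Q₁ + Q₂) σ → IsEquivariantCAS p g (Q₁ + Q₂) σ' →
        ∃ A : Matrix.SpecialLinearGroup (Fin 3) ℂ, ∀ x, σ' x = A.1.mulVec (σ x))) ∧
    (∀ (h : CTensor S 2) (u : S → ℂ), IsBersMetric p c₁ c₂ h →
      ContMDiff (𝓡 2) 𝓘(ℝ, ℂ) ∞ u →
      ((∃ σ : M → C3, IsEquivariantCAS p (conformalMetric u h) (Q₁ + Q₂) σ) ↔
        GaussPDE h Q₁ Q₂ u)) := by
  have hD : ∀ g : CTensor S 2, IsPositiveComplexMetric g → HasConformalClass g c₁ c₂ →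
      HasCoordinateData g Q₁ Q₂ := fun g hg hgc x =>
    exists_coordinateData hc₁ hc₂ hQ₁ hQ₂ hg.smooth hgc x
  refine ⟨fun g hg hgc => ⟨(hD g hg hgc).exists_isEquivariantCAS_iff hp hp_surj hg,
    fun σ σ' hσ hσ' => ?_⟩, fun h u hh hu => ?_⟩
  · obtain ⟨A, hA, -⟩ := (hD g hg hgc).existsUnique_global hp (isEquivariantCAS_iff.1 hσ).2.1
      (isEquivariantCAS_iff.1 hσ').2.1
    exact ⟨A, hA⟩
  · obtain ⟨f₁, f₂, B⟩ := hh.exists_bersData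
    have hgc := (B.hasConformalClass hp hp_surj).conformalMetric (u := u)
    have hg := hgc.isPositiveComplexMetric hc₁ hc₂
      ((B.isSmooth hp hc₁ hc₂ hp_surj).conformalMetric hu)
    rw [(hD _ hg hgc).exists_isEquivariantCAS_iff hp hp_surj hg,
      B.gaussEquation_conformalMetric_iff hp hc₁ hc₂ hp_surj hu]

theorem mainTheorem7 {S M : Type*}
    -- `S` is a closed oriented (smooth) surface
    [TopologicalSpace S] [T2Space S] [CompactSpace S] [ConnectedSpace S]
    [ChartedSpace Plane S] [IsManifold (𝓡 2) ∞ S] (hS : IsOrientedAtlas S)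
    -- `p : M → S` is its universal covering
    [TopologicalSpace M] [SimplyConnectedSpace M]
    (p : M → S) (hp : IsCoveringMap p) (hp_surj : Function.Surjective p)
    -- complex structures on `S` and on the oppositely oriented surface
    (c₁ c₂ : ComplexStructure S) (hc₁ : c₁.IsCompatible) (hc₂ : c₂.IsAntiCompatible)
    -- holomorphic cubic differentials
    (Q₁ Q₂ : CTensor S 3) (hQ₁ : IsHolomorphicCubic c₁ Q₁) (hQ₂ : IsHolomorphicCubic c₂ Q₂) :
    (∀ g : CTensor S 2, IsPositiveComplexMetric g → HasConformalClass g c₁ c₂ →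
      ((∃ σ : M → C3, IsEquivariantCAS p g (Q₁ + Q₂) σ) ↔ GaussEquation g Q₁ Q₂) ∧
      (∀ σ σ' : M → C3, IsEquivariantCAS p g (Q₁ + Q₂) σ → IsEquivariantCAS p g (Q₁ + Q₂) σ' →
        ∃ A : Matrix.SpecialLinearGroup (Fin 3) ℂ, ∀ x, σ' x = A.1.mulVec (σ x))) ∧
    (∀ (h : CTensor S 2) (u : S → ℂ), IsBersMetric p c₁ c₂ h →
      ContMDiff (𝓡 2) 𝓘(ℝ, ℂ) ∞ u →
      ((∃ σ : M → C3, IsEquivariantCAS p (conformalMetric u h) (Q₁ + Q₂) σ) ↔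
        GaussPDE h Q₁ Q₂ u)) :=
  mainTheorem7_general p hp.isLocalHomeomorph hp_surj c₁ c₂ hc₁ hc₂ Q₁ Q₂ hQ₁ hQ₂
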